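/- **Setting.** Let $p$ be a prime, $q=p^a$, $f\in\mathbf F_q[x_1,\dots,x_n]$ of degree $\delta$, let $e$ be an integer with $1\le e\le\delta$, let $m\in\{0,1,\dots,n\}$, and let $b$ be a rational number with $$\frac{\delta}{(p-1)(\delta-e+1)}<b<\frac{p\delta}{(p-1)\delta+e-1}.$$ *The spectral sequence of $f$.* Let $\Omega^k$ be the module of differential $k$-forms of $\mathbf F_q[x_1,\dots,x_n]$ over $\mathbf F_q$. A $k$-form is homogeneous if its coefficients are all homogeneous of one degree $c$; its degree is then $c+(n-k)(\delta-1)$. Let $F_l\Omega^k$ be the span of the homogeneous $k$-forms of degree $\le l$, and let $E_t^{r,s}$ be the spectral sequence of the filtered complex $(\Omega^\bullet,\ df\wedge\cdot)$, $E_1^{r,s}=H^{r+s}(F_r/F_{r-1})$. *Dwork's complex.* Let $\mathbf C_p$ be the completion of an algebraic closure of $\mathbf Q_p$, let $\mathrm{ord}$ be its valuation with $\mathrm{ord}\,p=1$, let $\zeta_p\in\mathbf C_p$ be a primitive $p$-th root of unity, $\Omega_1=\mathbf Q_p(\zeta_p)$, $K=\mathbf Q_p(\mu_{q-1})$ the unramified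 extension of $\mathbf Q_p$ of degree $a$. Choose a positive integer $M$ such that $Mb/p$ and $M\delta/(p(p-1))$ are integers and $\pi\in\mathbf C_p$ with $\pi^{M\delta}=-p$ (if $p=2$ or $a$ is even, $\pi^{M\delta}=p$ is also allowed). Put $\tilde\Omega_0=K(\zeta_p,\pi)$, with ring of integers $\mathcal O$, and identify the residue field of $\mathcal O$ with $\mathbf F_q$. Let $\gamma\in\Omega_1$ satisfy $\sum_{i\ge0}\gamma^{p^i}/p^i=0$ and $\mathrm{ord}\,\gamma=1/(p-1)$, let $\gamma_l=\sum_{i=0}^{l}\gamma^{p^i}/p^i$, let $\hat f=\sum_u\hat a_ux^u$ be the Teichmüller lifting of $f$ ($\hat a_u\in\mathcal O$, $\hat a_u^q=\hat a_u$, $\hat f$ reduces to $f$), let $\hat f^{\tau^l}=\sum_u\hat a_u^{p^l}x^u$ and $\hat f_i^{\tau^l}=\partial\hat f^{\tau^l}/\partial x_i$. Put $\epsilon=Mb(\delta-1)-M\delta/(p-1)$ and $$C(b)=\Bigl\{\sum_{u\in\mathbf N^n}A_u\pi^{Mb|u|}x^u \Bigm| A_u\in\tilde\Omega_0,\ A_u\to0\Bigr\},\qquad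 D_i=\pi^\epsilon\Bigl(\frac{\partial}{\partial x_i}+H_i\Bigr),\qquad H_i=\sum_{l\ge0}\gamma_lp^lx_i^{p^l-1}\hat f_i^{\tau^l}(x_1^{p^l},\dots,x_n^{p^l}).$$ Let $\Omega^k_{C(b)}=\bigoplus_{i_1<\dots<i_k}C(b)\,dx_{i_1}\wedge\dots\wedge dx_{i_k}$, with differential $D(\xi\,dx_{i_1}\wedge\dots\wedge dx_{i_k})=(\sum_iD_i(\xi)dx_i)\wedge dx_{i_1}\wedge\dots\wedge dx_{i_k}$. Let $\hat F^r\Omega^k_{C(b)}$ be the set of the forms all of whose coefficients have $A_u\in\pi^r\mathcal O$ for all $u$ (filtration by $p$-divisibility, $r\in\mathbf Z$), and let $\hat E^{r,s}_t$ be the spectral sequence of this filtered complex: with $Z^{r,s}_t=\{\omega\in\hat F^r\Omega^{r+s}_{C(b)} : D\omega\in\hat F^{r+t}\Omega^{r+s+1}_{C(b)}\}$, $$\hat E^{r,s}_t=\frac{Z^{r,s}_t+\hat F^{r+1}\Omega^{r+s}_{C(b)}}{D(Z^{r-t+1,s+t-2}_{t-1})+\hat F^{r+1}\Omega^{r+s}_{C(b)}}.$$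 For $\omega\in\hat F^0\Omega^m_{C(b)}$ let $\mathrm{red}(\omega)\in\Omega^m$ be the form obtained by replacing each $A_u\pi^{Mb|u|}x^u$ by $\bar A_ux^u$, where $\bar A_u\in\mathbf F_q$ is the residue class of $A_u$. **Theorem 3.1.** Let $\{\phi_i\}_{i\in I}\subseteq\Omega^m$ be homogeneous $m$-forms such that for each $r\ge0$ the classes $\{[\phi_i]\}_{\deg\phi_i=r}$ form a basis of $E_e^{r,m-r}$ as $\mathbf F_q$-vector space. Let $\{\tilde\phi_i\}_{i\in I}\subseteq\hat F^0\Omega^m_{C(b)}$ satisfy $\mathrm{red}(\tilde\phi_i)=\phi_i$ for all $i\in I$. Then for each $r\in\mathbf Z$ the classes $\{[\pi^r\tilde\phi_i]\}_{i\in I}$ form a basis of $\hat E^{r,m-r}_{Mb(e-1)+1}$ as $\mathbf F_q$-vector space. -/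

import Mathlib

open MvPolynomial

noncomputable section

namespace DworkSS

/-! ### Differential forms in coordinates -/

/-- Differential forms of all degrees in `n` variables with coefficients in `A`. The form
`∑_S ω(S) dx_S`, where `dx_S = dx_{i₁} ∧ ⋯ ∧ dx_{i_k}` for `S = {i₁ < ⋯ < i_k}`, is stored as
the family of its coefficients `ω(S)`. -/
abbrev Form (n : ℕ) (A : Type*) : Type _ := Finset (Fin n) → A

/-- The `k`-forms all of whose coefficients lie in the submodule `P` of `A`. -/
def kForms {R A : Type*} [CommRing R] [AddCommGroup A] [Module R A] (n k : ℕ)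
    (P : Submodule R A) : Submodule R (Form n A) where
  carrier := {ω | (∀ S, ω S ∈ P) ∧ ∀ S, S.card ≠ k → ω S = 0}
  add_mem' := fun {x y} hx hy =>
    ⟨fun S => P.add_mem (hx.1 S) (hy.1 S), fun S hS => by
      simp [hx.2 S hS, hy.2 S hS]⟩
  zero_mem' := ⟨fun _ => P.zero_mem, fun _ _ => rfl⟩
  smul_mem' := fun c x hx =>
    ⟨fun S => P.smul_mem c (hx.1 S), fun S hS => by simp [hx.2 S hS]⟩

/-- The operator `ξ dx_S ↦ (∑ᵢ Dᵢ(ξ) dxᵢ) ∧ dx_S` attached to linear operators `D₁, …, Dₙ`.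
The coefficient of `dx_T` in the image of `ω` collects the terms `S = T \ {i}`, `i ∈ T`, with the
sign of `dxᵢ ∧ dx_S = ± dx_T`. -/
def formDiff {R A : Type*} [CommRing R] [AddCommGroup A] [Module R A] {n : ℕ}
    (D : Fin n → A →ₗ[R] A) : Form n A →ₗ[R] Form n A where
  toFun ω T := ∑ i ∈ T, (-1 : ℤ) ^ (T.filter (fun j => j < i)).card • D i (ω (T.erase i))
  map_add' x y := by
    funext T
    simp [Finset.sum_add_distrib]
  map_smul' c x := by
    funext T
    simp only [Pi.smul_apply, map_smul, RingHom.id_apply, Finset.smul_sum]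
    exact Finset.sum_congr rfl fun i _ => smul_comm _ _ _

/-! ### The spectral sequence of a filtered complex

The complex is given by a linear map `d : X → X`, and `Fil r k` is the `r`-th step of a decreasing
filtration on its degree `k` part (`r ∈ ℤ`, `k ∈ ℕ`). There is nothing in negative degrees. -/

/-- `Z_t^{r,k-r} = {ω ∈ F^r X^k | d ω ∈ F^{r+t} X^{k+1}}`. -/
def cycles {R X : Type*} [CommRing R] [AddCommGroup X] [Module R X] (d : X →ₗ[R] X)
    (Fil : ℤ → ℕ → Submodule R X) (t r : ℤ) (k : ℕ) : Submodule R X :=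
  Fil r k ⊓ (Fil (r + t) (k + 1)).comap d

/-- The numerator `Z_t^{r,k-r} + F^{r+1} X^k` of `E_t^{r,k-r}`. -/
def pageNum {R X : Type*} [CommRing R] [AddCommGroup X] [Module R X] (d : X →ₗ[R] X)
    (Fil : ℤ → ℕ → Submodule R X) (t r : ℤ) (k : ℕ) : Submodule R X :=
  cycles d Fil t r k ⊔ Fil (r + 1) k

/-- The denominator `d(Z_{t-1}^{r-t+1,k-1-(r-t+1)}) + F^{r+1} X^k` of `E_t^{r,k-r}`, where the
cycles are taken in degree `j = k - 1` (there are none if `k = 0`). -/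
def pageDen {R X : Type*} [CommRing R] [AddCommGroup X] [Module R X] (d : X →ₗ[R] X)
    (Fil : ℤ → ℕ → Submodule R X) (t r : ℤ) (k : ℕ) : Submodule R X :=
  (⨆ (j : ℕ) (_ : j + 1 = k), (cycles d Fil (t - 1) (r - t + 1) j).map d) ⊔ Fil (r + 1) k

/-- The quotient module `P / Q` of two submodules of `X` (in the cases of interest `Q ≤ P`). -/
abbrev SubQuot {R X : Type*} [CommRing R] [AddCommGroup X] [Module R X] (P Q : Submodule R X) :
    Type _ := P ⧸ Q.submoduleOf P

/-- The term `E_t^{r,k-r}` (of total degree `k`) of the spectral sequence. -/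
abbrev Page {R X : Type*} [CommRing R] [AddCommGroup X] [Module R X] (d : X →ₗ[R] X)
    (Fil : ℤ → ℕ → Submodule R X) (t r : ℤ) (k : ℕ) : Type _ :=
  SubQuot (pageNum d Fil t r k) (pageDen d Fil t r k)

/-- The elements `v i` of `X` lie in the numerator of `E_t^{r,k-r}`, and their classes form a basis
of this `R`-module. -/
def ClassesFormBasis {R X ι : Type*} [CommRing R] [AddCommGroup X] [Module R X] (d : X →ₗ[R] X)
    (Fil : ℤ → ℕ → Submodule R X) (t r : ℤ) (k : ℕ) (v : ι → X) : Prop :=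
  ∃ B : Module.Basis ι R (Page d Fil t r k),
    ∀ i, ∃ h : v i ∈ pageNum d Fil t r k, B i = Submodule.Quotient.mk ⟨v i, h⟩

/-- Given `ρ : R → k₀` onto a field, `E_t^{r,k-r}` is a `k₀`-vector space via `ρ` (that is, the
action of `R` factors through `ρ`), the elements `v i` lie in its numerator, and their classes form
a `k₀`-basis. -/
def ClassesFormBasisOver {R k₀ X ι : Type*} [CommRing R] [Field k₀] (ρ : R →+* k₀)
    [AddCommGroup X] [Module R X] (d : X →ₗ[R] X)
    (Fil : ℤ → ℕ → Submodule R X) (t r : ℤ) (k : ℕ) (v : ι → X) : Prop :=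
  ∃ _ : Module k₀ (Page d Fil t r k),
    (∀ (c : R) (x : Page d Fil t r k), ρ c • x = c • x) ∧
    ∃ B : Module.Basis ι k₀ (Page d Fil t r k),
      ∀ i, ∃ h : v i ∈ pageNum d Fil t r k, B i = Submodule.Quotient.mk ⟨v i, h⟩

/-! ### The filtered complex `(Ω^•_{F[x]/F}, df ∧ ·)` -/

/-- The map `ω ↦ df ∧ ω` on polynomial differential forms. -/
def wedgeDf {F : Type*} [Field F] {n : ℕ} (f : MvPolynomial (Fin n) F) :
    Form n (MvPolynomial (Fin n) F) →ₗ[F] Form n (MvPolynomial (Fin n) F) :=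
  formDiff fun i => LinearMap.mulLeft F (pderiv i f)

/-- `ω` is a `k`-form all of whose coefficients are homogeneous of degree `l`. -/
def IsHomogeneousForm {F : Type*} [Field F] {n : ℕ} (k l : ℕ)
    (ω : Form n (MvPolynomial (Fin n) F)) : Prop :=
  ω ∈ kForms (R := F) n k ⊤ ∧ ∀ S, (ω S).IsHomogeneous l

/-- The increasing filtration `F_l Ω^k`: the span of the homogeneous `k`-forms of degree at most
`l`, where a `k`-form with coefficients homogeneous of degree `c` has degree `c + (n-k)(δ-1)`. -/
def polyFil {F : Type*} [Field F] (n δ : ℕ) (l : ℤ) (k : ℕ) :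
    Submodule F (Form n (MvPolynomial (Fin n) F)) :=
  Submodule.span F
    {ω | ∃ c : ℕ, IsHomogeneousForm k c ω ∧ ((c + (n - k) * (δ - 1) : ℕ) : ℤ) ≤ l}

/-- The classes of the forms `v i` are a basis of the term `E_e^{r,k-r}` of the spectral sequence of
`(Ω^•, df ∧ ·)` with its increasing filtration `F_l`, `E_1^{r,k-r} = H^k(F_r / F_{r-1})`. The
increasing filtration `F_l` is the decreasing filtration `s ↦ F_{-s}`, with `s = -r`. -/
def PolyBasis {F ι : Type*} [Field F] {n : ℕ} (f : MvPolynomial (Fin n) F) (e r : ℤ) (k : ℕ)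
    (v : ι → Form n (MvPolynomial (Fin n) F)) : Prop :=
  ClassesFormBasis (wedgeDf f) (fun s k => polyFil n f.totalDegree (-s) k) e (-r) k v

/-! ### The `p`-adic fields -/

/-- The unramified extension `K = ℚ_p(μ_{q-1})` of `ℚ_p` of degree `a`, `q = p ^ a`. -/
def unramifiedField (p a : ℕ) [Fact p.Prime] : IntermediateField ℚ_[p] ℂ_[p] :=
  IntermediateField.adjoin ℚ_[p] {x : ℂ_[p] | x ^ (p ^ a - 1) = 1}

/-- The field `Ω₁ = ℚ_p(ζ)`. -/
def omegaOne (p : ℕ) [Fact p.Prime] (ζ : ℂ_[p]) : IntermediateField ℚ_[p] ℂ_[p] :=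
  IntermediateField.adjoin ℚ_[p] {ζ}

/-- The field `Ω̃₀ = K(ζ, π)`. -/
def omegaTilde (p a : ℕ) [Fact p.Prime] (ζ π : ℂ_[p]) : IntermediateField ℚ_[p] ℂ_[p] :=
  unramifiedField p a ⊔ omegaOne p ζ ⊔ IntermediateField.adjoin ℚ_[p] {π}

/-- `π` as an element of `Ω̃₀`. -/
def piElt (p a : ℕ) [Fact p.Prime] (ζ π : ℂ_[p]) : omegaTilde p a ζ π :=
  ⟨π, (le_sup_right : IntermediateField.adjoin ℚ_[p] {π} ≤ omegaTilde p a ζ π)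
    (IntermediateField.mem_adjoin_simple_self ℚ_[p] π)⟩

instance (p a : ℕ) [Fact p.Prime] (ζ π : ℂ_[p]) : IsUltrametricDist (omegaTilde p a ζ π) :=
  IsUltrametricDist.subtype _

/-- The ring of integers `{x | ‖x‖ ≤ 1}` of an ultrametric normed field. -/
abbrev integerRing (L : Type*) [NormedField L] [IsUltrametricDist L] : ValuationSubring L :=
  (NormedField.valuation (K := L)).valuationSubring

/-! ### Dwork's complex -/

section Dwork

variable {L : Type*} [NormedField L] [IsUltrametricDist L] {n : ℕ}

/-- For `ξ = ∑_u A_u π^{N|u|} x^u`, the coefficient `A_u`. -/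
def normCoeff (π : L) (N : ℕ) (u : Fin n →₀ ℕ) (ξ : MvPowerSeries (Fin n) L) : L :=
  MvPowerSeries.coeff u ξ / π ^ (N * u.degree)

/-- The filtration step `F̂^r C(b)` of the space
`C(b) = {∑_u A_u π^{N|u|} x^u | A_u ∈ L, A_u → 0}`, where `N = M b`: the series in `C(b)` with
`A_u ∈ π^r 𝒪_L` for all `u`. -/
def dworkFil (π : L) (N : ℕ) (r : ℤ) : Submodule (integerRing L) (MvPowerSeries (Fin n) L) where
  carrier := {ξ | Filter.Tendsto (fun u => normCoeff π N u ξ) Filter.cofinite (nhds 0) ∧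
    ∀ u, ∃ c : integerRing L, normCoeff π N u ξ = π ^ r * c}
  add_mem' := by
    rintro x y ⟨hx, hx'⟩ ⟨hy, hy'⟩
    refine ⟨?_, fun u => ?_⟩
    · simpa [normCoeff, add_div] using hx.add hy
    · obtain ⟨c, hc⟩ := hx' u
      obtain ⟨d, hd⟩ := hy' u
      refine ⟨c + d, ?_⟩
      have : normCoeff π N u (x + y) = normCoeff π N u x + normCoeff π N u y := by
        simp [normCoeff, add_div]
      rw [this, hc, hd]
      push_cast
      ring
  zero_mem' := by
    refine ⟨?_, fun u => ⟨0, by simp [normCoeff]⟩⟩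
    simp only [normCoeff, map_zero, zero_div]
    exact tendsto_const_nhds
  smul_mem' := by
    rintro a x ⟨hx, hx'⟩
    have key : ∀ u, normCoeff π N u (a • x) = (a : L) * normCoeff π N u x := by
      intro u
      have : MvPowerSeries.coeff u (a • x) = (a : L) * MvPowerSeries.coeff u x := rfl
      rw [normCoeff, this, mul_div_assoc, normCoeff]
    refine ⟨?_, fun u => ?_⟩
    · simpa [key] using hx.const_mul (a : L)
    · obtain ⟨c, hc⟩ := hx' u
      refine ⟨a * c, ?_⟩
      rw [key, hc]
      push_cast
      ring

/-- The filtration `F̂^r Ω^k_{C(b)}` of the forms with coefficients in `C(b)`. -/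
def dworkFormFil (n : ℕ) (π : L) (N : ℕ) (r : ℤ) (k : ℕ) :
    Submodule (integerRing L) (Form n (MvPowerSeries (Fin n) L)) :=
  kForms n k (dworkFil π N r)

/-- `γ_l = ∑_{i=0}^l γ^{p^i} / p^i`. -/
def gammaPartial (p : ℕ) (γ : L) (l : ℕ) : L :=
  ∑ i ∈ Finset.range (l + 1), γ ^ p ^ i / (p : L) ^ i

/-- The polynomial `f̂^{τ^l}`, `τ` the Frobenius automorphism, for a polynomial `f̂` with
Teichmüller coefficients: `τ` maps a Teichmüller representative to its `p`-th power. -/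
def frobTwist (p : ℕ) (fhat : MvPolynomial (Fin n) L) (l : ℕ) : MvPolynomial (Fin n) L :=
  ∑ u ∈ fhat.support, monomial u (coeff u fhat ^ p ^ l)

/-- `H_i = ∑_{l ≥ 0} γ_l p^l x_i^{p^l - 1} f̂_i^{τ^l}(x^{p^l})`, where `f̂_i = ∂f̂/∂x_i`.
The `l`-th term is divisible by `x_i^{p^l - 1}`, so that the sum is finite in each coefficient. -/
def dworkH (p : ℕ) (γ : L) (fhat : MvPolynomial (Fin n) L) (i : Fin n) :
    MvPowerSeries (Fin n) L := fun u =>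
  ∑ᶠ l : ℕ, coeff u (C (gammaPartial p γ l * (p : L) ^ l) * X i ^ (p ^ l - 1) *
    expand (p ^ l) (pderiv i (frobTwist p fhat l)))

/-- The operator `D_i = π^ε ∂/∂x_i + π^ε H_i`. -/
def dworkDi (p : ℕ) (π γ : L) (ε : ℤ) (fhat : MvPolynomial (Fin n) L) (i : Fin n) :
    MvPowerSeries (Fin n) L →ₗ[integerRing L] MvPowerSeries (Fin n) L :=
  (π ^ ε • ((MvPowerSeries.pderiv L i).toLinearMap +
    LinearMap.mulLeft L (dworkH p γ fhat i))).restrictScalars (integerRing L)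

/-- The differential `D(ξ dx_S) = (∑ᵢ Dᵢ(ξ) dxᵢ) ∧ dx_S` of Dwork's complex. -/
def dworkD (p : ℕ) (π γ : L) (ε : ℤ) (fhat : MvPolynomial (Fin n) L) :
    Form n (MvPowerSeries (Fin n) L) →ₗ[integerRing L] Form n (MvPowerSeries (Fin n) L) :=
  formDiff (dworkDi p π γ ε fhat)

/-- `f̂` is the Teichmüller lifting of `f`, with respect to the reduction map `ρ : 𝒪_L → F`:
`f̂` reduces to `f` and its coefficients satisfy `c^q = c`. -/
def IsTeichmuellerLift {F : Type*} [Field F] (ρ : integerRing L →+* F) (q : ℕ)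
    (fhat : MvPolynomial (Fin n) (integerRing L)) (f : MvPolynomial (Fin n) F) : Prop :=
  (∀ u, coeff u fhat ^ q = coeff u fhat) ∧ map ρ fhat = f

/-- `ω` is an `m`-form in `F̂^0 Ω^m_{C(b)}` and `red(ω) = φ`: the coefficients `A_u(S)` of `ω` are
integral and reduce to the coefficients of `φ`. -/
def Reduces {F : Type*} [Field F] (ρ : integerRing L →+* F) (π : L) (N m : ℕ)
    (ω : Form n (MvPowerSeries (Fin n) L)) (φ : Form n (MvPolynomial (Fin n) F)) : Prop :=
  ω ∈ dworkFormFil n π N 0 m ∧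
    ∀ S u, ∃ c : integerRing L, normCoeff π N u (ω S) = c ∧ ρ c = coeff u (φ S)

end Dwork

end DworkSS

end

noncomputable section

namespace DworkSS

set_option linter.unusedSectionVars false

/-! ### Rings of integers -/

section Unif

variable {L : Type*} [NormedField L] [IsUltrametricDist L]

/-! Write N = Mb, v = Mδ, d = δ - 1, G = Mδ/(p - 1). The proof has an arithmetic half and an
algebraic half.

Arithmetic: π is a uniformizer of Ω̃₀ (`isUnif_omegaTilde`), with ord_π p = v and ord_π γ = G. Put θ
= γ/π^G, a unit. The operator π^ε(∂/∂xᵢ + Hᵢ) equals θ π^(Nd) ∂f̂/∂xᵢ plus terms divisible by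
π^(N(e-1)+1). The lower bound on b is what makes the derivative term this small, and the upper bound
does the same for the terms l ≥ 1 of Hᵢ (`exponent_bounds`, `dworkDi_sub_mem`). So up to page
N(e-1)+1 Dwork's differential may be replaced by the leading part θ π^(Nd) df̂ ∧ ·.

Algebra: in normalized coefficients A_u, multiplication by π^(Nd) g with deg g ≤ d multiplies the
contribution of a monomial of degree d - j by π^(Nj). Losing j degrees therefore costs exactly
π^(Nj), and the p-divisibility filtration follows the degree filtration of (Ω^•, df ∧ ·), one degree
step being worth N steps of π.

From p-adic forms to polynomial forms, fix c and take from each A_u the π-adic digit of index N(c -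
|u|), for 0 ≤ c - |u| < e. This diagonal of digits is a polynomial form whose top part is the degree
c part of the reduction, and df ∧ acts on it as the leading part acts on digits
(`dig_normCoeff_mul`, `dig_normCoeff_leadMap`). Digits are additive, and linear over Teichmüller
elements, as long as their index is below v, because carries are divisible by p. This is why N(e-1)
< v is needed. From polynomial forms to p-adic forms, lift the coefficients and multiply by π^(Nc).
The wedge of the lifts agrees with the lift of the wedge modulo p, and p is again too divisible to
matter.

With these two constructions, cycles and boundaries of Ê modulo F̂¹ correspond, through the
homogeneous parts of the reduction, to cycles and boundaries of E_e (`homPart_mem_pageNum`,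
`homPart_mem_pageDen`, `exists_cycle_of_mem_pageNum`, `exists_boundary_of_mem`). Since D commutes
with π^r, only r = 0 has to be considered. A reduction is a finite sum of homogeneous parts, so the
bases in all degrees of E_e together give a basis of one term of Ê. -/

theorem mem_integerRing {x : L} : x ∈ integerRing L ↔ ‖x‖ ≤ 1 := by
  simp only [integerRing]
  rfl

/-- The hypotheses on the coefficient field: `π` is a uniformizer of `L`, the residue field map is
`ρ`, `p` has the norm of `π ^ v`, and the residue field is represented by fixed points
of `x ↦ x ^ q`. -/
structure IsUnif {F : Type*} [Field F] (p q v : ℕ) (π : L) (ρ : integerRing L →+* F) : Prop where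
  prime : p.Prime
  norm_pos : 0 < ‖π‖
  norm_lt : ‖π‖ < 1
  gap : ∀ x : L, ‖x‖ < 1 → ‖x‖ ≤ ‖π‖
  ker : ∀ x : integerRing L, ρ x = 0 ↔ ‖(x : L)‖ < 1
  norm_p : ‖(p : L)‖ = ‖π‖ ^ v
  v_pos : 0 < v
  pow : ∃ a, a ≠ 0 ∧ q = p ^ a
  lift : ∀ y : F, ∃ x : integerRing L, ρ x = y ∧ x ^ q = x

/-- If `x ^ q - x` is divisible by `π` in a ring `R` of elements of norm at most `1`, for all `x`
in `R`, then the norms of the nonzero elements of `R` are powers of `‖π‖`. -/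
theorem norm_eq_pow_of_frobenius {K : Type*} [NormedField K] [IsUltrametricDist K]
    (R : Subring K) (π : K) (q : ℕ) (hq : 1 < q) (hπ : ‖π‖ < 1) (hR : ∀ x ∈ R, ‖x‖ ≤ 1)
    (hfrob : ∀ x ∈ R, ∃ y ∈ R, x ^ q - x = π * y) {x : K} (hx : x ∈ R) (hx0 : x ≠ 0) :
    ∃ k : ℕ, ‖x‖ = ‖π‖ ^ k := by
  have key : ∀ k : ℕ, ∀ x ∈ R, ‖π‖ ^ k < ‖x‖ → ∃ j : ℕ, ‖x‖ = ‖π‖ ^ j := by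
    intro k
    induction k with
    | zero => intro x hx h; exact absurd (hR x hx) (by simpa using h)
    | succ k ih =>
      intro x hx h
      rcases eq_or_lt_of_le (hR x hx) with h1 | h1
      · exact ⟨0, by simpa using h1⟩
      obtain ⟨y, hy, hxy⟩ := hfrob x hx
      have h0 : 0 < ‖x‖ := lt_of_le_of_lt (by positivity) h
      -- Since x ^ q is strictly smaller than x, the norm of x ^ q - x = π y is that of x. Passing
      -- from x to y divides the norm by ‖π‖, so the induction stops at norm 1.
      have hlt : ‖x ^ q‖ < ‖x‖ := by
        rw [norm_pow]
        exact pow_lt_self_of_lt_one₀ h0 h1 hq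
      have hn : ‖x‖ = ‖π‖ * ‖y‖ := by
        rw [← norm_mul, ← hxy, norm_sub_rev, sub_eq_add_neg,
          IsUltrametricDist.norm_add_eq_max_of_norm_ne_norm (by rw [norm_neg]; exact hlt.ne'),
          norm_neg, max_eq_left hlt.le]
      have hπ0 : 0 < ‖π‖ := by
        rcases (norm_nonneg π).eq_or_lt with h' | h'
        · rw [← h', zero_mul] at hn
          exact absurd hn h0.ne'
        · exact h'
      obtain ⟨j, hj⟩ := ih y hy (by
        rw [hn, pow_succ'] at h
        exact lt_of_mul_lt_mul_left h hπ0.le)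
      exact ⟨j + 1, by rw [hn, hj, pow_succ']⟩
  obtain ⟨k, hk⟩ := exists_pow_lt_of_lt_one (norm_pos_iff.2 hx0) hπ
  exact key k x hx hk

end Unif

/-! ### The uniformizer and the residue field of Ω̃₀ -/

section Field

variable (p : ℕ) [Fact p.Prime]

theorem norm_p_padicComplex : ‖(p : ℂ_[p])‖ = (p : ℝ)⁻¹ := by
  have h := PadicComplex.norm_extends' p (p : ℚ_[p])
  rw [Padic.norm_p] at h
  rw [← h]
  congr 1
  exact (map_natCast (algebraMap ℚ_[p] ℂ_[p]) p).symm

/-- Roots of monic polynomials with coefficients of norm at most `1` have norm at most `1`. -/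
theorem norm_le_one_of_pow_eq_sum {K : Type*} [NormedField K] [IsUltrametricDist K]
    {u : K} {m : ℕ} (c : ℕ → K) (hc : ∀ k < m, ‖c k‖ ≤ 1)
    (h : u ^ m = ∑ k ∈ Finset.range m, c k * u ^ k) : ‖u‖ ≤ 1 := by
  by_contra hu
  push Not at hu
  rcases Nat.eq_zero_or_pos m with rfl | hm
  · simp at h
  have h2 : ‖u ^ m‖ ≤ ‖u‖ ^ (m - 1) := by
    rw [h]
    refine IsUltrametricDist.norm_sum_le_of_forall_le_of_nonneg (by positivity) fun k hk => ?_
    rw [Finset.mem_range] at hk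
    rw [norm_mul, norm_pow]
    calc ‖c k‖ * ‖u‖ ^ k ≤ 1 * ‖u‖ ^ k := by gcongr; exact hc k hk
      _ ≤ ‖u‖ ^ (m - 1) := by
        rw [one_mul]; exact pow_le_pow_right₀ hu.le (by omega)
  rw [norm_pow] at h2
  exact absurd h2 (not_le.2 (pow_lt_pow_right₀ hu (by omega)))

/-- If `ζ ^ p = 1`, `ζ ≠ 1` and `c ^ (p-1) = s p` with `s = ± 1`, then `u = (ζ - 1) / c` is a
root of a monic polynomial of degree `p - 1` with coefficients in `ℤ[c]`, which is congruent to
`u ^ (p-1) + s` modulo `c`. -/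
theorem exists_pow_root_of_unity {K : Type*} [Field K] [CharZero K] {ζ c s : K}
    {p : ℕ} (hp : p.Prime) (hζ : ζ ^ p = 1)
    (hζ1 : ζ ≠ 1) (hs : s * s = 1) (hc : c ^ (p - 1) = s * p) :
    ∃ w : ℕ → ℕ, ((ζ - 1) / c) ^ (p - 1) =
      ∑ k ∈ Finset.range (p - 1), (-s * (w k : K) * c ^ k) * ((ζ - 1) / c) ^ k ∧ w 0 = 1 := by
  have hp1 : 1 < p := hp.one_lt
  have hs0 : s ≠ 0 := by rintro rfl; simp at hs
  have hp0 : (p : K) ≠ 0 := Nat.cast_ne_zero.2 hp.ne_zero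
  have hc0 : c ≠ 0 := by
    rintro rfl
    rw [zero_pow (by omega)] at hc
    exact mul_ne_zero hs0 hp0 hc.symm
  set u := (ζ - 1) / c with hu
  have hu0 : u ≠ 0 := div_ne_zero (sub_ne_zero.2 hζ1) hc0
  have hζu : ζ = c * u + 1 := by rw [hu, mul_div_cancel₀ _ hc0, sub_add_cancel]
  refine ⟨fun k => p.choose (k + 1) / p, ?_, ?_⟩
  · have h1 : (c * u + 1) ^ p = 1 := by rw [← hζu, hζ]
    rw [add_pow] at h1
    simp only [one_pow, mul_one] at h1
    obtain ⟨r, rfl⟩ : ∃ r, p = r + 1 := ⟨p - 1, by omega⟩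
    rw [Finset.sum_range_succ', Finset.sum_range_succ] at h1
    simp only [Nat.add_sub_cancel] at *
    have hdiv : ∀ k ∈ Finset.range r, ((c * u) ^ (k + 1) * ((r + 1).choose (k + 1) : K)) =
        ((r + 1 : ℕ) : K) * c * u *
          ((((r + 1).choose (k + 1) / (r + 1) : ℕ) : K) * c ^ k * u ^ k) := by
      intro k hk
      rw [Finset.mem_range] at hk
      obtain ⟨d, hd⟩ := hp.dvd_choose_self (k := k + 1) (by omega) (by omega)
      rw [hd, Nat.mul_div_cancel_left d r.succ_pos]
      push_cast
      rw [mul_pow, pow_succ, pow_succ]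
      ring
    rw [Finset.sum_congr rfl hdiv, ← Finset.mul_sum] at h1
    simp only [Nat.choose_self, Nat.choose_zero_right, Nat.cast_one, pow_zero, mul_one,
      add_eq_right] at h1
    -- The top term absorbs c ^ (p-1) = s p, so every term of the expansion of (1 + c u) ^ p - 1
    -- carries the common factor p c u, which is cancelled.
    have h2 : (c * u) ^ (r + 1) = c * u * (s * ((r + 1 : ℕ) : K)) * u ^ r := by
      rw [← hc]; rw [mul_pow, pow_succ, pow_succ]; ring
    rw [h2] at h1
    set A := ∑ k ∈ Finset.range r,
      ((((r + 1).choose (k + 1) / (r + 1) : ℕ) : K) * c ^ k * u ^ k) with hA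
    have h3 : ((r + 1 : ℕ) : K) * c * u * (A + s * u ^ r) = 0 := by
      linear_combination h1
    have h4 := (mul_eq_zero.1 h3).resolve_left (mul_ne_zero (mul_ne_zero hp0 hc0) hu0)
    have h5 : u ^ r = -s * A := by
      linear_combination (s : K) * h4 - u ^ r * hs
    rw [h5, hA, Finset.mul_sum]
    exact Finset.sum_congr rfl fun k _ => by simp only [mul_assoc]
  · simp [hp.pos]

end Field

/-- For s = -1 one Frobenius step already fixes u. For s = 1 it sends u to -u, which is u itself in
characteristic 2; for odd p a second step restores the sign, so an even a suffices. This is the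
purpose of the condition on the sign in π ^ v = ± p. -/
theorem pow_prime_pow_eq_self {A : Type*} [CommRing A] {p a : ℕ} (hp : p.Prime)
    (hpA : (p : A) = 0) {u s : A} (hu : u ^ p = -s * u)
    (hs : s = -1 ∨ s = 1 ∧ (p = 2 ∨ Even a)) : u ^ p ^ a = u := by
  have iter : u ^ p = u → u ^ p ^ a = u := by
    intro h
    induction a with
    | zero => simp
    | succ k ih =>
      have : u ^ p ^ k = u := by
        clear hs ih
        induction k with
        | zero => simp
        | succ k ih => rw [pow_succ, pow_mul, ih, h]
      rw [pow_succ, pow_mul, this, h]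
  rcases hs with rfl | ⟨rfl, h2 | he⟩
  · exact iter (by rw [hu]; ring)
  · refine iter ?_
    subst h2
    rw [hu]
    have h2 : (2 : A) = 0 := by exact_mod_cast hpA
    linear_combination (-u) * h2
  · obtain ⟨k, rfl⟩ := he
    rcases hp.eq_two_or_odd' with rfl | hodd
    · refine iter ?_
      rw [hu]
      have h2 : (2 : A) = 0 := by exact_mod_cast hpA
      linear_combination (-u) * h2
    have h2 : u ^ (p * p) = u := by
      rw [pow_mul, hu, neg_mul, one_mul, hodd.neg_pow, hu]
      ring
    clear iter
    induction k with
    | zero => simp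
    | succ k ih =>
      rw [show k + 1 + (k + 1) = (k + k) + 1 + 1 by ring, pow_succ, pow_succ, mul_assoc, pow_mul,
        ih, h2]

section Field

variable (p : ℕ) [Fact p.Prime]

/-- The subring of `ℂ_[p]` generated by `ℤ_[p]`, the roots of unity of order dividing
`p ^ a - 1`, and two elements. -/
def integralGen (a : ℕ) (π u : ℂ_[p]) : Subring ℂ_[p] :=
  Subring.closure (Set.range (fun x : ℤ_[p] => algebraMap ℚ_[p] ℂ_[p] x) ∪
    {x | x ^ (p ^ a - 1) = 1} ∪ {π, u})

variable {p}

theorem algebraMap_mem_integralGen {a : ℕ} {π u : ℂ_[p]} (x : ℤ_[p]) :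
    algebraMap ℚ_[p] ℂ_[p] x ∈ integralGen p a π u :=
  Subring.subset_closure (Or.inl (Or.inl ⟨x, rfl⟩))

theorem left_mem_integralGen {a : ℕ} {π u : ℂ_[p]} : π ∈ integralGen p a π u :=
  Subring.subset_closure (Or.inr (by simp))

theorem right_mem_integralGen {a : ℕ} {π u : ℂ_[p]} : u ∈ integralGen p a π u :=
  Subring.subset_closure (Or.inr (by simp))

/-- Modulo π the ring has characteristic p, so the elements fixed by x ↦ x ^ q form a subring and
only generators need checking: ℤ_p has residue field 𝔽_p, the roots of unity are fixed exactly, π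
becomes 0, and u is handled by `pow_prime_pow_eq_self`. -/
theorem exists_frobenius_integralGen {a v : ℕ} (hv : v ≠ 0) {π u s : ℂ_[p]}
    (hs : s = -1 ∨ s = 1 ∧ (p = 2 ∨ Even a)) (hπ : π ^ v = s * p)
    (hu : ∃ y ∈ integralGen p a π u, u ^ p = -s * u + π * y) {x : ℂ_[p]}
    (hx : x ∈ integralGen p a π u) :
    ∃ y ∈ integralGen p a π u, x ^ p ^ a - x = π * y := by
  have hp : p.Prime := Fact.out
  set R := integralGen p a π u with hR
  let π' : R := ⟨π, left_mem_integralGen⟩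
  let mk := Ideal.Quotient.mk (Ideal.span {π'})
  have hsR : ∃ s' : R, (s' : ℂ_[p]) = s ∧ s * s = 1 ∧ (s' = -1 ∨ s' = 1 ∧ (p = 2 ∨ Even a)) := by
    rcases hs with rfl | ⟨rfl, h⟩
    · exact ⟨-1, by simp, by simp, Or.inl rfl⟩
    · exact ⟨1, by simp, by simp, Or.inr ⟨rfl, h⟩⟩
  obtain ⟨s', hs's, hss, hs'⟩ := hsR
  have hpi0 : mk π' = 0 := Ideal.Quotient.eq_zero_iff_mem.2 (Ideal.mem_span_singleton_self _)
  have hpA : (p : R ⧸ Ideal.span {π'}) = 0 := by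
    have : (p : R) = s' * π' ^ v := by
      apply Subtype.ext
      push_cast
      change (p : ℂ_[p]) = s' * π ^ v
      rw [hs's, hπ, ← mul_assoc, hss, one_mul]
    rw [← map_natCast mk, this, map_mul, map_pow, hpi0, zero_pow hv, mul_zero]
  have key : ∀ y (hy : y ∈ R), (mk ⟨y, hy⟩) ^ p ^ a = mk ⟨y, hy⟩ := by
    intro y hy
    refine Subring.closure_induction (p := fun y hy => (mk ⟨y, hy⟩) ^ p ^ a = mk ⟨y, hy⟩)
      ?_ ?_ ?_ ?_ ?_ ?_ hy
    · rintro y ((⟨z, rfl⟩ | hy1) | hy1)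
      · have h1 : z ^ p ^ a - z ∈ IsLocalRing.maximalIdeal ℤ_[p] := by
          rw [← PadicInt.ker_toZMod, RingHom.mem_ker, map_sub, map_pow, ZMod.pow_card_pow, sub_self]
        rw [PadicInt.maximalIdeal_eq_span_p, Ideal.mem_span_singleton] at h1
        obtain ⟨w, hw⟩ := h1
        have hz : (⟨algebraMap ℚ_[p] ℂ_[p] z, algebraMap_mem_integralGen z⟩ : R) ^ p ^ a -
            ⟨algebraMap ℚ_[p] ℂ_[p] z, algebraMap_mem_integralGen z⟩ =
            p * ⟨algebraMap ℚ_[p] ℂ_[p] w, algebraMap_mem_integralGen w⟩ := by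
          apply Subtype.ext
          have := congrArg (fun z : ℤ_[p] => algebraMap ℚ_[p] ℂ_[p] z) hw
          simpa using this
        have h2 := congrArg mk hz
        rw [map_sub, map_mul, map_natCast, hpA, zero_mul, map_pow, sub_eq_zero] at h2
        exact h2
      · rw [← map_pow]
        congr 1
        apply Subtype.ext
        change y ^ p ^ a = y
        have : p ^ a = p ^ a - 1 + 1 := (Nat.sub_add_cancel (Nat.pos_of_ne_zero (by
          simp [hp.ne_zero]))).symm
        rw [this, pow_succ, hy1, one_mul]
      · rcases hy1 with rfl | rfl
        · change mk π' ^ p ^ a = mk π'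
          rw [hpi0, zero_pow (by simp [hp.ne_zero])]
        · obtain ⟨z, hz, hu⟩ := hu
          refine pow_prime_pow_eq_self hp hpA (s := mk s') ?_ ?_
          · have : (⟨y, right_mem_integralGen⟩ : R) ^ p =
                -s' * ⟨y, right_mem_integralGen⟩ + π' * ⟨z, hz⟩ := by
              apply Subtype.ext
              simpa [hs's] using hu
            rw [← map_pow, this, map_add, map_mul, map_mul, hpi0, zero_mul, add_zero, map_neg]
          · rcases hs' with h | ⟨h, h'⟩
            · left; rw [h, map_neg, map_one]
            · right; exact ⟨by rw [h, map_one], h'⟩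
    · change mk 0 ^ p ^ a = mk 0
      rw [map_zero, zero_pow (by simp [hp.ne_zero])]
    · change mk 1 ^ p ^ a = mk 1
      rw [map_one, one_pow]
    · intro y z hy hz h1 h2
      change mk (⟨y, hy⟩ + ⟨z, hz⟩) ^ p ^ a = mk (⟨y, hy⟩ + ⟨z, hz⟩)
      rw [map_add]
      obtain ⟨r, hr⟩ := exists_add_pow_prime_pow_eq hp (mk ⟨y, hy⟩) (mk ⟨z, hz⟩) a
      rw [hr, hpA, h1, h2]
      ring
    · intro y hy h1
      have e0 : mk ⟨-y, R.neg_mem hy⟩ = - mk ⟨y, hy⟩ := by rw [← map_neg]; rfl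
      change mk ⟨-y, R.neg_mem hy⟩ ^ p ^ a = mk ⟨-y, R.neg_mem hy⟩
      rw [e0]
      -- Adding y and -y determines (-y) ^ q without a case distinction on the parity of p.
      obtain ⟨r, hr⟩ := exists_add_pow_prime_pow_eq hp (mk ⟨y, hy⟩) (- mk ⟨y, hy⟩) a
      rw [hpA, h1, add_neg_cancel, zero_pow (by simp [hp.ne_zero])] at hr
      linear_combination -hr
    · intro y z hy hz h1 h2
      change mk (⟨y, hy⟩ * ⟨z, hz⟩) ^ p ^ a = mk (⟨y, hy⟩ * ⟨z, hz⟩)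
      rw [map_mul, mul_pow, h1, h2]
  have h1 := key x hx
  rw [← map_pow, ← sub_eq_zero, ← map_sub, Ideal.Quotient.eq_zero_iff_mem,
    Ideal.mem_span_singleton] at h1
  obtain ⟨y, hy⟩ := h1
  exact ⟨y, y.2, congrArg Subtype.val hy⟩

theorem norm_le_one_of_mem_integralGen {a : ℕ} (ha : a ≠ 0) {π u : ℂ_[p]} (hπ : ‖π‖ ≤ 1)
    (hu : ‖u‖ ≤ 1) {x : ℂ_[p]} (hx : x ∈ integralGen p a π u) : ‖x‖ ≤ 1 := by
  have hp : p.Prime := Fact.out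
  have : integralGen p a π u ≤ (integerRing ℂ_[p]).toSubring := by
    refine Subring.closure_le.2 ?_
    rintro y ((⟨z, rfl⟩ | hy1) | hy1)
    · exact mem_integerRing.2 ((PadicComplex.norm_extends' p z).trans_le z.2)
    · refine mem_integerRing.2 (le_of_eq ?_)
      have h1 : ‖y‖ ^ (p ^ a - 1) = 1 := by rw [← norm_pow, hy1, norm_one]
      exact (pow_eq_one_iff_of_nonneg (norm_nonneg _)
        (Nat.sub_ne_zero_of_lt (Nat.one_lt_pow ha hp.one_lt))).1 h1
    · rcases hy1 with rfl | rfl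
      · exact mem_integerRing.2 hπ
      · exact mem_integerRing.2 hu
  exact mem_integerRing.1 (this hx)

/-- All generators of the field are algebraic over ℚ_p, so it is already generated as an algebra,
and the only denominators come from the coefficients in ℚ_p. -/
theorem exists_pow_mul_mem_integralGen {a G : ℕ} (ha : a ≠ 0) {ζ π u : ℂ_[p]}
    (hζ : ζ ^ p = 1) (hu : ζ = 1 + π ^ G * u) {v : ℕ} (hv : 0 < v) {s : ℤ} (hπ : π ^ v = s * p)
    {x : ℂ_[p]} (hx : x ∈ omegaTilde p a ζ π) :
    ∃ k : ℕ, (p : ℂ_[p]) ^ k * x ∈ integralGen p a π u := by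
  have hp : p.Prime := Fact.out
  set R := integralGen p a π u with hR
  have hpR : (p : ℂ_[p]) ∈ R := natCast_mem R p
  have hset : omegaTilde p a ζ π = IntermediateField.adjoin ℚ_[p]
      ({x : ℂ_[p] | x ^ (p ^ a - 1) = 1} ∪ {ζ} ∪ {π}) := by
    rw [IntermediateField.adjoin_union, IntermediateField.adjoin_union]
    rfl
  have halg : ∀ y ∈ ({x : ℂ_[p] | x ^ (p ^ a - 1) = 1} ∪ {ζ} ∪ {π} : Set ℂ_[p]),
      IsAlgebraic ℚ_[p] y := by
    intro y hy
    have hq : 0 < p ^ a - 1 := Nat.sub_pos_of_lt (Nat.one_lt_pow ha hp.one_lt)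
    refine IsIntegral.isAlgebraic ?_
    rcases hy with (hy | rfl) | rfl
    · exact IsIntegral.of_pow hq (by rw [show y ^ (p ^ a - 1) = 1 from hy]; exact isIntegral_one)
    · exact IsIntegral.of_pow hp.pos (by rw [hζ]; exact isIntegral_one)
    · refine IsIntegral.of_pow hv ?_
      rw [hπ, show (s : ℂ_[p]) * p = algebraMap ℚ_[p] ℂ_[p] (s * p) by simp]
      exact isIntegral_algebraMap
  have hx' : x ∈ Algebra.adjoin ℚ_[p] ({x : ℂ_[p] | x ^ (p ^ a - 1) = 1} ∪ {ζ} ∪ {π}) := by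
    rw [← IntermediateField.adjoin_toSubalgebra_of_isAlgebraic halg, ← hset]
    exact hx
  refine Algebra.adjoin_induction (p := fun x _ => ∃ k : ℕ, (p : ℂ_[p]) ^ k * x ∈ R)
    ?_ ?_ ?_ ?_ hx'
  · rintro y ((hy | rfl) | rfl)
    · exact ⟨0, by rw [pow_zero, one_mul]; exact Subring.subset_closure (Or.inl (Or.inr hy))⟩
    · refine ⟨0, ?_⟩
      rw [pow_zero, one_mul, hu]
      exact R.add_mem R.one_mem (R.mul_mem (R.pow_mem left_mem_integralGen _)
        right_mem_integralGen)
    · exact ⟨0, by rw [pow_zero, one_mul]; exact left_mem_integralGen⟩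
  · intro r
    obtain ⟨k, hk⟩ : ∃ k : ℕ, ‖(p : ℚ_[p]) ^ k * r‖ ≤ 1 := by
      rcases eq_or_ne r 0 with rfl | hr
      · exact ⟨0, by simp⟩
      have h1 : (p : ℝ)⁻¹ < 1 := inv_lt_one_of_one_lt₀ (by exact_mod_cast hp.one_lt)
      obtain ⟨k, hk⟩ := exists_pow_lt_of_lt_one (inv_pos.2 (norm_pos_iff.2 hr)) h1
      refine ⟨k, ?_⟩
      rw [norm_mul, norm_pow, Padic.norm_p]
      have hr' := norm_pos_iff.2 hr
      calc _ ≤ ‖r‖⁻¹ * ‖r‖ := by gcongr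
        _ = 1 := inv_mul_cancel₀ hr'.ne'
    refine ⟨k, ?_⟩
    have := algebraMap_mem_integralGen (a := a) (π := π) (u := u) (⟨_, hk⟩ : ℤ_[p])
    simpa using this
  · rintro y z - - ⟨k, hk⟩ ⟨j, hj⟩
    refine ⟨k + j, ?_⟩
    have := R.add_mem (R.mul_mem (R.pow_mem hpR j) hk) (R.mul_mem (R.pow_mem hpR k) hj)
    convert this using 1
    ring
  · rintro y z - - ⟨k, hk⟩ ⟨j, hj⟩
    refine ⟨k + j, ?_⟩
    convert R.mul_mem hk hj using 1
    ring

/-- This is the statement that π is a uniformizer. On the ring generated by ℤ_p, the roots of unity,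
π and u = (ζ - 1)/π^G one has x ^ q ≡ x modulo π, which forces norms of nonzero elements to be
powers of ‖π‖. An arbitrary element of the field enters this ring after multiplication by a power of
p, whose norm is also a power of ‖π‖. -/
theorem norm_pow_eq_of_mem_omegaTilde {a v : ℕ} (ha : a ≠ 0) (hv : 0 < v) (hpv : p - 1 ∣ v)
    {ζ π : ℂ_[p]} (hζ : IsPrimitiveRoot ζ p)
    (hπ : π ^ v = -(p : ℂ_[p]) ∨ (π ^ v = (p : ℂ_[p]) ∧ (p = 2 ∨ Even a)))
    {x : ℂ_[p]} (hx : x ∈ omegaTilde p a ζ π) (hx1 : ‖x‖ < 1) : ‖x‖ ≤ ‖π‖ := by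
  have hp : p.Prime := Fact.out
  obtain ⟨s, hs, hπs⟩ : ∃ s : ℤ, (s = -1 ∨ s = 1 ∧ (p = 2 ∨ Even a)) ∧ π ^ v = s * p := by
    rcases hπ with h | ⟨h, h'⟩
    · exact ⟨-1, Or.inl rfl, by rw [h]; push_cast; ring⟩
    · exact ⟨1, Or.inr ⟨rfl, h'⟩, by rw [h]; push_cast; ring⟩
  have hs1 : ‖(s : ℂ_[p])‖ = 1 := by rcases hs with rfl | ⟨rfl, -⟩ <;> simp
  have hss : (s : ℂ_[p]) * s = 1 := by rcases hs with rfl | ⟨rfl, -⟩ <;> simp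
  have hsC : (s : ℂ_[p]) = -1 ∨ (s : ℂ_[p]) = 1 ∧ (p = 2 ∨ Even a) := by
    rcases hs with rfl | ⟨rfl, h⟩
    · left; simp
    · right; exact ⟨by simp, h⟩
  obtain ⟨G, hG⟩ := hpv
  have hG0 : G ≠ 0 := by rintro rfl; simp [hG] at hv
  have hnp : ‖π‖ ^ v = (p : ℝ)⁻¹ := by
    rw [← norm_pow, hπs, norm_mul, hs1, one_mul, norm_p_padicComplex]
  have hp1 : (p : ℝ)⁻¹ < 1 := inv_lt_one_of_one_lt₀ (by exact_mod_cast hp.one_lt)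
  have hπ1 : ‖π‖ < 1 := by
    by_contra h
    push Not at h
    exact absurd (one_le_pow₀ h (n := v)) (not_le.2 (hnp ▸ hp1))
  have hπ0 : 0 < ‖π‖ := by
    refine (norm_nonneg π).lt_of_ne fun h => ?_
    rw [← h, zero_pow hv.ne'] at hnp
    exact absurd hnp (inv_pos.2 (by exact_mod_cast hp.pos)).ne
  have hπne : π ≠ 0 := norm_pos_iff.1 hπ0
  -- Here c = π ^ G satisfies c ^ (p-1) = π ^ v = s p, so π ^ G is the right power to divide ζ - 1
  -- by.
  obtain ⟨w, hw, hw0⟩ := exists_pow_root_of_unity (c := π ^ G) hp hζ.pow_eq_one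
    (hζ.ne_one hp.one_lt) hss (by rw [← pow_mul, mul_comm G, ← hG, hπs])
  set u := (ζ - 1) / π ^ G with hu
  have hu1 : ‖u‖ ≤ 1 := by
    refine norm_le_one_of_pow_eq_sum _ (fun k _ => ?_) hw
    rw [norm_mul, norm_mul, norm_neg, hs1, one_mul, norm_pow, norm_pow]
    exact mul_le_one₀ (IsUltrametricDist.norm_natCast_le_one _ _) (by positivity)
      (pow_le_one₀ (by positivity) (pow_le_one₀ hπ0.le hπ1.le))
  have hπR : π ∈ integralGen p a π u := left_mem_integralGen
  have huR : u ∈ integralGen p a π u := right_mem_integralGen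
  -- In the equation of degree p - 1 every term with k ≥ 1 carries a factor π ^ (G k), and the
  -- constant term is -s. Multiplying by u gives u ^ p ≡ -s u modulo π.
  have hup : ∃ y ∈ integralGen p a π u, u ^ p = -s * u + π * y := by
    have h1 : u ^ p = u ^ (p - 1) * u := by
      rw [← pow_succ, Nat.sub_add_cancel hp.one_lt.le]
    obtain ⟨r, hr⟩ : ∃ r, p - 1 = r + 1 := ⟨p - 2, by have := hp.two_le; omega⟩
    rw [hr, Finset.sum_range_succ'] at hw
    simp only [hw0, Nat.cast_one, pow_zero, mul_one] at hw
    refine ⟨(∑ k ∈ Finset.range r,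
      -s * (w (k + 1) : ℂ_[p]) * π ^ (G * (k + 1) - 1) * u ^ (k + 1)) * u, ?_, ?_⟩
    · refine Subring.mul_mem _ (Subring.sum_mem _ fun k _ => ?_) huR
      exact Subring.mul_mem _ (Subring.mul_mem _ (Subring.mul_mem _ (Subring.neg_mem _
        (intCast_mem _ s)) (natCast_mem _ _)) (Subring.pow_mem _ hπR _)) (Subring.pow_mem _ huR _)
    · rw [h1, hr, hw, add_mul, add_comm, ← mul_assoc, Finset.mul_sum]
      congr 2
      refine Finset.sum_congr rfl fun k _ => ?_
      rw [← pow_mul]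
      have hk : G * (k + 1) = G * (k + 1) - 1 + 1 :=
        (Nat.sub_add_cancel (Nat.mul_pos (Nat.pos_of_ne_zero hG0) k.succ_pos)).symm
      conv_lhs => rw [hk, pow_succ]
      ring
  rcases eq_or_ne x 0 with rfl | hx0
  · simp
  obtain ⟨k, hk⟩ := exists_pow_mul_mem_integralGen (u := u) (G := G) ha hζ.pow_eq_one
    (by rw [hu, mul_div_cancel₀ _ (pow_ne_zero _ hπne)]; ring) hv hπs hx
  have hpne : (p : ℂ_[p]) ≠ 0 := Nat.cast_ne_zero.2 hp.ne_zero
  obtain ⟨j, hj⟩ := norm_eq_pow_of_frobenius (integralGen p a π u) π (p ^ a)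
    (Nat.one_lt_pow ha hp.one_lt) hπ1
    (fun x hx => norm_le_one_of_mem_integralGen ha hπ1.le hu1 hx)
    (fun x hx => exists_frobenius_integralGen hv.ne' hsC hπs hup hx) hk
    (mul_ne_zero (pow_ne_zero _ hpne) hx0)
  rw [norm_mul, norm_pow, norm_p_padicComplex, ← hnp, ← pow_mul] at hj
  have hlt : ‖π‖ ^ j < ‖π‖ ^ (v * k) := by
    rw [← hj]
    exact mul_lt_of_lt_one_right (by positivity) hx1
  have hjk : v * k < j := (pow_lt_pow_iff_right_of_lt_one₀ hπ0 hπ1).1 hlt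
  obtain ⟨i, rfl⟩ := Nat.exists_eq_add_of_lt hjk
  rw [add_assoc, pow_add] at hj
  rw [mul_left_cancel₀ (pow_ne_zero _ hπ0.ne') hj]
  calc ‖π‖ ^ (i + 1) ≤ ‖π‖ ^ 1 := pow_le_pow_of_le_one hπ0.le hπ1.le (by omega)
    _ = ‖π‖ := pow_one _

end Field

/-- An element of norm below 1 is divisible by π, and ρ kills π because ρ(π) ^ v = ± ρ(p) = 0. A
unit cannot be in the kernel. The Teichmüller representatives are 0 and the powers of a primitive
(q-1)-th root of unity. -/
theorem isUnif_omegaTilde {p : ℕ} [Fact p.Prime] {a v : ℕ} {F : Type*} [Field F] [Finite F]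
    (hF : Nat.card F = p ^ a) (hv : 0 < v) (hpv : p - 1 ∣ v)
    {ζ π : ℂ_[p]} (hζ : IsPrimitiveRoot ζ p)
    (hπ : π ^ v = -(p : ℂ_[p]) ∨ (π ^ v = (p : ℂ_[p]) ∧ (p = 2 ∨ Even a)))
    (ρ : integerRing (omegaTilde p a ζ π) →+* F) :
    IsUnif p (p ^ a) v (piElt p a ζ π) ρ := by
  have hp : p.Prime := Fact.out
  have ha : a ≠ 0 := by
    rintro rfl
    rw [pow_zero] at hF
    exact absurd Finite.one_lt_card (by rw [hF]; exact lt_irrefl 1 : ¬ 1 < Nat.card F)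
  have hq : 1 < p ^ a := Nat.one_lt_pow ha hp.one_lt
  have hpF : (p : F) = 0 := by
    have := Fintype.ofFinite F
    have h := Nat.cast_card_eq_zero F
    rw [← Nat.card_eq_fintype_card, hF, Nat.cast_pow] at h
    exact pow_eq_zero_iff ha |>.1 h
  have hqF : ((p ^ a - 1 : ℕ) : F) = -1 := by
    rw [Nat.cast_sub hq.le, Nat.cast_pow, hpF, zero_pow ha]
    simp
  obtain ⟨s, hs1, hπs⟩ : ∃ s : ℤ, ‖(s : ℂ_[p])‖ = 1 ∧ π ^ v = s * p := by
    rcases hπ with h | ⟨h, h'⟩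
    · exact ⟨-1, by simp, by rw [h]; push_cast; ring⟩
    · exact ⟨1, by simp, by rw [h]; push_cast; ring⟩
  have hnp : ‖π‖ ^ v = (p : ℝ)⁻¹ := by
    rw [← norm_pow, hπs, norm_mul, hs1, one_mul, norm_p_padicComplex]
  have hp1 : (p : ℝ)⁻¹ < 1 := inv_lt_one_of_one_lt₀ (by exact_mod_cast hp.one_lt)
  have hπ1 : ‖π‖ < 1 := by
    by_contra h
    push Not at h
    exact absurd (one_le_pow₀ h (n := v)) (not_le.2 (hnp ▸ hp1))
  have hπ0 : 0 < ‖π‖ := by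
    refine (norm_nonneg π).lt_of_ne fun h => ?_
    rw [← h, zero_pow hv.ne'] at hnp
    exact absurd hnp (inv_pos.2 (by exact_mod_cast hp.pos)).ne
  have hgap : ∀ x : omegaTilde p a ζ π, ‖x‖ < 1 → ‖x‖ ≤ ‖piElt p a ζ π‖ := fun x hx =>
    norm_pow_eq_of_mem_omegaTilde ha hv hpv hζ hπ x.2 hx
  have hπne : piElt p a ζ π ≠ 0 := norm_pos_iff.1 hπ0
  have hker : ∀ x : integerRing (omegaTilde p a ζ π), ρ x = 0 ↔ ‖(x : omegaTilde p a ζ π)‖ < 1 := by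
    intro x
    refine ⟨fun hx => ?_, fun hx => ?_⟩
    · refine lt_of_le_of_ne (mem_integerRing.1 x.2) fun h1 => ?_
      have hx0 : (x : omegaTilde p a ζ π) ≠ 0 := by
        rw [← norm_ne_zero_iff, h1]; exact one_ne_zero
      have hi : (x : omegaTilde p a ζ π)⁻¹ ∈ integerRing (omegaTilde p a ζ π) :=
        mem_integerRing.2 (by rw [norm_inv, h1, inv_one])
      have : x * ⟨_, hi⟩ = 1 := Subtype.ext (mul_inv_cancel₀ hx0)
      have h2 := congrArg ρ this
      rw [map_mul, hx, zero_mul, map_one] at h2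
      exact zero_ne_one h2
    · have hπO : piElt p a ζ π ∈ integerRing (omegaTilde p a ζ π) := mem_integerRing.2 hπ1.le
      have hy : (x : omegaTilde p a ζ π) / piElt p a ζ π ∈ integerRing (omegaTilde p a ζ π) := by
        rw [mem_integerRing, norm_div]
        exact (div_le_one hπ0).2 (hgap _ hx)
      have hx : x = ⟨_, hπO⟩ * ⟨_, hy⟩ := Subtype.ext (mul_div_cancel₀ _ hπne).symm
      have hρπ : ρ ⟨_, hπO⟩ = 0 := by
        have h1 : (⟨_, hπO⟩ : integerRing (omegaTilde p a ζ π)) ^ v = s * p := by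
          apply Subtype.ext
          apply Subtype.ext
          push_cast
          exact hπs
        have h2 := congrArg ρ h1
        rw [map_pow, map_mul, map_natCast, hpF, mul_zero] at h2
        exact pow_eq_zero_iff hv.ne' |>.1 h2
      rw [hx, map_mul, hρπ, zero_mul]
  refine ⟨hp, hπ0, hπ1, hgap, hker, ?_, hv, ⟨a, ha, rfl⟩, ?_⟩
  · change ‖(p : ℂ_[p])‖ = ‖π‖ ^ v
    rw [norm_p_padicComplex, hnp]
  · have hq1 : p ^ a - 1 ≠ 0 := by omega
    have hqq : p ^ a = p ^ a - 1 + 1 := by omega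
    have : NeZero ((p ^ a - 1 : ℕ) : ℂ_[p]) := ⟨Nat.cast_ne_zero.2 hq1⟩
    obtain ⟨w, hw⟩ := HasEnoughRootsOfUnity.exists_primitiveRoot ℂ_[p] (p ^ a - 1)
    have hwL : w ∈ omegaTilde p a ζ π := by
      have : w ∈ unramifiedField p a := IntermediateField.subset_adjoin _ _ hw.pow_eq_one
      exact (le_sup_left.trans le_sup_left : unramifiedField p a ≤ omegaTilde p a ζ π) this
    have hw1 : ‖w‖ = 1 := by
      have h1 : ‖w‖ ^ (p ^ a - 1) = 1 := by rw [← norm_pow, hw.pow_eq_one, norm_one]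
      exact (pow_eq_one_iff_of_nonneg (norm_nonneg _) hq1).1 h1
    let W : integerRing (omegaTilde p a ζ π) := ⟨⟨w, hwL⟩, mem_integerRing.2 hw1.le⟩
    have hWp : ∀ k : ℕ, W ^ k = 1 → w ^ k = 1 := fun k h =>
      congrArg (fun x : integerRing (omegaTilde p a ζ π) => ((x : omegaTilde p a ζ π) : ℂ_[p])) h
    have hW1 : W ^ (p ^ a - 1) = 1 := by
      apply Subtype.ext
      apply Subtype.ext
      exact hw.pow_eq_one
    -- The reduction stays primitive: if W ^ k ≠ 1 then the sum of its first q - 1 powers vanishes,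
    -- whereas W ^ k ≡ 1 would make that sum reduce to q - 1 = -1.
    have hρW : IsPrimitiveRoot (ρ W) (p ^ a - 1) := by
      refine IsPrimitiveRoot.mk_of_lt _ (by omega) (by rw [← map_pow, hW1, map_one]) ?_
      intro k hk0 hk h1
      have hne : W ^ k - 1 ≠ 0 := fun h =>
        hw.pow_ne_one_of_pos_of_lt hk0.ne' hk (hWp k (sub_eq_zero.1 h))
      have h2 := mul_geom_sum (W ^ k) (p ^ a - 1)
      rw [← pow_mul, mul_comm k, pow_mul, hW1, one_pow, sub_self] at h2
      have h3 := congrArg ρ ((mul_eq_zero.1 h2).resolve_left hne)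
      rw [map_sum, map_zero] at h3
      have h4 : ∀ i, ρ ((W ^ k) ^ i) = 1 := fun i => by rw [map_pow, map_pow, h1, one_pow]
      simp only [h4, Finset.sum_const, Finset.card_range, nsmul_eq_mul, mul_one, hqF] at h3
      exact one_ne_zero (neg_eq_zero.1 h3)
    intro y
    rcases eq_or_ne y 0 with rfl | hy
    · exact ⟨0, map_zero _, zero_pow (by omega)⟩
    have hy1 : y ^ (p ^ a - 1) = 1 := by
      have := Fintype.ofFinite F
      rw [← hF, Nat.card_eq_fintype_card]
      exact FiniteField.pow_card_sub_one_eq_one y hy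
    have : NeZero (p ^ a - 1) := ⟨hq1⟩
    obtain ⟨i, -, hi⟩ := hρW.eq_pow_of_pow_eq_one hy1
    refine ⟨W ^ i, by rw [map_pow, hi], ?_⟩
    rw [hqq, pow_succ, ← pow_mul, mul_comm i, pow_mul, hW1, one_pow, one_mul]

theorem norm_sub_le_max_ultra {E : Type*} [SeminormedAddCommGroup E] [IsUltrametricDist E]
    (x y : E) : ‖x - y‖ ≤ max ‖x‖ ‖y‖ := by
  simpa [sub_eq_add_neg] using IsUltrametricDist.norm_add_le_max x (-y)

/-! ### Residues and digits -/

section Digits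

variable {L : Type*} [NormedField L] [IsUltrametricDist L] {F : Type*} [Field F]

open Classical in
/-- The residue map, extended by `0` to all of `L`. -/
def res (ρ : integerRing L →+* F) (x : L) : F :=
  if h : x ∈ integerRing L then ρ ⟨x, h⟩ else 0

theorem res_coe (ρ : integerRing L →+* F) (x : integerRing L) : res ρ x = ρ x := by
  simp [res]

theorem res_of_norm_le (ρ : integerRing L →+* F) {x : L} (hx : ‖x‖ ≤ 1) :
    res ρ x = ρ ⟨x, mem_integerRing.2 hx⟩ := res_coe ρ ⟨x, mem_integerRing.2 hx⟩

@[simp] theorem res_zero (ρ : integerRing L →+* F) : res ρ 0 = 0 := by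
  rw [res_of_norm_le ρ (by simp)]
  exact map_zero ρ

@[simp] theorem res_one (ρ : integerRing L →+* F) : res ρ 1 = 1 := by
  rw [res_of_norm_le ρ (by simp)]
  exact map_one ρ

theorem res_natCast (ρ : integerRing L →+* F) (k : ℕ) : res ρ (k : L) = k := by
  rw [res_of_norm_le ρ (IsUltrametricDist.norm_natCast_le_one _ _)]
  exact map_natCast ρ k

theorem res_add (ρ : integerRing L →+* F) {x y : L} (hx : ‖x‖ ≤ 1) (hy : ‖y‖ ≤ 1) :
    res ρ (x + y) = res ρ x + res ρ y := by
  rw [res_of_norm_le ρ hx, res_of_norm_le ρ hy, ← map_add]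
  exact res_coe ρ (⟨x, mem_integerRing.2 hx⟩ + ⟨y, mem_integerRing.2 hy⟩)

theorem res_sub (ρ : integerRing L →+* F) {x y : L} (hx : ‖x‖ ≤ 1) (hy : ‖y‖ ≤ 1) :
    res ρ (x - y) = res ρ x - res ρ y := by
  rw [res_of_norm_le ρ hx, res_of_norm_le ρ hy, ← map_sub]
  exact res_coe ρ (⟨x, mem_integerRing.2 hx⟩ - ⟨y, mem_integerRing.2 hy⟩)

theorem res_mul (ρ : integerRing L →+* F) {x y : L} (hx : ‖x‖ ≤ 1) (hy : ‖y‖ ≤ 1) :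
    res ρ (x * y) = res ρ x * res ρ y := by
  rw [res_of_norm_le ρ hx, res_of_norm_le ρ hy, ← map_mul]
  exact res_coe ρ (⟨x, mem_integerRing.2 hx⟩ * ⟨y, mem_integerRing.2 hy⟩)

/-- The elements of the ring of integers fixed modulo `p` by `x ↦ x ^ q`. -/
def FrobFixed (p q : ℕ) (x : L) : Prop := ‖x‖ ≤ 1 ∧ ‖x ^ q - x‖ ≤ ‖(p : L)‖

/-- The `k`-th `π`-adic digit of `x`, with digits lifted by the section `s`. -/
def dig (ρ : integerRing L →+* F) (π : L) (s : F → L) : ℕ → L → F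
  | 0, x => res ρ x
  | k + 1, x => dig ρ π s k ((x - s (res ρ x)) / π)

/-- A section `s` of the residue map with values in the elements fixed by Frobenius mod `p`. -/
structure IsFrobSection (p q : ℕ) (ρ : integerRing L →+* F) (s : F → L) : Prop where
  res_eq : ∀ y, res ρ (s y) = y
  fixed : ∀ y, FrobFixed p q (s y)

namespace IsUnif

variable {p q v : ℕ} {π : L} {ρ : integerRing L →+* F}

theorem pi_ne_zero (h : IsUnif p q v π ρ) : π ≠ 0 := norm_pos_iff.1 h.norm_pos

theorem res_eq_zero_iff (h : IsUnif p q v π ρ) {x : L} (hx : ‖x‖ ≤ 1) :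
    res ρ x = 0 ↔ ‖x‖ < 1 := by
  rw [res_of_norm_le ρ hx, h.ker]

theorem norm_div_le_one (h : IsUnif p q v π ρ) {x : L} (hx : ‖x‖ ≤ 1) (h0 : res ρ x = 0) :
    ‖x / π‖ ≤ 1 := by
  rw [norm_div]
  exact (div_le_one h.norm_pos).2 (h.gap x ((h.res_eq_zero_iff hx).1 h0))

theorem one_lt_q (h : IsUnif p q v π ρ) : 1 < q := by
  obtain ⟨a, ha, rfl⟩ := h.pow
  exact Nat.one_lt_pow ha h.prime.one_lt

theorem fixed_add (h : IsUnif p q v π ρ) {x y : L} (hx : FrobFixed p q x) (hy : FrobFixed p q y) :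
    FrobFixed p q (x + y) := by
  refine ⟨(IsUltrametricDist.norm_add_le_max x y).trans (max_le hx.1 hy.1), ?_⟩
  obtain ⟨a, ha, rfl⟩ := h.pow
  obtain ⟨r, hr⟩ := exists_add_pow_prime_pow_eq h.prime
    (⟨x, mem_integerRing.2 hx.1⟩ : integerRing L) ⟨y, mem_integerRing.2 hy.1⟩ a
  have hr' : (x + y) ^ p ^ a = x ^ p ^ a + y ^ p ^ a + p * x * y * r := congrArg Subtype.val hr
  have : (x + y) ^ p ^ a - (x + y) = ((x ^ p ^ a - x) + (y ^ p ^ a - y)) + p * (x * y * r) := by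
    rw [hr']; ring
  rw [this]
  refine (IsUltrametricDist.norm_add_le_max _ _).trans (max_le
    ((IsUltrametricDist.norm_add_le_max _ _).trans (max_le hx.2 hy.2)) ?_)
  rw [norm_mul]
  refine mul_le_of_le_one_right (norm_nonneg _) ?_
  rw [norm_mul, norm_mul]
  exact mul_le_one₀ (mul_le_one₀ hx.1 (norm_nonneg _) hy.1) (norm_nonneg _)
    (mem_integerRing.1 r.2)

theorem fixed_mul (_ : IsUnif p q v π ρ) {x y : L} (hx : FrobFixed p q x)
    (hy : FrobFixed p q y) : FrobFixed p q (x * y) := by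
  refine ⟨by rw [norm_mul]; exact mul_le_one₀ hx.1 (norm_nonneg _) hy.1, ?_⟩
  have : (x * y) ^ q - x * y = (x ^ q - x) * y ^ q + x * (y ^ q - y) := by ring
  rw [this]
  refine (IsUltrametricDist.norm_add_le_max _ _).trans (max_le ?_ ?_)
  · rw [norm_mul, norm_pow]
    exact (mul_le_of_le_one_right (norm_nonneg _) (pow_le_one₀ (norm_nonneg _) hy.1)).trans hx.2
  · rw [norm_mul]
    exact (mul_le_of_le_one_left (norm_nonneg _) hx.1).trans hy.2

theorem fixed_zero (h : IsUnif p q v π ρ) : FrobFixed p q (0 : L) :=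
  ⟨by simp, by simp [zero_pow (by have := h.one_lt_q; omega : q ≠ 0)]⟩

theorem fixed_one (_ : IsUnif p q v π ρ) : FrobFixed p q (1 : L) := ⟨by simp, by simp⟩

theorem fixed_natCast (h : IsUnif p q v π ρ) (k : ℕ) : FrobFixed p q (k : L) := by
  induction k with
  | zero => simpa using h.fixed_zero
  | succ k ih => rw [Nat.cast_succ]; exact h.fixed_add ih h.fixed_one

theorem fixed_sum (h : IsUnif p q v π ρ) {ι : Type*} (t : Finset ι) (x : ι → L)
    (hx : ∀ i ∈ t, FrobFixed p q (x i)) : FrobFixed p q (∑ i ∈ t, x i) := by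
  classical
  induction t using Finset.induction_on with
  | empty => simpa using h.fixed_zero
  | insert i t hi ih =>
    rw [Finset.sum_insert hi]
    exact h.fixed_add (hx i (by simp)) (ih fun j hj => hx j (by simp [hj]))

/-- An element fixed by Frobenius modulo `p` with residue zero is divisible by `p`. -/
theorem norm_le_norm_p (h : IsUnif p q v π ρ) {x : L} (hx : FrobFixed p q x)
    (h0 : res ρ x = 0) : ‖x‖ ≤ ‖(p : L)‖ := by
  by_contra hlt
  push Not at hlt
  have hx0 : 0 < ‖x‖ := (norm_nonneg _).trans_lt hlt
  -- Raising to the q-th power strictly shrinks x, so x cannot exceed ‖x ^ q - x‖.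
  have h1 : ‖x ^ q‖ < ‖x‖ := by
    rw [norm_pow]
    exact pow_lt_self_of_lt_one₀ hx0 ((h.res_eq_zero_iff hx.1).1 h0) h.one_lt_q
  have h2 : ‖x‖ ≤ max ‖x ^ q‖ ‖x ^ q - x‖ := by
    have := norm_sub_le_max_ultra (x ^ q) (x ^ q - x)
    rwa [sub_sub_cancel] at this
  exact absurd h2 (not_le.2 (max_lt h1 (hx.2.trans_lt hlt)))

theorem fixed_neg_one (h : IsUnif p q v π ρ) : FrobFixed p q (-1 : L) := by
  refine ⟨by simp, ?_⟩
  obtain ⟨a, ha, rfl⟩ := h.pow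
  rcases h.prime.eq_two_or_odd' with rfl | hodd
  -- For p = 2 the element -1 is only fixed modulo p: here (-1) ^ q - (-1) = 2.
  · rw [(even_two.pow_of_ne_zero ha).neg_one_pow]
    norm_num
  · rw [hodd.pow.neg_one_pow]
    simp

theorem fixed_sub (h : IsUnif p q v π ρ) {x y : L} (hx : FrobFixed p q x) (hy : FrobFixed p q y) :
    FrobFixed p q (x - y) := by
  rw [sub_eq_add_neg, ← neg_one_mul]
  exact h.fixed_add hx (h.fixed_mul h.fixed_neg_one hy)

/-- Elements fixed modulo p are determined modulo p by their residues. Hence the section s is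
additive and multiplicative modulo p, and 𝒪/p behaves like F[t]/(t ^ v). -/
theorem norm_sub_le_norm_p (h : IsUnif p q v π ρ) {x y : L} (hx : FrobFixed p q x)
    (hy : FrobFixed p q y) (hxy : res ρ x = res ρ y) : ‖x - y‖ ≤ ‖(p : L)‖ :=
  h.norm_le_norm_p (h.fixed_sub hx hy) (by rw [res_sub ρ hx.1 hy.1, hxy, sub_self])

theorem exists_section (h : IsUnif p q v π ρ) : ∃ s : F → L, IsFrobSection p q ρ s := by
  choose s hs using h.lift
  refine ⟨fun y => s y, fun y => by rw [res_coe, (hs y).1], fun y =>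
    ⟨mem_integerRing.1 (s y).2, ?_⟩⟩
  have : ((s y : L)) ^ q = s y := congrArg Subtype.val (hs y).2
  rw [this, sub_self, norm_zero]
  exact norm_nonneg _

variable {s : F → L}

theorem norm_sub_dig_div_le (h : IsUnif p q v π ρ) (hs : IsFrobSection p q ρ s) {x : L}
    (hx : ‖x‖ ≤ 1) : ‖(x - s (res ρ x)) / π‖ ≤ 1 := by
  refine h.norm_div_le_one ?_ ?_
  · exact (norm_sub_le_max_ultra _ _).trans (max_le hx (hs.fixed _).1)
  · rw [res_sub ρ hx (hs.fixed _).1, hs.res_eq, sub_self]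

theorem dig_congr (h : IsUnif p q v π ρ) (hs : IsFrobSection p q ρ s) (k : ℕ) {x y : L}
    (hx : ‖x‖ ≤ 1) (hy : ‖y‖ ≤ 1) (hxy : ‖x - y‖ ≤ ‖π‖ ^ (k + 1)) :
    dig ρ π s k x = dig ρ π s k y := by
  have hres : res ρ x = res ρ y := by
    rw [← sub_eq_zero, ← res_sub ρ hx hy, h.res_eq_zero_iff
      ((norm_sub_le_max_ultra _ _).trans (max_le hx hy))]
    exact hxy.trans_lt (pow_lt_one₀ h.norm_pos.le h.norm_lt k.succ_ne_zero)
  induction k generalizing x y with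
  | zero => exact hres
  | succ k ih =>
    have hd : ‖(x - s (res ρ x)) / π - (y - s (res ρ y)) / π‖ ≤ ‖π‖ ^ (k + 1) := by
      rw [hres, ← sub_div, sub_sub_sub_cancel_right, norm_div, div_le_iff₀ h.norm_pos, ← pow_succ]
      exact hxy
    have hx' := h.norm_sub_dig_div_le hs hx
    have hy' := h.norm_sub_dig_div_le hs hy
    refine ih hx' hy' hd ?_
    rw [← sub_eq_zero, ← res_sub ρ hx' hy', h.res_eq_zero_iff
      ((norm_sub_le_max_ultra _ _).trans (max_le hx' hy'))]
    exact hd.trans_lt (pow_lt_one₀ h.norm_pos.le h.norm_lt k.succ_ne_zero)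

theorem norm_p_div_le (h : IsUnif p q v π ρ) {k : ℕ} (hk : k + 1 < v) {x : L}
    (hx : ‖x‖ ≤ ‖(p : L)‖) : ‖x / π‖ ≤ ‖π‖ ^ (k + 1) := by
  rw [norm_div, div_le_iff₀ h.norm_pos, ← pow_succ]
  exact hx.trans (h.norm_p.trans_le (pow_le_pow_of_le_one h.norm_pos.le h.norm_lt.le hk))

/-- The carry s(a) + s(b) - s(a + b) has residue zero and is fixed modulo p, so it is divisible by p
and hence by π ^ v. It does not reach the digits of index below v. -/
theorem dig_add (h : IsUnif p q v π ρ) (hs : IsFrobSection p q ρ s) {k : ℕ} (hk : k < v)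
    {x y : L} (hx : ‖x‖ ≤ 1) (hy : ‖y‖ ≤ 1) :
    dig ρ π s k (x + y) = dig ρ π s k x + dig ρ π s k y := by
  induction k generalizing x y with
  | zero => exact res_add ρ hx hy
  | succ k ih =>
    have hxy : ‖x + y‖ ≤ 1 := (IsUltrametricDist.norm_add_le_max _ _).trans (max_le hx hy)
    have hx' := h.norm_sub_dig_div_le hs hx
    have hy' := h.norm_sub_dig_div_le hs hy
    change dig ρ π s k _ = dig ρ π s k _ + dig ρ π s k _
    rw [← ih (by omega) hx' hy']
    refine h.dig_congr hs k (h.norm_sub_dig_div_le hs hxy)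
      ((IsUltrametricDist.norm_add_le_max _ _).trans (max_le hx' hy')) ?_
    rw [← add_div, ← sub_div]
    refine h.norm_p_div_le hk ?_
    have hf := hs.fixed
    have e : x + y - s (res ρ (x + y)) - (x - s (res ρ x) + (y - s (res ρ y))) =
        s (res ρ x) + s (res ρ y) - s (res ρ (x + y)) := by ring
    rw [e]
    refine h.norm_sub_le_norm_p (h.fixed_add (hf _) (hf _)) (hf _) ?_
    rw [res_add ρ (hf _).1 (hf _).1, hs.res_eq, hs.res_eq, hs.res_eq, res_add ρ hx hy]

/-- As for sums, c s(a) and s(ca) have the same residue and are both fixed modulo p, so their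
difference is a multiple of p. -/
theorem dig_fixed_mul (h : IsUnif p q v π ρ) (hs : IsFrobSection p q ρ s) {k : ℕ} (hk : k < v)
    {c x : L} (hc : FrobFixed p q c) (hx : ‖x‖ ≤ 1) :
    dig ρ π s k (c * x) = res ρ c * dig ρ π s k x := by
  induction k generalizing x with
  | zero => exact res_mul ρ hc.1 hx
  | succ k ih =>
    have hcx : ‖c * x‖ ≤ 1 := by rw [norm_mul]; exact mul_le_one₀ hc.1 (norm_nonneg _) hx
    have hx' := h.norm_sub_dig_div_le hs hx
    change dig ρ π s k _ = _ * dig ρ π s k _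
    rw [← ih (by omega) hx']
    refine h.dig_congr hs k (h.norm_sub_dig_div_le hs hcx)
      (by rw [norm_mul]; exact mul_le_one₀ hc.1 (norm_nonneg _) hx') ?_
    rw [← mul_div_assoc, ← sub_div]
    refine h.norm_p_div_le hk ?_
    have hf := hs.fixed
    have e : c * x - s (res ρ (c * x)) - c * (x - s (res ρ x)) =
        c * s (res ρ x) - s (res ρ (c * x)) := by ring
    rw [e]
    refine h.norm_sub_le_norm_p (h.fixed_mul hc (hf _)) (hf _) ?_
    rw [res_mul ρ hc.1 (hf _).1, hs.res_eq, hs.res_eq, res_mul ρ hc.1 hx]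

theorem dig_zero (h : IsUnif p q v π ρ) (hs : IsFrobSection p q ρ s) {k : ℕ} (hk : k < v) :
    dig ρ π s k 0 = 0 := by
  have := h.dig_fixed_mul hs hk h.fixed_zero (x := 0) (by simp)
  simpa using this

theorem dig_of_norm_le (h : IsUnif p q v π ρ) (hs : IsFrobSection p q ρ s) {k : ℕ} (hk : k < v)
    {x : L} (hx : ‖x‖ ≤ ‖π‖ ^ (k + 1)) : dig ρ π s k x = 0 := by
  rw [← h.dig_zero hs hk]
  exact h.dig_congr hs k (hx.trans (pow_le_one₀ h.norm_pos.le h.norm_lt.le)) (by simp)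
    (by simpa using hx)

theorem dig_pow_mul_of_lt (h : IsUnif p q v π ρ) (hs : IsFrobSection p q ρ s) {k j : ℕ}
    (hk : k < v) (hkj : k < j) {x : L} (hx : ‖x‖ ≤ 1) : dig ρ π s k (π ^ j * x) = 0 := by
  refine h.dig_of_norm_le hs hk ?_
  rw [norm_mul, norm_pow]
  exact (mul_le_of_le_one_right (by positivity) hx).trans
    (pow_le_pow_of_le_one h.norm_pos.le h.norm_lt.le hkj)

theorem dig_pow_mul (h : IsUnif p q v π ρ) (hs : IsFrobSection p q ρ s) {k j : ℕ}
    (hk : k + j < v) {x : L} (hx : ‖x‖ ≤ 1) : dig ρ π s (k + j) (π ^ j * x) = dig ρ π s k x := by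
  induction j with
  | zero => simp
  | succ j ih =>
    rw [← ih (by omega)]
    have hj : ‖π ^ j * x‖ ≤ 1 := by
      rw [norm_mul, norm_pow]
      exact mul_le_one₀ (pow_le_one₀ h.norm_pos.le h.norm_lt.le) (norm_nonneg _) hx
    have hj1 : ‖π ^ (j + 1) * x‖ ≤ 1 := by
      rw [norm_mul, norm_pow]
      exact mul_le_one₀ (pow_le_one₀ h.norm_pos.le h.norm_lt.le) (norm_nonneg _) hx
    change dig ρ π s (k + j) _ = _
    refine h.dig_congr hs _ (h.norm_sub_dig_div_le hs hj1) hj ?_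
    have hres : res ρ (π ^ (j + 1) * x) = 0 := h.dig_pow_mul_of_lt hs h.v_pos j.succ_pos hx
    -- The section need not send 0 to 0. The element s 0 is only known to be divisible by p, which
    -- is enough for digits of index below v.
    have e : (π ^ (j + 1) * x - s (res ρ (π ^ (j + 1) * x))) / π - π ^ j * x = (- s 0) / π := by
      rw [hres, pow_succ]
      field_simp [h.pi_ne_zero]
      ring
    rw [e]
    refine h.norm_p_div_le (by omega) ?_
    rw [norm_neg]
    exact h.norm_le_norm_p (hs.fixed 0) (hs.res_eq 0)

theorem dig_sum (h : IsUnif p q v π ρ) (hs : IsFrobSection p q ρ s) {k : ℕ} (hk : k < v)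
    {ι : Type*} (t : Finset ι) (x : ι → L) (hx : ∀ i ∈ t, ‖x i‖ ≤ 1) :
    dig ρ π s k (∑ i ∈ t, x i) = ∑ i ∈ t, dig ρ π s k (x i) := by
  classical
  induction t using Finset.induction_on with
  | empty => simpa using h.dig_zero hs hk
  | insert i t hi ih =>
    have ht : ∀ j ∈ t, ‖x j‖ ≤ 1 := fun j hj => hx j (by simp [hj])
    rw [Finset.sum_insert hi, Finset.sum_insert hi, h.dig_add hs hk (hx i (by simp))
      (IsUltrametricDist.norm_sum_le_of_forall_le_of_nonneg zero_le_one ht), ih ht]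

end IsUnif

end Digits

/-! ### The spaces `dworkFil` -/

section Fil

variable {L : Type*} [NormedField L] {n : ℕ}

theorem normCoeff_add (π : L) (N : ℕ) (u : Fin n →₀ ℕ) (ξ η : MvPowerSeries (Fin n) L) :
    normCoeff π N u (ξ + η) = normCoeff π N u ξ + normCoeff π N u η := by
  simp [normCoeff, add_div]

theorem normCoeff_sub (π : L) (N : ℕ) (u : Fin n →₀ ℕ) (ξ η : MvPowerSeries (Fin n) L) :
    normCoeff π N u (ξ - η) = normCoeff π N u ξ - normCoeff π N u η := by
  simp [normCoeff, sub_div]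

@[simp] theorem normCoeff_zero (π : L) (N : ℕ) (u : Fin n →₀ ℕ) :
    normCoeff π N u (0 : MvPowerSeries (Fin n) L) = 0 := by
  simp [normCoeff]

theorem normCoeff_smul (π : L) (N : ℕ) (u : Fin n →₀ ℕ) (c : L) (ξ : MvPowerSeries (Fin n) L) :
    normCoeff π N u (c • ξ) = c * normCoeff π N u ξ := by
  simp [normCoeff, mul_div_assoc]

theorem normCoeff_mul (π : L) (N : ℕ) (u : Fin n →₀ ℕ)
    (ξ η : MvPowerSeries (Fin n) L) :
    normCoeff π N u (ξ * η) = ∑ x ∈ Finset.HasAntidiagonal.antidiagonal u,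
      normCoeff π N x.1 ξ * normCoeff π N x.2 η := by
  rw [normCoeff, MvPowerSeries.coeff_mul, Finset.sum_div]
  refine Finset.sum_congr rfl fun x hx => ?_
  rw [Finset.HasAntidiagonal.mem_antidiagonal] at hx
  rw [normCoeff, normCoeff, div_mul_div_comm, ← pow_add, ← mul_add, ← map_add, hx]

theorem normCoeff_coe (π : L) (N : ℕ) (u : Fin n →₀ ℕ) (g : MvPolynomial (Fin n) L) :
    normCoeff π N u (g : MvPowerSeries (Fin n) L) = coeff u g / π ^ (N * u.degree) := by
  simp [normCoeff]

variable [IsUltrametricDist L]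

theorem mem_dworkFil {π : L} (hπ : π ≠ 0) {N : ℕ} {r : ℤ} {ξ : MvPowerSeries (Fin n) L} :
    ξ ∈ dworkFil π N r ↔ Filter.Tendsto (fun u => normCoeff π N u ξ) Filter.cofinite (nhds 0) ∧
      ∀ u, ‖normCoeff π N u ξ‖ ≤ ‖π‖ ^ r := by
  have hr : 0 < ‖π‖ ^ r := zpow_pos (norm_pos_iff.2 hπ) r
  refine and_congr_right fun _ => forall_congr' fun u => ⟨?_, fun h => ?_⟩
  · rintro ⟨c, hc⟩
    rw [hc, norm_mul, norm_zpow]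
    exact mul_le_of_le_one_right hr.le (mem_integerRing.1 c.2)
  · refine ⟨⟨normCoeff π N u ξ / π ^ r, mem_integerRing.2 ?_⟩,
      (mul_div_cancel₀ _ (zpow_ne_zero r hπ)).symm⟩
    rw [norm_div, norm_zpow]
    exact (div_le_one hr).2 h

theorem mul_mem_dworkFil {π : L} (hπ : π ≠ 0) {N : ℕ} {r s : ℤ} {ξ η : MvPowerSeries (Fin n) L}
    (hξ : ξ ∈ dworkFil π N r) (hη : η ∈ dworkFil π N s) : ξ * η ∈ dworkFil π N (r + s) := by
  have hπ0 := norm_pos_iff.2 hπ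
  rw [mem_dworkFil hπ] at *
  obtain ⟨hξt, hξb⟩ := hξ
  obtain ⟨hηt, hηb⟩ := hη
  refine ⟨?_, fun u => ?_⟩
  · rw [NormedAddGroup.tendsto_nhds_zero] at *
    intro ε hε
    have hr : 0 < ‖π‖ ^ r := zpow_pos hπ0 r
    have hs : 0 < ‖π‖ ^ s := zpow_pos hπ0 s
    have h1 := hξt (ε / 2 / ‖π‖ ^ s) (by positivity)
    have h2 := hηt (ε / 2 / ‖π‖ ^ r) (by positivity)
    rw [Filter.eventually_cofinite] at *
    -- If u is not a sum of two exponents at which the respective coefficients are large, every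
    -- product in the convolution has a small factor. The exceptional u form a sum of two finite
    -- sets.
    refine (h1.add h2).subset fun u hu => ?_
    by_contra hns
    refine hu (lt_of_le_of_lt ?_ (half_lt_self hε))
    rw [normCoeff_mul]
    refine IsUltrametricDist.norm_sum_le_of_forall_le_of_nonneg (by positivity) fun x hx => ?_
    rw [Finset.HasAntidiagonal.mem_antidiagonal] at hx
    rw [norm_mul]
    by_cases hx1 : ‖normCoeff π N x.1 ξ‖ < ε / 2 / ‖π‖ ^ s
    · calc _ ≤ ε / 2 / ‖π‖ ^ s * ‖π‖ ^ s := by gcongr; exact hηb _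
        _ = ε / 2 := by field_simp
    · by_cases hx2 : ‖normCoeff π N x.2 η‖ < ε / 2 / ‖π‖ ^ r
      · calc _ ≤ ‖π‖ ^ r * (ε / 2 / ‖π‖ ^ r) := by gcongr; exact hξb _
          _ = ε / 2 := by field_simp
      · exact absurd (Set.mem_add.2 ⟨x.1, hx1, x.2, hx2, hx⟩) hns
  · rw [normCoeff_mul]
    refine IsUltrametricDist.norm_sum_le_of_forall_le_of_nonneg (by positivity) fun x _ => ?_
    rw [norm_mul, zpow_add₀ hπ0.ne']
    exact mul_le_mul (hξb _) (hηb _) (norm_nonneg _) (by positivity)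

theorem smul_mem_dworkFil {π : L} (hπ : π ≠ 0) {N : ℕ} {r s : ℤ} {ξ : MvPowerSeries (Fin n) L}
    (hξ : ξ ∈ dworkFil π N r) {c : L} (hc : ‖c‖ ≤ ‖π‖ ^ s) : c • ξ ∈ dworkFil π N (s + r) := by
  have hπ0 := norm_pos_iff.2 hπ
  rw [mem_dworkFil hπ] at *
  refine ⟨?_, fun u => ?_⟩
  · simpa [normCoeff_smul] using hξ.1.const_mul c
  · rw [normCoeff_smul, norm_mul, zpow_add₀ hπ0.ne']
    exact mul_le_mul hc (hξ.2 u) (norm_nonneg _) (by positivity)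

theorem zpow_smul_mem_dworkFil {π : L} (hπ : π ≠ 0) {N : ℕ} {r s : ℤ}
    {ξ : MvPowerSeries (Fin n) L} : π ^ s • ξ ∈ dworkFil π N (s + r) ↔ ξ ∈ dworkFil π N r := by
  refine ⟨fun h => ?_, fun h => smul_mem_dworkFil hπ h (norm_zpow _ _).le⟩
  have := smul_mem_dworkFil hπ h (c := π ^ (-s)) (s := -s) (norm_zpow _ _).le
  rwa [neg_add_cancel_left, smul_smul, ← zpow_add₀ hπ, neg_add_cancel, zpow_zero, one_smul]
    at this

theorem dworkFil_anti {π : L} (hπ : π ≠ 0) (hπ1 : ‖π‖ ≤ 1) {N : ℕ} {r s : ℤ} (hrs : r ≤ s) :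
    (dworkFil π N s : Submodule _ (MvPowerSeries (Fin n) L)) ≤ dworkFil π N r := by
  intro ξ hξ
  rw [mem_dworkFil hπ] at *
  exact ⟨hξ.1, fun u => (hξ.2 u).trans
    (zpow_le_zpow_right_of_le_one₀ (norm_pos_iff.2 hπ) hπ1 hrs)⟩

/-- Polynomials are in `dworkFil` as soon as their coefficients satisfy the norm bounds. -/
theorem coe_mem_dworkFil {π : L} (hπ : π ≠ 0) {N : ℕ} {r : ℤ} {g : MvPolynomial (Fin n) L}
    (hg : ∀ u, ‖normCoeff π N u (g : MvPowerSeries (Fin n) L)‖ ≤ ‖π‖ ^ r) :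
    (g : MvPowerSeries (Fin n) L) ∈ dworkFil π N r := by
  rw [mem_dworkFil hπ]
  refine ⟨?_, hg⟩
  refine tendsto_nhds_of_eventually_eq ?_
  rw [Filter.eventually_cofinite]
  refine (g.support.finite_toSet).subset fun u hu => ?_
  rw [Set.mem_ofPred_eq, normCoeff_coe] at hu
  exact mem_support_iff.2 fun h => hu (by rw [h, zero_div])

/-- A monomial of degree |u| ≤ d acquires the normalized coefficient π ^ (N (d - |u|)) times the
original one: integral, and a unit multiple only in top degree. -/
theorem smul_coe_mem_dworkFil {π : L} (hπ : π ≠ 0) (hπ1 : ‖π‖ ≤ 1) {N d : ℕ}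
    {g : MvPolynomial (Fin n) L} (hg : ∀ u, ‖coeff u g‖ ≤ 1)
    (hd : ∀ u, coeff u g ≠ 0 → u.degree ≤ d) :
    π ^ (N * d) • (g : MvPowerSeries (Fin n) L) ∈ dworkFil π N 0 := by
  rw [← coe_smul]
  refine coe_mem_dworkFil hπ fun u => ?_
  rw [normCoeff_coe, coeff_smul, smul_eq_mul, zpow_zero]
  by_cases hu : coeff u g = 0
  · simp [hu]
  obtain ⟨k, rfl⟩ := Nat.exists_eq_add_of_le (hd u hu)
  rw [mul_add, pow_add, mul_assoc, mul_div_cancel_left₀ _ (pow_ne_zero _ hπ), norm_mul, norm_pow]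
  exact mul_le_one₀ (pow_le_one₀ (norm_nonneg _) hπ1) (norm_nonneg _) (hg u)

/-- Differentiation lowers the degree by one, so in normalized coefficients it gains a factor π ^ N.
-/
theorem smul_pderiv_mem_dworkFil {π : L} (hπ : π ≠ 0) (hπ1 : ‖π‖ ≤ 1) {N : ℕ} {ε t : ℤ}
    (ht : t ≤ ε + N) (i : Fin n) {ξ : MvPowerSeries (Fin n) L} (hξ : ξ ∈ dworkFil π N 0) :
    π ^ ε • MvPowerSeries.pderiv L i ξ ∈ dworkFil π N t := by
  have hπ0 := norm_pos_iff.2 hπ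
  rw [mem_dworkFil hπ] at *
  have key : ∀ u : Fin n →₀ ℕ, normCoeff π N u (π ^ ε • MvPowerSeries.pderiv L i ξ) =
      π ^ (ε + N) * (((u i + 1 : ℕ) : L) * normCoeff π N (u + Finsupp.single i 1) ξ) := by
    intro u
    have hdeg : (u + Finsupp.single i 1).degree = u.degree + 1 := by simp
    rw [normCoeff_smul, normCoeff, normCoeff, MvPowerSeries.coeff_pderiv, hdeg, Nat.mul_add, pow_add,
      Nat.mul_one, zpow_add₀ hπ, zpow_natCast]
    push_cast
    field_simp [hπ]
  have hb : ∀ u : Fin n →₀ ℕ, ‖normCoeff π N u (π ^ ε • MvPowerSeries.pderiv L i ξ)‖ ≤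
      ‖π‖ ^ (ε + N) * ‖normCoeff π N (u + Finsupp.single i 1) ξ‖ := by
    intro u
    rw [key, norm_mul, norm_mul, norm_zpow]
    gcongr
    exact mul_le_of_le_one_left (norm_nonneg _) (IsUltrametricDist.norm_natCast_le_one _ _)
  refine ⟨?_, fun u => ?_⟩
  · refine squeeze_zero_norm hb ?_
    have h1 : Filter.Tendsto (fun u : Fin n →₀ ℕ => u + Finsupp.single i 1) Filter.cofinite
        Filter.cofinite := (add_left_injective _).tendsto_cofinite
    simpa using ((hξ.1.comp h1).norm).const_mul (‖π‖ ^ (ε + N))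
  · refine (hb u).trans ?_
    have := hξ.2 (u + Finsupp.single i 1)
    rw [zpow_zero] at this
    exact (mul_le_of_le_one_right (by positivity) this).trans
      (zpow_le_zpow_right_of_le_one₀ hπ0 hπ1 ht)

end Fil

/-! ### The terms of the series Hᵢ -/

section Frob

variable {L : Type*} [NormedField L] {n : ℕ}

theorem coeff_frobTwist (p : ℕ) (hp : p ≠ 0) (fhat : MvPolynomial (Fin n) L) (l : ℕ)
    (w : Fin n →₀ ℕ) : coeff w (frobTwist p fhat l) = coeff w fhat ^ p ^ l := by
  classical
  simp only [frobTwist, coeff_sum, coeff_monomial, Finset.sum_ite_eq', mem_support_iff]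
  by_cases h : coeff w fhat = 0
  · simp [h, hp]
  · simp [h]

/-- The nonzero coefficients of the `l`-th term of `dworkH`. -/
theorem exists_of_coeff_dworkH_term {p : ℕ} (hp : p ≠ 0) (c : L) (fhat : MvPolynomial (Fin n) L)
    (i : Fin n) (l : ℕ) {u : Fin n →₀ ℕ}
    (hu : coeff u (C c * X i ^ (p ^ l - 1) *
      expand (p ^ l) (pderiv i (frobTwist p fhat l))) ≠ 0) :
    ∃ w : Fin n →₀ ℕ, u = Finsupp.single i (p ^ l - 1) + p ^ l • w ∧
      coeff (w + Finsupp.single i 1) fhat ≠ 0 ∧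
      coeff u (C c * X i ^ (p ^ l - 1) * expand (p ^ l) (pderiv i (frobTwist p fhat l))) =
        c * (coeff (w + Finsupp.single i 1) fhat ^ p ^ l * ((w i + 1 : ℕ) : L)) := by
  classical
  have hpl : p ^ l ≠ 0 := pow_ne_zero _ hp
  rw [mul_assoc, coeff_C_mul, X_pow_eq_monomial, coeff_monomial_mul', one_mul] at hu ⊢
  have hle : Finsupp.single i (p ^ l - 1) ≤ u := by
    by_contra h
    rw [if_neg h, mul_zero] at hu
    exact hu rfl
  rw [if_pos hle] at hu ⊢
  have h1 := mem_support_iff.2 (right_ne_zero_of_mul hu)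
  rw [support_expand _ hpl, Finset.mem_image] at h1
  obtain ⟨w, hw, hwu⟩ := h1
  have hwu' : p ^ l • w = u - Finsupp.single i (p ^ l - 1) := hwu
  rw [← hwu', coeff_expand_smul _ hpl, coeff_pderiv, coeff_frobTwist p hp]
  refine ⟨w, by rw [hwu', add_tsub_cancel_of_le hle], fun h0 => ?_, by push_cast; rfl⟩
  rw [mem_support_iff, coeff_pderiv, coeff_frobTwist p hp, h0, zero_pow hpl, zero_mul] at hw
  exact hw rfl

theorem finite_support_dworkH_term {p : ℕ} (hp : 1 < p) (c : ℕ → L)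
    (fhat : MvPolynomial (Fin n) L) (i : Fin n) (u : Fin n →₀ ℕ) :
    Function.support (fun l => coeff u (C (c l) * X i ^ (p ^ l - 1) *
      expand (p ^ l) (pderiv i (frobTwist p fhat l)))) ⊆ ↑(Finset.range (u i + 1 + 1)) := by
  intro l hl
  obtain ⟨w, hw, -⟩ := exists_of_coeff_dworkH_term (by omega) _ fhat i l hl
  have h1 : p ^ l - 1 ≤ u i := by
    rw [hw]
    simp
  have := l.lt_pow_self hp
  rw [Finset.coe_range, Set.mem_Iio]
  omega

end Frob

/-! ### The leading term of the operators Dᵢ -/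

section Dwork

variable {L : Type*} [NormedField L] [IsUltrametricDist L] {F : Type*} [Field F] {n : ℕ}
  {p q v : ℕ} {π : L} {ρ : integerRing L →+* F}

/-- The monomials of the l-th term have degree at most p^l δ - 1, so normalization costs at most π ^
(N (p^l δ - 1)). Together with the order of γ_l p^l and the factor π^ε the exponents add up to (p^l
- 1)(Gp - Nδ) = (p^l - 1) E. -/
theorem norm_dworkH_term_le (h : IsUnif p q v π ρ) {G N δ E : ℕ} {γ : L} (hδ : 1 ≤ δ)
    (hE : E + N * δ = G * p) (hγ : ∀ l, ‖gammaPartial p γ l * (p : L) ^ l‖ ≤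
      ‖π‖ ^ ((G : ℤ) * (p ^ (l + 1) - (p - 1))))
    {fhat : MvPolynomial (Fin n) L} (hf : ∀ u, ‖coeff u fhat‖ ≤ 1)
    (hfd : ∀ u, coeff u fhat ≠ 0 → u.degree ≤ δ) (i : Fin n) (l : ℕ) (u : Fin n →₀ ℕ) :
    ‖π ^ (((N * (δ - 1) : ℕ) : ℤ) - G) * coeff u (C (gammaPartial p γ l * (p : L) ^ l) *
      X i ^ (p ^ l - 1) * expand (p ^ l) (pderiv i (frobTwist p fhat l))) /
      π ^ (N * u.degree)‖ ≤ ‖π‖ ^ ((p ^ l - 1) * E) := by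
  by_cases hu : coeff u (C (gammaPartial p γ l * (p : L) ^ l) *
      X i ^ (p ^ l - 1) * expand (p ^ l) (pderiv i (frobTwist p fhat l))) = 0
  · rw [hu, mul_zero, zero_div, norm_zero]
    positivity
  have hπ0 := h.norm_pos
  obtain ⟨w, hw, hwf, hwe⟩ := exists_of_coeff_dworkH_term h.prime.ne_zero _ fhat i l hu
  have hwd := hfd _ hwf
  have hdw : (w + Finsupp.single i 1).degree = w.degree + 1 := by simp
  rw [hdw] at hwd
  have hpl : 1 ≤ p ^ l := Nat.one_le_pow _ _ h.prime.pos
  have hud : u.degree + 1 ≤ p ^ l * δ := by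
    have : u.degree = (p ^ l - 1) + p ^ l * w.degree := by
      rw [hw, map_add, Finsupp.degree_single, map_nsmul, smul_eq_mul]
    calc u.degree + 1 = p ^ l * (w.degree + 1) := by rw [this, Nat.mul_add]; omega
      _ ≤ p ^ l * δ := Nat.mul_le_mul_left _ hwd
  rw [hwe, norm_div, norm_mul, norm_mul, norm_zpow, norm_pow]
  have hnf : ‖coeff (w + Finsupp.single i 1) fhat ^ p ^ l * ((w i + 1 : ℕ) : L)‖ ≤ 1 := by
    rw [norm_mul, norm_pow]
    exact mul_le_one₀ (pow_le_one₀ (norm_nonneg _) (hf _)) (norm_nonneg _)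
      (IsUltrametricDist.norm_natCast_le_one _ _)
  calc _ ≤ ‖π‖ ^ (((N * (δ - 1) : ℕ) : ℤ) - G) *
        (‖π‖ ^ ((G : ℤ) * (p ^ (l + 1) - (p - 1))) * 1) / ‖π‖ ^ (N * u.degree) := by
        gcongr
        exact hγ l
    _ = ‖π‖ ^ ((((N * (δ - 1) : ℕ) : ℤ) - G) + (G : ℤ) * (p ^ (l + 1) - (p - 1)) -
        ((N * u.degree : ℕ) : ℤ)) := by
        rw [mul_one, ← zpow_natCast ‖π‖ (N * u.degree), ← zpow_add₀ hπ0.ne', ← zpow_sub₀ hπ0.ne']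
    _ ≤ ‖π‖ ^ (((p ^ l - 1) * E : ℕ) : ℤ) := by
        refine zpow_le_zpow_right_of_le_one₀ hπ0 h.norm_lt.le ?_
        have h1 : (E : ℤ) = G * p - N * δ := by
          have : (E : ℤ) + N * δ = G * p := by exact_mod_cast hE
          linarith
        have h2 : (N : ℤ) * (u.degree + 1) ≤ N * (p ^ l * δ) := by
          exact_mod_cast Nat.mul_le_mul_left N hud
        push_cast [Nat.cast_sub hpl, Nat.cast_sub hδ]
        rw [h1, pow_succ]
        nlinarith
    _ = _ := zpow_natCast _ _

/-- The term l = 0 of Hᵢ is γ ∂f̂/∂xᵢ, which after scaling is the one subtracted here. The terms l ≥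
1 have order at least (p^l - 1) E ≥ (p - 1) E ≥ t, and because E ≥ 1 these bounds grow with l, which
gives the convergence A_u → 0. -/
theorem smul_dworkH_sub_mem (h : IsUnif p q v π ρ) {G N δ E : ℕ} {γ : L} (hδ : 1 ≤ δ)
    (hE : E + N * δ = G * p) (hE0 : 1 ≤ E) (hγ : ∀ l, ‖gammaPartial p γ l * (p : L) ^ l‖ ≤
      ‖π‖ ^ ((G : ℤ) * (p ^ (l + 1) - (p - 1))))
    {fhat : MvPolynomial (Fin n) L} (hf : ∀ u, ‖coeff u fhat‖ ≤ 1)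
    (hfd : ∀ u, coeff u fhat ≠ 0 → u.degree ≤ δ) (i : Fin n) {t : ℕ} (ht : t ≤ (p - 1) * E) :
    π ^ (((N * (δ - 1) : ℕ) : ℤ) - G) • dworkH p γ fhat i - (γ / π ^ G) • (π ^ (N * (δ - 1)) •
      (pderiv i fhat : MvPowerSeries (Fin n) L)) ∈ dworkFil π N (t : ℤ) := by
  have hπ0 := h.norm_pos
  have hp1 := h.prime.one_lt
  set T : ℕ → MvPolynomial (Fin n) L := fun l => C (gammaPartial p γ l * (p : L) ^ l) *
      X i ^ (p ^ l - 1) * expand (p ^ l) (pderiv i (frobTwist p fhat l)) with hT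
  set B : (Fin n →₀ ℕ) → ℕ → L := fun u l =>
    π ^ (((N * (δ - 1) : ℕ) : ℤ) - G) * coeff u (T l) / π ^ (N * u.degree) with hB
  have hBn : ∀ u l, ‖B u l‖ ≤ ‖π‖ ^ ((p ^ l - 1) * E) := fun u l =>
    norm_dworkH_term_le h hδ hE hγ hf hfd i l u
  have hfT : frobTwist p fhat 0 = fhat := by
    ext w
    rw [coeff_frobTwist p h.prime.ne_zero, pow_zero, pow_one]
  have hT0 : T 0 = C γ * pderiv i fhat := by
    simp [hT, hfT, gammaPartial]
  have key : ∀ u, normCoeff π N u (π ^ (((N * (δ - 1) : ℕ) : ℤ) - G) • dworkH p γ fhat i -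
      (γ / π ^ G) • (π ^ (N * (δ - 1)) • (pderiv i fhat : MvPowerSeries (Fin n) L))) =
      ∑ l ∈ Finset.range (u i + 1), B u (l + 1) := by
    intro u
    have hH : MvPowerSeries.coeff u (dworkH p γ fhat i) =
        ∑ l ∈ Finset.range (u i + 1 + 1), coeff u (T l) :=
      finsum_eq_sum_of_support_subset _ (finite_support_dworkH_term hp1
        (fun l => gammaPartial p γ l * (p : L) ^ l) fhat i u)
    rw [Finset.sum_range_succ', hT0] at hH
    rw [normCoeff_sub, normCoeff_smul, normCoeff_smul, normCoeff_smul, normCoeff_coe, normCoeff,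
      hH, coeff_C_mul, zpow_sub₀ h.pi_ne_zero, zpow_natCast, zpow_natCast]
    simp only [hB]
    rw [← Finset.sum_div, ← Finset.mul_sum, zpow_sub₀ h.pi_ne_zero, zpow_natCast, zpow_natCast]
    field_simp [h.pi_ne_zero]
    ring
  rw [mem_dworkFil h.pi_ne_zero]
  have hexp : ∀ l, l ≤ (p ^ l - 1) * E := fun l =>
    (Nat.le_sub_one_of_lt (l.lt_pow_self hp1)).trans (Nat.le_mul_of_pos_right _ hE0)
  refine ⟨?_, fun u => ?_⟩
  · rw [NormedAddGroup.tendsto_nhds_zero]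
    intro ε hε
    obtain ⟨l₀, hl₀⟩ := exists_pow_lt_of_lt_one hε h.norm_lt
    rw [Filter.eventually_cofinite]
    -- Outside the finitely many monomials of the first l₀ terms only indices l ≥ l₀ contribute, and
    -- these have norm at most ‖π‖ ^ l₀.
    refine ((Finset.range l₀).biUnion fun l => (T l).support).finite_toSet.subset fun u hu => ?_
    by_contra hns
    refine hu (lt_of_le_of_lt ?_ hl₀)
    rw [key]
    refine IsUltrametricDist.norm_sum_le_of_forall_le_of_nonneg (by positivity) fun l _ => ?_
    by_cases hl : l + 1 < l₀
    · have : coeff u (T (l + 1)) = 0 := by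
        by_contra hne
        exact hns (Finset.mem_coe.2 (Finset.mem_biUnion.2
          ⟨l + 1, Finset.mem_range.2 hl, mem_support_iff.2 hne⟩))
      simp only [hB, this, mul_zero, zero_div, norm_zero]
      positivity
    · exact (hBn u _).trans (pow_le_pow_of_le_one hπ0.le h.norm_lt.le
        (le_trans (by omega) (hexp (l + 1))))
  · rw [key, zpow_natCast]
    refine IsUltrametricDist.norm_sum_le_of_forall_le_of_nonneg (by positivity) fun l _ => ?_
    refine (hBn u _).trans (pow_le_pow_of_le_one hπ0.le h.norm_lt.le (ht.trans ?_))
    exact Nat.mul_le_mul_right _ (Nat.sub_le_sub_right (Nat.le_self_pow l.succ_ne_zero p) 1)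

/-- The leading part of `dworkDi`. -/
theorem dworkDi_sub_mem (h : IsUnif p q v π ρ) {G N δ E : ℕ} {γ : L} (hδ : 1 ≤ δ)
    (hE : E + N * δ = G * p) (hE0 : 1 ≤ E) (hγ : ∀ l, ‖gammaPartial p γ l * (p : L) ^ l‖ ≤
      ‖π‖ ^ ((G : ℤ) * (p ^ (l + 1) - (p - 1))))
    {fhat : MvPolynomial (Fin n) L} (hf : ∀ u, ‖coeff u fhat‖ ≤ 1)
    (hfd : ∀ u, coeff u fhat ≠ 0 → u.degree ≤ δ) (i : Fin n) {t : ℕ} (ht : t ≤ (p - 1) * E)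
    (ht' : t + G ≤ N * δ) {ξ : MvPowerSeries (Fin n) L} (hξ : ξ ∈ dworkFil π N 0) :
    dworkDi p π γ (((N * (δ - 1) : ℕ) : ℤ) - G) fhat i ξ - (γ / π ^ G) • (π ^ (N * (δ - 1)) •
      ((pderiv i fhat : MvPowerSeries (Fin n) L) * ξ)) ∈ dworkFil π N (t : ℤ) := by
  have h1 := smul_dworkH_sub_mem h hδ hE hE0 hγ hf hfd i ht
  have h2 := mul_mem_dworkFil h.pi_ne_zero h1 hξ
  -- The derivative term has order at least ε + N = Nδ - G, and `ht'` says that this is at least t.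
  have h3 := smul_pderiv_mem_dworkFil h.pi_ne_zero h.norm_lt.le (N := N)
    (ε := ((N * (δ - 1) : ℕ) : ℤ) - G) (t := t) (by
      obtain ⟨d, rfl⟩ : ∃ d, δ = d + 1 := ⟨δ - 1, by omega⟩
      rw [Nat.mul_succ] at ht'
      rw [Nat.add_sub_cancel]
      have : (t : ℤ) + G ≤ ((N * d : ℕ) : ℤ) + N := by exact_mod_cast ht'
      linarith) i hξ
  rw [add_zero] at h2
  convert Submodule.add_mem _ h3 h2 using 1
  simp only [dworkDi, LinearMap.coe_restrictScalars, LinearMap.smul_apply, LinearMap.add_apply,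
    LinearMap.mulLeft_apply, sub_mul, smul_mul_assoc, smul_add]
  rw [add_sub_assoc]
  rfl

end Dwork

/-! ### Forms -/

theorem formDiff_apply {R A : Type*} [CommRing R] [AddCommGroup A] [Module R A] {n : ℕ}
    (D : Fin n → A →ₗ[R] A) (ω : Form n A) (T : Finset (Fin n)) :
    formDiff D ω T =
      ∑ i ∈ T, (-1 : ℤ) ^ (T.filter (fun j => j < i)).card • D i (ω (T.erase i)) := rfl

theorem formDiff_eq_zero {R A : Type*} [CommRing R] [AddCommGroup A] [Module R A] {n k : ℕ}
    (D : Fin n → A →ₗ[R] A) {ω : Form n A} (hω : ∀ S : Finset (Fin n), S.card ≠ k → ω S = 0)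
    {T : Finset (Fin n)} (hT : T.card ≠ k + 1) : formDiff D ω T = 0 := by
  rw [formDiff_apply]
  refine Finset.sum_eq_zero fun i hi => ?_
  have : (T.erase i).card ≠ k := by
    have := Finset.card_erase_add_one hi
    omega
  rw [hω _ this, map_zero, smul_zero]

/-! ### Polynomial forms and the degree filtration -/

section Poly

variable {F : Type*} [Field F] {n : ℕ}

/-- The part of a form with homogeneous coefficients of degree `c`. -/
def homPart (c : ℕ) :
    Form n (MvPolynomial (Fin n) F) →ₗ[F] Form n (MvPolynomial (Fin n) F) :=
  (homogeneousComponent c).compLeft (Finset (Fin n))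

theorem coeff_homPart (c : ℕ) (ω : Form n (MvPolynomial (Fin n) F)) (S : Finset (Fin n))
    (u : Fin n →₀ ℕ) : coeff u (homPart c ω S) = if u.degree = c then coeff u (ω S) else 0 :=
  coeff_homogeneousComponent c (ω S) u

/-- Splitting a form into its homogeneous parts turns the span into a degree bound on each monomial,
the form in which the filtration is used from here on. -/
theorem mem_polyFil {δ : ℕ} {l : ℤ} {k : ℕ} {ω : Form n (MvPolynomial (Fin n) F)} :
    ω ∈ polyFil n δ l k ↔ (∀ S, S.card ≠ k → ω S = 0) ∧
      ∀ S u, coeff u (ω S) ≠ 0 → ((u.degree + (n - k) * (δ - 1) : ℕ) : ℤ) ≤ l := by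
  constructor
  · intro h
    refine Submodule.span_induction (p := fun ω _ => (∀ S, S.card ≠ k → ω S = 0) ∧
      ∀ S u, coeff u (ω S) ≠ 0 → ((u.degree + (n - k) * (δ - 1) : ℕ) : ℤ) ≤ l) ?_ ?_ ?_ ?_ h
    · rintro ω ⟨c, ⟨hω, hc⟩, hl⟩
      refine ⟨hω.2, fun S u hu => ?_⟩
      have : u.degree = c := by
        by_contra hne
        exact hu ((hc S).coeff_eq_zero hne)
      rw [this]
      exact hl
    · exact ⟨fun _ _ => rfl, fun S u hu => absurd (coeff_zero u) hu⟩
    · rintro x y - - ⟨hx, hx'⟩ ⟨hy, hy'⟩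
      refine ⟨fun S hS => by rw [Pi.add_apply, hx S hS, hy S hS, add_zero], fun S u hu => ?_⟩
      rw [Pi.add_apply, coeff_add] at hu
      by_cases h0 : coeff u (x S) = 0
      · rw [h0, zero_add] at hu
        exact hy' S u hu
      · exact hx' S u h0
    · rintro c x - ⟨hx, hx'⟩
      refine ⟨fun S hS => by rw [Pi.smul_apply, hx S hS, smul_zero], fun S u hu => ?_⟩
      rw [Pi.smul_apply, coeff_smul, smul_eq_mul] at hu
      exact hx' S u (right_ne_zero_of_mul hu)
  · rintro ⟨h1, h2⟩
    set B := Finset.univ.sup fun S => (ω S).totalDegree with hB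
    have hsum : ω = ∑ c ∈ Finset.range (B + 1), homPart c ω := by
      funext S
      ext u
      rw [Finset.sum_apply, coeff_sum]
      simp only [coeff_homPart, Finset.sum_ite_eq, Finset.mem_range]
      split_ifs with hu
      · rfl
      · refine coeff_eq_zero_of_totalDegree_lt (lt_of_le_of_lt
          (Finset.le_sup (f := fun S => (ω S).totalDegree) (Finset.mem_univ S)) ?_)
        change B < u.degree
        omega
    rw [hsum]
    refine Submodule.sum_mem _ fun c _ => ?_
    by_cases hc : homPart c ω = 0
    · rw [hc]
      exact Submodule.zero_mem _
    obtain ⟨S, hS⟩ := Function.ne_iff.1 hc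
    obtain ⟨u, hu⟩ := MvPolynomial.ne_zero_iff.1 hS
    rw [coeff_homPart] at hu
    have hud : u.degree = c := by
      by_contra h
      rw [if_neg h] at hu
      exact hu rfl
    rw [if_pos hud] at hu
    refine Submodule.subset_span ⟨c, ⟨⟨fun _ => trivial, fun S hS => ?_⟩, fun S =>
      homogeneousComponent_isHomogeneous c (ω S)⟩, hud ▸ h2 S u hu⟩
    change homogeneousComponent c (ω S) = 0
    rw [h1 S hS, map_zero]

theorem coeff_formDiff_mulLeft {R : Type*} [CommRing R] (g : Fin n → MvPolynomial (Fin n) R)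
    (ω : Form n (MvPolynomial (Fin n) R)) (T : Finset (Fin n)) (u : Fin n →₀ ℕ) :
    coeff u (formDiff (fun i => LinearMap.mulLeft R (g i)) ω T) =
      ∑ i ∈ T, (-1 : R) ^ (T.filter (fun j => j < i)).card * coeff u (g i * ω (T.erase i)) := by
  rw [formDiff_apply, coeff_sum]
  refine Finset.sum_congr rfl fun i _ => ?_
  rw [LinearMap.mulLeft_apply, ← Int.cast_smul_eq_zsmul R, coeff_smul, smul_eq_mul]
  push_cast
  rfl

theorem exists_of_coeff_formDiff_ne_zero {R : Type*} [CommRing R]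
    {g : Fin n → MvPolynomial (Fin n) R} {ω : Form n (MvPolynomial (Fin n) R)}
    {T : Finset (Fin n)} {u : Fin n →₀ ℕ}
    (hu : coeff u (formDiff (fun i => LinearMap.mulLeft R (g i)) ω T) ≠ 0) :
    ∃ i ∈ T, ∃ x y, x + y = u ∧ coeff x (g i) ≠ 0 ∧ coeff y (ω (T.erase i)) ≠ 0 := by
  rw [coeff_formDiff_mulLeft] at hu
  obtain ⟨i, hi, hne⟩ := Finset.exists_ne_zero_of_sum_ne_zero hu
  have h1 := right_ne_zero_of_mul hne
  rw [coeff_mul] at h1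
  obtain ⟨x, hx, hne⟩ := Finset.exists_ne_zero_of_sum_ne_zero h1
  exact ⟨i, hi, x.1, x.2, Finset.HasAntidiagonal.mem_antidiagonal.1 hx, left_ne_zero_of_mul hne,
    right_ne_zero_of_mul hne⟩

/-- The degree of `df ∧ ω` is at most that of `ω` increased by `d`. -/
theorem degree_le_of_coeff_formDiff_ne_zero {R : Type*} [CommRing R]
    {g : Fin n → MvPolynomial (Fin n) R} {d : ℕ}
    (hg : ∀ i u, coeff u (g i) ≠ 0 → u.degree ≤ d)
    {ω : Form n (MvPolynomial (Fin n) R)} {c : ℤ}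
    (hω : ∀ S u, coeff u (ω S) ≠ 0 → (u.degree : ℤ) ≤ c) {T : Finset (Fin n)} {u : Fin n →₀ ℕ}
    (hu : coeff u (formDiff (fun i => LinearMap.mulLeft R (g i)) ω T) ≠ 0) :
    (u.degree : ℤ) ≤ c + d := by
  obtain ⟨i, -, x, y, rfl, hx, hy⟩ := exists_of_coeff_formDiff_ne_zero hu
  have h1 := hg i x hx
  have h2 := hω _ y hy
  rw [map_add]
  push_cast
  omega

end Poly

/-- The supremum has at most one term, that of degree k - 1, and is zero for k = 0. -/
theorem mem_iSup_map_cycles {R X : Type*} [CommRing R] [AddCommGroup X] [Module R X]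
    {d : X →ₗ[R] X} {Fil : ℤ → ℕ → Submodule R X} {t r : ℤ} {k : ℕ} {x : X} :
    (x ∈ ⨆ (j : ℕ) (_ : j + 1 = k), (cycles d Fil t r j).map d) ↔
      x = 0 ∨ ∃ j, j + 1 = k ∧ ∃ η ∈ cycles d Fil t r j, d η = x := by
  constructor
  · intro h
    cases k with
    | zero => left; simpa using h
    | succ k =>
      have : (⨆ (j : ℕ) (_ : j + 1 = k + 1), (cycles d Fil t r j).map d) ≤
          (cycles d Fil t r k).map d := iSup₂_le fun j hj => by
        obtain rfl : j = k := by omega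
        exact le_rfl
      obtain ⟨η, hη, hx⟩ := this h
      exact Or.inr ⟨k, rfl, η, hη, hx⟩
  · rintro (rfl | ⟨j, hj, η, hη, rfl⟩)
    · exact Submodule.zero_mem _
    · exact Submodule.mem_iSup_of_mem j (Submodule.mem_iSup_of_mem hj ⟨η, hη, rfl⟩)

/-! ### The leading part of Dwork's differential -/

section Lead

variable {L : Type*} [NormedField L] [IsUltrametricDist L] {F : Type*} [Field F] {n : ℕ}
  {p q v : ℕ} {π : L} {ρ : integerRing L →+* F} {s : F → L}

/-- The polynomials `g i` lift `g₀ i`, have coefficients fixed by Frobenius modulo `p`, and degree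
at most `d`. -/
structure IsLift (p q : ℕ) (ρ : integerRing L →+* F) (d : ℕ) (g : Fin n → MvPolynomial (Fin n) L)
    (g₀ : Fin n → MvPolynomial (Fin n) F) : Prop where
  fixed : ∀ i u, FrobFixed p q (coeff u (g i))
  res_eq : ∀ i u, res ρ (coeff u (g i)) = coeff u (g₀ i)
  deg : ∀ i u, coeff u (g i) ≠ 0 → u.degree ≤ d

theorem IsLift.deg_res {d : ℕ} {g : Fin n → MvPolynomial (Fin n) L}
    {g₀ : Fin n → MvPolynomial (Fin n) F} (hg : IsLift p q ρ d g g₀) (i : Fin n) (u : Fin n →₀ ℕ)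
    (hu : coeff u (g₀ i) ≠ 0) : u.degree ≤ d :=
  hg.deg i u fun h => hu (by rw [← hg.res_eq, h, res_zero])

/-- The leading part `ω ↦ π ^ (N d) ∑ gᵢ dxᵢ ∧ ω` of Dwork's differential. -/
def leadMap (π : L) (N d : ℕ) (g : Fin n → MvPolynomial (Fin n) L) :
    Form n (MvPowerSeries (Fin n) L) →ₗ[L] Form n (MvPowerSeries (Fin n) L) :=
  formDiff fun i => LinearMap.mulLeft L (π ^ (N * d) • (g i : MvPowerSeries (Fin n) L))

/-- The map `ω ↦ ∑ gᵢ dxᵢ ∧ ω` on polynomial forms. -/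
def polyWedge {R : Type*} [CommRing R] (g : Fin n → MvPolynomial (Fin n) R) :
    Form n (MvPolynomial (Fin n) R) →ₗ[R] Form n (MvPolynomial (Fin n) R) :=
  formDiff fun i => LinearMap.mulLeft R (g i)

theorem mem_dworkFormFil {N : ℕ} {r : ℤ} {k : ℕ} {ω : Form n (MvPowerSeries (Fin n) L)} :
    ω ∈ dworkFormFil n π N r k ↔ (∀ S, ω S ∈ dworkFil π N r) ∧ ∀ S, S.card ≠ k → ω S = 0 :=
  Iff.rfl

theorem norm_normCoeff_le (hπ : π ≠ 0) {N : ℕ} {r : ℤ} {k : ℕ}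
    {ω : Form n (MvPowerSeries (Fin n) L)} (hω : ω ∈ dworkFormFil n π N r k)
    (S : Finset (Fin n)) (u : Fin n →₀ ℕ) : ‖normCoeff π N u (ω S)‖ ≤ ‖π‖ ^ r :=
  ((mem_dworkFil hπ).1 (hω.1 S)).2 u

theorem zpow_smul_mem_dworkFormFil (hπ : π ≠ 0) {N : ℕ} {r s : ℤ} {k : ℕ}
    {ω : Form n (MvPowerSeries (Fin n) L)} :
    π ^ s • ω ∈ dworkFormFil n π N (s + r) k ↔ ω ∈ dworkFormFil n π N r k := by
  rw [mem_dworkFormFil, mem_dworkFormFil]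
  refine and_congr (forall_congr' fun S => ?_) (forall_congr' fun S => imp_congr_right fun _ => ?_)
  · exact zpow_smul_mem_dworkFil hπ
  · rw [Pi.smul_apply, smul_eq_zero_iff_right (zpow_ne_zero s hπ)]

theorem smul_mem_dworkFormFil (hπ : π ≠ 0) {N : ℕ} {r : ℤ} {k : ℕ}
    {ω : Form n (MvPowerSeries (Fin n) L)} (hω : ω ∈ dworkFormFil n π N r k) {c : L}
    (hc : ‖c‖ ≤ 1) : c • ω ∈ dworkFormFil n π N r k := by
  refine ⟨fun S => ?_, fun S hS => by rw [Pi.smul_apply, hω.2 S hS, smul_zero]⟩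
  have := smul_mem_dworkFil hπ (hω.1 S) (c := c) (s := 0) (by simpa using hc)
  rwa [zero_add] at this

theorem dworkFormFil_anti (hπ : π ≠ 0) (hπ1 : ‖π‖ ≤ 1) {N : ℕ} {r s : ℤ} (hrs : r ≤ s) {k : ℕ} :
    dworkFormFil n π N s k ≤ dworkFormFil n π N r k := fun _ hω =>
  ⟨fun S => dworkFil_anti hπ hπ1 hrs (hω.1 S), hω.2⟩

theorem IsLift.leadMap_mem {d : ℕ} {g : Fin n → MvPolynomial (Fin n) L}
    {g₀ : Fin n → MvPolynomial (Fin n) F} (hg : IsLift p q ρ d g g₀) (hπ : π ≠ 0)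
    (hπ1 : ‖π‖ ≤ 1) {N k : ℕ} {ω : Form n (MvPowerSeries (Fin n) L)}
    (hω : ω ∈ dworkFormFil n π N 0 k) : leadMap π N d g ω ∈ dworkFormFil n π N 0 (k + 1) := by
  refine ⟨fun T => ?_, fun T hT => formDiff_eq_zero _ hω.2 hT⟩
  rw [leadMap, formDiff_apply]
  refine Submodule.sum_mem _ fun i _ => zsmul_mem ?_ _
  have := mul_mem_dworkFil hπ (smul_coe_mem_dworkFil (N := N) hπ hπ1
    (fun u => (hg.fixed i u).1) (hg.deg i)) (hω.1 (T.erase i))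
  rwa [add_zero] at this

theorem normCoeff_leadMap (N d : ℕ) (g : Fin n → MvPolynomial (Fin n) L)
    (ω : Form n (MvPowerSeries (Fin n) L)) (T : Finset (Fin n)) (u : Fin n →₀ ℕ) :
    normCoeff π N u (leadMap π N d g ω T) = ∑ i ∈ T, (-1) ^ (T.filter (fun j => j < i)).card *
      normCoeff π N u (π ^ (N * d) • ((g i : MvPowerSeries (Fin n) L) * ω (T.erase i))) := by
  rw [leadMap, formDiff_apply, normCoeff, map_sum, Finset.sum_div]
  refine Finset.sum_congr rfl fun i _ => ?_
  rw [LinearMap.mulLeft_apply, ← Int.cast_smul_eq_zsmul L, smul_mul_assoc]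
  change normCoeff π N u (_ • _) = _
  rw [normCoeff_smul]
  push_cast
  rfl

/-! ### Diagonals of digits -/

/-- The polynomial with coefficients `dig_{N (c - |u|)}(A_u)` for `0 ≤ c - |u| < e`, where `A_u`
are the normalized coefficients of `ξ`. -/
def diagPart (ρ : integerRing L →+* F) (π : L) (s : F → L) (N e : ℕ) (c : ℤ)
    (ξ : MvPowerSeries (Fin n) L) : MvPolynomial (Fin n) F :=
  ∑ u ∈ (Finsupp.finite_of_degree_le (σ := Fin n) c.toNat).toFinset,
    monomial u (if (u.degree : ℤ) ≤ c ∧ c - u.degree < e then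
      dig ρ π s (N * (c - u.degree).toNat) (normCoeff π N u ξ) else 0)

theorem coeff_diagPart (N e : ℕ) (c : ℤ) (ξ : MvPowerSeries (Fin n) L) (u : Fin n →₀ ℕ) :
    coeff u (diagPart ρ π s N e c ξ) = if (u.degree : ℤ) ≤ c ∧ c - u.degree < e then
      dig ρ π s (N * (c - u.degree).toNat) (normCoeff π N u ξ) else 0 := by
  classical
  rw [diagPart, coeff_sum]
  simp only [coeff_monomial, Finset.sum_ite_eq', Set.Finite.mem_toFinset, Set.mem_ofPred_eq]
  split_ifs with h1 h2 h2
  · rfl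
  · rfl
  · exact absurd (by omega : u.degree ≤ c.toNat) h1
  · rfl

/-- In the convolution at x₁ + x₂ = u the factor g contributes its coefficient times π ^ (N (d -
|x₁|)). This shifts digits by N (d - |x₁|), so the digit of index Ni of the product comes from the
digit of A_{x₂} of index N (i - d + |x₁|) = N (c - |x₂|), a point of the diagonal. If |x₂| > c the
shift exceeds Ni and nothing is left. All indices stay below v, where digits are linear. -/
theorem dig_normCoeff_mul (h : IsUnif p q v π ρ) (hs : IsFrobSection p q ρ s) {N e d : ℕ}
    (ht : N * (e - 1) < v) (hN : 0 < N) {g : MvPolynomial (Fin n) L}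
    {g₀ : MvPolynomial (Fin n) F} (hgf : ∀ u, FrobFixed p q (coeff u g))
    (hg : ∀ u, res ρ (coeff u g) = coeff u g₀) (hgd : ∀ u, coeff u g ≠ 0 → u.degree ≤ d)
    {ξ : MvPowerSeries (Fin n) L} (hξ : ξ ∈ dworkFil π N 0) {c : ℤ} {i : ℕ} (hi : i < e)
    {u : Fin n →₀ ℕ} (hu : (u.degree : ℤ) + i = c + d) :
    dig ρ π s (N * i) (normCoeff π N u (π ^ (N * d) • ((g : MvPowerSeries (Fin n) L) * ξ))) =
      coeff u (g₀ * diagPart ρ π s N e c ξ) := by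
  have hξ1 : ∀ u, ‖normCoeff π N u ξ‖ ≤ 1 := fun u => by
    simpa using ((mem_dworkFil h.pi_ne_zero).1 hξ).2 u
  have hNi : N * i < v := lt_of_le_of_lt (Nat.mul_le_mul_left _ (by omega)) ht
  have hterm : ∀ x : (Fin n →₀ ℕ) × (Fin n →₀ ℕ),
      π ^ (N * d) * (normCoeff π N x.1 (g : MvPowerSeries (Fin n) L) * normCoeff π N x.2 ξ) =
        π ^ (N * (d - x.1.degree)) * (coeff x.1 g * normCoeff π N x.2 ξ) := by
    intro x
    rw [normCoeff_coe]
    by_cases hx : coeff x.1 g = 0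
    · simp [hx]
    obtain ⟨k, hk⟩ := Nat.exists_eq_add_of_le (hgd _ hx)
    rw [hk, Nat.add_sub_cancel_left, Nat.mul_add, pow_add]
    field_simp [h.pi_ne_zero]
  have hn1 : ∀ x : (Fin n →₀ ℕ) × (Fin n →₀ ℕ), ‖coeff x.1 g * normCoeff π N x.2 ξ‖ ≤ 1 := by
    intro x
    rw [norm_mul]
    exact mul_le_one₀ (hgf _).1 (norm_nonneg _) (hξ1 _)
  rw [normCoeff_smul, normCoeff_mul, Finset.mul_sum, coeff_mul,
    Finset.sum_congr rfl fun x _ => hterm x, h.dig_sum hs hNi]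
  · refine Finset.sum_congr rfl fun x hx => ?_
    rw [Finset.HasAntidiagonal.mem_antidiagonal] at hx
    have hdeg : x.1.degree + x.2.degree = u.degree := by rw [← map_add, hx]
    rw [coeff_diagPart, ← hg]
    by_cases hx0 : coeff x.1 g = 0
    · rw [hx0, zero_mul, mul_zero, res_zero, zero_mul, h.dig_zero hs hNi]
    have hxd := hgd _ hx0
    by_cases hc : (x.2.degree : ℤ) ≤ c
    · rw [if_pos ⟨hc, by omega⟩]
      have hi' : i = (c - x.2.degree).toNat + (d - x.1.degree) := by omega
      rw [← h.dig_fixed_mul hs (lt_of_le_of_lt (Nat.mul_le_mul_left _ (by omega)) hNi) (hgf _)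
        (hξ1 _)]
      conv_lhs => rw [hi', Nat.mul_add]
      refine h.dig_pow_mul hs ?_ (hn1 x)
      rw [← Nat.mul_add, ← hi']
      exact hNi
    · rw [if_neg (fun h => hc h.1), mul_zero]
      exact h.dig_pow_mul_of_lt hs hNi (Nat.mul_lt_mul_of_pos_left (by omega) hN) (hn1 x)
  · intro x _
    rw [norm_mul, norm_pow]
    exact mul_le_one₀ (pow_le_one₀ h.norm_pos.le h.norm_lt.le) (norm_nonneg _) (hn1 x)

theorem norm_neg_one_pow_mul_le {x : L} {B : ℝ} (k : ℕ) (hx : ‖x‖ ≤ B) : ‖(-1) ^ k * x‖ ≤ B := by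
  rwa [norm_mul, norm_pow, norm_neg, norm_one, one_pow, one_mul]

theorem IsUnif.fixed_neg_one_pow (h : IsUnif p q v π ρ) (k : ℕ) :
    FrobFixed p q ((-1 : L) ^ k) := by
  induction k with
  | zero => simpa using h.fixed_one
  | succ k ih => rw [pow_succ]; exact h.fixed_mul ih h.fixed_neg_one

theorem res_neg_one_pow (ρ : integerRing L →+* F) (k : ℕ) : res ρ ((-1 : L) ^ k) = (-1) ^ k := by
  have h1 : res ρ (-1 : L) = -1 := by
    have := res_sub ρ (x := (0 : L)) (y := 1) (by simp) (by simp)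
    simpa using this
  induction k with
  | zero => simp
  | succ k ih => rw [pow_succ, res_mul ρ (by simp) (by simp), ih, h1, pow_succ]

/-- Digits of the leading part of the differential are computed by the wedge product with `g₀`. -/
theorem dig_normCoeff_leadMap (h : IsUnif p q v π ρ) (hs : IsFrobSection p q ρ s) {N e d k : ℕ}
    (ht : N * (e - 1) < v) (hN : 0 < N) {g : Fin n → MvPolynomial (Fin n) L}
    {g₀ : Fin n → MvPolynomial (Fin n) F} (hg : IsLift p q ρ d g g₀)
    {ω : Form n (MvPowerSeries (Fin n) L)} (hω : ω ∈ dworkFormFil n π N 0 k) {c : ℤ} {i : ℕ}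
    (hi : i < e) {u : Fin n →₀ ℕ} (hu : (u.degree : ℤ) + i = c + d) (T : Finset (Fin n)) :
    dig ρ π s (N * i) (normCoeff π N u (leadMap π N d g ω T)) =
      coeff u (polyWedge g₀ (fun S => diagPart ρ π s N e c (ω S)) T) := by
  have hNi : N * i < v := lt_of_le_of_lt (Nat.mul_le_mul_left _ (by omega)) ht
  have hb : ∀ j : Fin n, ‖normCoeff π N u
      (π ^ (N * d) • ((g j : MvPowerSeries (Fin n) L) * ω (T.erase j)))‖ ≤ 1 := by
    intro j
    have := mul_mem_dworkFil h.pi_ne_zero (smul_coe_mem_dworkFil (N := N) h.pi_ne_zero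
      h.norm_lt.le (fun u => (hg.fixed j u).1) (hg.deg j)) (hω.1 (T.erase j))
    rw [smul_mul_assoc] at this
    simpa using ((mem_dworkFil h.pi_ne_zero).1 this).2 u
  rw [normCoeff_leadMap, h.dig_sum hs hNi _ _ fun j _ => norm_neg_one_pow_mul_le _ (hb j),
    polyWedge, coeff_formDiff_mulLeft]
  refine Finset.sum_congr rfl fun j _ => ?_
  rw [h.dig_fixed_mul hs hNi (h.fixed_neg_one_pow _) (hb j), res_neg_one_pow,
    dig_normCoeff_mul h hs ht hN (hg.fixed j) (hg.res_eq j) (hg.deg j) (hω.1 _) hi hu]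

/-! ### Lifts of polynomial forms -/

/-- The coefficientwise lift of a polynomial. -/
def liftPoly (s : F → L) (ψ : MvPolynomial (Fin n) F) : MvPolynomial (Fin n) L :=
  ∑ u ∈ ψ.support, monomial u (s (coeff u ψ))

theorem coeff_liftPoly (s : F → L) (ψ : MvPolynomial (Fin n) F) (u : Fin n →₀ ℕ)
    [Decidable (coeff u ψ = 0)] :
    coeff u (liftPoly s ψ) = if coeff u ψ = 0 then 0 else s (coeff u ψ) := by
  classical
  simp only [liftPoly, coeff_sum, coeff_monomial, Finset.sum_ite_eq', mem_support_iff]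
  split_ifs <;> simp_all

theorem fixed_coeff_liftPoly (h : IsUnif p q v π ρ) (hs : IsFrobSection p q ρ s)
    (ψ : MvPolynomial (Fin n) F) (u : Fin n →₀ ℕ) : FrobFixed p q (coeff u (liftPoly s ψ)) := by
  classical
  rw [coeff_liftPoly]
  split_ifs
  · exact h.fixed_zero
  · exact hs.fixed _

theorem res_coeff_liftPoly (hs : IsFrobSection p q ρ s)
    (ψ : MvPolynomial (Fin n) F) (u : Fin n →₀ ℕ) :
    res ρ (coeff u (liftPoly s ψ)) = coeff u ψ := by
  classical
  rw [coeff_liftPoly]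
  split_ifs with h0
  · rw [res_zero, h0]
  · exact hs.res_eq _

/-- `π ^ (N c) ψ̂`, where `ψ̂` is the coefficientwise lift of `ψ`. -/
def liftForm (π : L) (s : F → L) (N : ℕ) (c : ℤ) (ψ : Form n (MvPolynomial (Fin n) F)) :
    Form n (MvPowerSeries (Fin n) L) :=
  fun S => π ^ (N * c) • (liftPoly s (ψ S) : MvPowerSeries (Fin n) L)

theorem normCoeff_zpow_smul_coe (hπ : π ≠ 0) (N : ℕ) (c : ℤ) (P : MvPolynomial (Fin n) L)
    (u : Fin n →₀ ℕ) : normCoeff π N u (π ^ (N * c) • (P : MvPowerSeries (Fin n) L)) =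
      π ^ (N * (c - u.degree)) * coeff u P := by
  rw [normCoeff_smul, normCoeff_coe, mul_sub, zpow_sub₀ hπ, ← zpow_natCast]
  push_cast
  ring

/-- On lifted forms the leading part is the wedge product of polynomial lifts, still scaled by one
power of π. The scaling exponent rises from Nc to N (c + d), as the degree bound does. -/
theorem leadMap_liftForm (hπ : π ≠ 0) (N d : ℕ) (g : Fin n → MvPolynomial (Fin n) L) (c : ℤ)
    (ψ : Form n (MvPolynomial (Fin n) F)) (T : Finset (Fin n)) :
    leadMap π N d g (liftForm π s N c ψ) T = π ^ (N * (c + d)) •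
      (polyWedge g (fun S => liftPoly s (ψ S)) T : MvPowerSeries (Fin n) L) := by
  rw [leadMap, polyWedge, formDiff_apply, formDiff_apply, ← coeToMvPowerSeries.ringHom_apply,
    map_sum, Finset.smul_sum]
  refine Finset.sum_congr rfl fun i _ => ?_
  rw [map_zsmul, LinearMap.mulLeft_apply, LinearMap.mulLeft_apply, map_mul, liftForm,
    smul_mul_assoc, mul_smul_comm, smul_smul, smul_comm _ (_ : ℤ), mul_add, zpow_add₀ hπ, mul_comm,
    ← zpow_natCast π]
  push_cast
  rfl

theorem fixed_coeff_polyWedge (h : IsUnif p q v π ρ) (hs : IsFrobSection p q ρ s) {d : ℕ}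
    {g : Fin n → MvPolynomial (Fin n) L} {g₀ : Fin n → MvPolynomial (Fin n) F}
    (hg : IsLift p q ρ d g g₀) (ψ : Form n (MvPolynomial (Fin n) F)) (T : Finset (Fin n))
    (u : Fin n →₀ ℕ) : FrobFixed p q (coeff u (polyWedge g (fun S => liftPoly s (ψ S)) T)) := by
  rw [polyWedge, coeff_formDiff_mulLeft]
  refine h.fixed_sum _ _ fun i _ => h.fixed_mul (h.fixed_neg_one_pow _) ?_
  rw [coeff_mul]
  exact h.fixed_sum _ _ fun x _ => h.fixed_mul (hg.fixed _ _) (fixed_coeff_liftPoly h hs _ _)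

theorem res_sum (ρ : integerRing L →+* F) {ι : Type*} (t : Finset ι) (x : ι → L)
    (hx : ∀ i ∈ t, ‖x i‖ ≤ 1) : res ρ (∑ i ∈ t, x i) = ∑ i ∈ t, res ρ (x i) := by
  classical
  induction t using Finset.induction_on with
  | empty => simp
  | insert i t hi ih =>
    have ht : ∀ j ∈ t, ‖x j‖ ≤ 1 := fun j hj => hx j (by simp [hj])
    rw [Finset.sum_insert hi, Finset.sum_insert hi, res_add ρ (hx i (by simp))
      (IsUltrametricDist.norm_sum_le_of_forall_le_of_nonneg zero_le_one ht), ih ht]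

theorem res_coeff_polyWedge (h : IsUnif p q v π ρ) (hs : IsFrobSection p q ρ s) {d : ℕ}
    {g : Fin n → MvPolynomial (Fin n) L} {g₀ : Fin n → MvPolynomial (Fin n) F}
    (hg : IsLift p q ρ d g g₀) (ψ : Form n (MvPolynomial (Fin n) F)) (T : Finset (Fin n))
    (u : Fin n →₀ ℕ) : res ρ (coeff u (polyWedge g (fun S => liftPoly s (ψ S)) T)) =
      coeff u (polyWedge g₀ ψ T) := by
  have hb : ∀ (i : Fin n) (x : (Fin n →₀ ℕ) × (Fin n →₀ ℕ)),
      FrobFixed p q (coeff x.1 (g i) * coeff x.2 (liftPoly s (ψ (T.erase i)))) := fun i x =>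
    h.fixed_mul (hg.fixed _ _) (fixed_coeff_liftPoly h hs _ _)
  have hb' : ∀ i : Fin n, ‖coeff u (g i * liftPoly s (ψ (T.erase i)))‖ ≤ 1 := fun i => by
    rw [coeff_mul]
    exact (h.fixed_sum _ _ fun x _ => hb i x).1
  rw [polyWedge, polyWedge, coeff_formDiff_mulLeft, coeff_formDiff_mulLeft,
    res_sum ρ _ _ fun i _ => norm_neg_one_pow_mul_le _ (hb' i)]
  refine Finset.sum_congr rfl fun i _ => ?_
  rw [res_mul ρ (h.fixed_neg_one_pow _).1 (hb' i), res_neg_one_pow, coeff_mul, coeff_mul,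
    res_sum ρ _ _ fun x _ => (hb i x).1]
  congr 1
  refine Finset.sum_congr rfl fun x _ => ?_
  rw [res_mul ρ (hg.fixed _ _).1 (fixed_coeff_liftPoly h hs _ _).1, hg.res_eq,
    res_coeff_liftPoly hs]

end Lead

/-! ### Comparison of cycles and boundaries -/

section Comparison

variable {L : Type*} [NormedField L] [IsUltrametricDist L] {F : Type*} [Field F] {n : ℕ}
  {p q v : ℕ} {π : L} {ρ : integerRing L →+* F} {s : F → L}

/-- The coefficientwise reduction of the form `ω` is `ψ`. -/
def ResEq (ρ : integerRing L →+* F) (π : L) (N : ℕ) (ω : Form n (MvPowerSeries (Fin n) L))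
    (ψ : Form n (MvPolynomial (Fin n) F)) : Prop :=
  ∀ S u, res ρ (normCoeff π N u (ω S)) = coeff u (ψ S)

/-- The hypotheses of the comparison: `D` is `θ` times the leading part given by the lifts `g` of
`g₀`, up to terms of filtration at least `N (e - 1) + 1`. -/
structure IsComparison (p q v : ℕ) (π : L) (ρ : integerRing L →+* F) (N d e : ℕ) (θ : L)
    (g : Fin n → MvPolynomial (Fin n) L) (g₀ : Fin n → MvPolynomial (Fin n) F)
    (D : Form n (MvPowerSeries (Fin n) L) →ₗ[integerRing L] Form n (MvPowerSeries (Fin n) L)) :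
    Prop where
  unif : IsUnif p q v π ρ
  lift : IsLift p q ρ d g g₀
  N_pos : 0 < N
  e_pos : 0 < e
  lt_v : N * (e - 1) < v
  norm_unit : ‖θ‖ = 1
  smul : ∀ (c : L) ω, D (c • ω) = c • D ω
  lead : ∀ k, ∀ ω ∈ dworkFormFil n π N 0 k,
    D ω - θ • leadMap π N d g ω ∈ dworkFormFil n π N ((N * (e - 1) : ℕ) + 1) (k + 1)

theorem IsUnif.zpow_le_one (h : IsUnif p q v π ρ) {z : ℤ} (hz : 0 ≤ z) : ‖π‖ ^ z ≤ 1 := by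
  simpa using zpow_le_zpow_right_of_le_one₀ h.norm_pos h.norm_lt.le hz

theorem liftForm_mem (h : IsUnif p q v π ρ) (hs : IsFrobSection p q ρ s) (N : ℕ) {c : ℤ} {k : ℕ}
    {ψ : Form n (MvPolynomial (Fin n) F)} (hψ : ∀ S, S.card ≠ k → ψ S = 0)
    (hc : ∀ S u, coeff u (ψ S) ≠ 0 → (u.degree : ℤ) ≤ c) :
    liftForm π s N c ψ ∈ dworkFormFil n π N 0 k := by
  classical
  refine ⟨fun S => ?_, fun S hS => ?_⟩
  · rw [liftForm, ← coe_smul]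
    refine coe_mem_dworkFil h.pi_ne_zero fun u => ?_
    rw [coe_smul, normCoeff_zpow_smul_coe h.pi_ne_zero, zpow_zero, coeff_liftPoly]
    split_ifs with h0
    · simp
    · rw [norm_mul, norm_zpow]
      refine mul_le_one₀ (h.zpow_le_one ?_) (norm_nonneg _)
        (hs.fixed _).1
      have := hc S u h0
      exact mul_nonneg (by positivity) (by omega)
  · simp [liftForm, hψ S hS, liftPoly]

/-- The reduction of `liftForm` at `c` is the part of degree `c`. -/
theorem resEq_liftForm (h : IsUnif p q v π ρ) (hs : IsFrobSection p q ρ s) {N : ℕ} (hN : 0 < N)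
    {c : ℕ} {ψ : Form n (MvPolynomial (Fin n) F)}
    (hc : ∀ S u, coeff u (ψ S) ≠ 0 → (u.degree : ℤ) ≤ c) :
    ResEq ρ π N (liftForm π s N c ψ) (homPart c ψ) := by
  classical
  intro S u
  rw [liftForm, normCoeff_zpow_smul_coe h.pi_ne_zero, coeff_homPart]
  have hf := (fixed_coeff_liftPoly h hs (ψ S) u).1
  split_ifs with hu
  · rw [hu, sub_self, mul_zero, zpow_zero, one_mul, res_coeff_liftPoly hs]
  · rw [coeff_liftPoly]
    split_ifs with h0
    · rw [mul_zero, res_zero]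
    have hlt : (u.degree : ℤ) < c := lt_of_le_of_ne (hc S u h0) (by exact_mod_cast hu)
    have h1 : ‖π ^ ((N : ℤ) * (c - u.degree)) * s (coeff u (ψ S))‖ < 1 := by
      rw [norm_mul, norm_zpow]
      refine mul_lt_one_of_nonneg_of_lt_one_left (by positivity)
        (zpow_lt_one₀ h.norm_pos h.norm_lt ?_) (hs.fixed _).1
      exact mul_pos (by exact_mod_cast hN) (by omega)
    exact (h.res_eq_zero_iff h1.le).2 h1

namespace IsComparison

variable {N d e : ℕ} {θ : L} {g : Fin n → MvPolynomial (Fin n) L}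
  {g₀ : Fin n → MvPolynomial (Fin n) F}
  {D : Form n (MvPowerSeries (Fin n) L) →ₗ[integerRing L] Form n (MvPowerSeries (Fin n) L)}

theorem unit_ne_zero (H : IsComparison p q v π ρ N d e θ g g₀ D) : θ ≠ 0 := by
  rw [← norm_ne_zero_iff, H.norm_unit]
  exact one_ne_zero

/-- Up to filtration N (e - 1) + 1 the error of the leading part is invisible and θ is a unit, so
divisibility of D ω and of the leading part are the same condition. The next lemma is the converse.
-/
theorem leadMap_mem_of_mem (H : IsComparison p q v π ρ N d e θ g g₀ D) {k : ℕ}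
    {ω : Form n (MvPowerSeries (Fin n) L)} (hω : ω ∈ dworkFormFil n π N 0 k) {r : ℤ}
    (hr : r ≤ (N * (e - 1) : ℕ) + 1) (hD : D ω ∈ dworkFormFil n π N r (k + 1)) :
    leadMap π N d g ω ∈ dworkFormFil n π N r (k + 1) := by
  have h1 := Submodule.sub_mem _ hD (dworkFormFil_anti H.unif.pi_ne_zero H.unif.norm_lt.le hr
    (H.lead k ω hω))
  rw [sub_sub_cancel] at h1
  have := smul_mem_dworkFormFil H.unif.pi_ne_zero h1 (c := θ⁻¹)
    (by rw [norm_inv, H.norm_unit, inv_one])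
  rwa [smul_smul, inv_mul_cancel₀ H.unit_ne_zero, one_smul] at this

theorem mem_of_leadMap_mem (H : IsComparison p q v π ρ N d e θ g g₀ D) {k : ℕ}
    {ω : Form n (MvPowerSeries (Fin n) L)} (hω : ω ∈ dworkFormFil n π N 0 k) {r : ℤ}
    (hr : r ≤ (N * (e - 1) : ℕ) + 1)
    (hD : leadMap π N d g ω ∈ dworkFormFil n π N r (k + 1)) :
    D ω ∈ dworkFormFil n π N r (k + 1) := by
  have h1 := Submodule.add_mem _ (dworkFormFil_anti H.unif.pi_ne_zero H.unif.norm_lt.le hr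
    (H.lead k ω hω)) (smul_mem_dworkFormFil H.unif.pi_ne_zero hD H.norm_unit.le)
  rwa [sub_add_cancel] at h1

/-- Where df ∧ ψ has a nonzero coefficient, the degree has dropped by j and the scaling supplies π ^
(N j). Elsewhere the coefficient of the wedge of lifts has residue zero and is fixed modulo p, so it
is divisible by p, of order v. Both orders are at least B. -/
theorem norm_normCoeff_leadMap_liftForm_le (H : IsComparison p q v π ρ N d e θ g g₀ D)
    (hs : IsFrobSection p q ρ s) {c : ℤ} {ψ : Form n (MvPolynomial (Fin n) F)}
    (hc : ∀ S u, coeff u (ψ S) ≠ 0 → (u.degree : ℤ) ≤ c) {j : ℕ} {T : Finset (Fin n)}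
    (hj : ∀ u, coeff u (polyWedge g₀ ψ T) ≠ 0 → (u.degree : ℤ) ≤ c + d - j) {B : ℕ}
    (hB : B ≤ v) (hBj : B ≤ N * j) (u : Fin n →₀ ℕ) :
    ‖normCoeff π N u (leadMap π N d g (liftForm π s N c ψ) T)‖ ≤ ‖π‖ ^ B := by
  have h := H.unif
  rw [leadMap_liftForm h.pi_ne_zero, normCoeff_zpow_smul_coe h.pi_ne_zero]
  have hf := fixed_coeff_polyWedge h hs H.lift ψ T u
  by_cases h0 : coeff u (polyWedge g (fun S => liftPoly s (ψ S)) T) = 0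
  · rw [h0, mul_zero, norm_zero]
    positivity
  have hu : (u.degree : ℤ) ≤ c + d := by
    refine degree_le_of_coeff_formDiff_ne_zero H.lift.deg (fun S w hw => hc S w ?_) h0
    classical
    rw [coeff_liftPoly] at hw
    exact fun h => hw (if_pos h)
  rw [norm_mul, norm_zpow]
  by_cases hz : coeff u (polyWedge g₀ ψ T) = 0
  · have hp := h.norm_le_norm_p hf (by rw [res_coeff_polyWedge h hs H.lift, hz])
    have h1 : ‖π‖ ^ ((N : ℤ) * (c + d - u.degree)) ≤ 1 :=
      h.zpow_le_one (mul_nonneg (by positivity) (by omega))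
    calc _ ≤ 1 * ‖π‖ ^ v := mul_le_mul h1 (hp.trans_eq h.norm_p) (norm_nonneg _) zero_le_one
      _ ≤ ‖π‖ ^ B := by rw [one_mul]; exact pow_le_pow_of_le_one h.norm_pos.le h.norm_lt.le hB
  · refine (mul_le_of_le_one_right (by positivity) hf.1).trans ?_
    rw [← zpow_natCast]
    refine zpow_le_zpow_right_of_le_one₀ h.norm_pos h.norm_lt.le ?_
    have h1 := hj u hz
    calc (B : ℤ) ≤ N * j := by exact_mod_cast hBj
      _ ≤ N * (c + d - u.degree) := by gcongr; omega

theorem leadMap_liftForm_mem (H : IsComparison p q v π ρ N d e θ g g₀ D)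
    (hs : IsFrobSection p q ρ s) {c : ℤ} {k : ℕ} {ψ : Form n (MvPolynomial (Fin n) F)}
    (hψ : ∀ S, S.card ≠ k → ψ S = 0)
    (hc : ∀ S u, coeff u (ψ S) ≠ 0 → (u.degree : ℤ) ≤ c) {j : ℕ}
    (hj : ∀ T, T.card = k + 1 → ∀ u, coeff u (polyWedge g₀ ψ T) ≠ 0 →
      (u.degree : ℤ) ≤ c + d - j) {B : ℕ} (hB : B ≤ v) (hBj : B ≤ N * j) :
    leadMap π N d g (liftForm π s N c ψ) ∈ dworkFormFil n π N B (k + 1) := by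
  have h := H.unif
  refine ⟨fun T => ?_, (H.lift.leadMap_mem h.pi_ne_zero h.norm_lt.le
    (liftForm_mem h hs N hψ hc)).2⟩
  have hj' : ∀ u, coeff u (polyWedge g₀ ψ T) ≠ 0 → (u.degree : ℤ) ≤ c + d - j := by
    intro u hu
    by_cases hT : T.card = k + 1
    · exact hj T hT u hu
    · rw [polyWedge, formDiff_eq_zero _ hψ hT, coeff_zero] at hu
      exact absurd rfl hu
  have hb := H.norm_normCoeff_leadMap_liftForm_le hs hc hj' hB hBj
  rw [leadMap_liftForm h.pi_ne_zero, ← coe_smul] at hb ⊢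
  exact coe_mem_dworkFil h.pi_ne_zero fun u => (hb u).trans_eq (zpow_natCast _ _).symm

/-- The reductions of cycles have homogeneous parts that are leading parts of cycles. -/
theorem homPart_mem_pageNum (H : IsComparison p q v π ρ N d e θ g g₀ D) {m : ℕ}
    {ω : Form n (MvPowerSeries (Fin n) L)} (hω : ω ∈ dworkFormFil n π N 0 m)
    (hD : D ω ∈ dworkFormFil n π N ((N * (e - 1) : ℕ) + 1) (m + 1))
    {ψ : Form n (MvPolynomial (Fin n) F)} (hψ : ResEq ρ π N ω ψ) (c : ℕ) :
    homPart c ψ ∈ pageNum (polyWedge g₀) (fun s k => polyFil n (d + 1) (-s) k) e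
      (-((c + (n - m) * d : ℕ) : ℤ)) m := by
  classical
  have h := H.unif
  obtain ⟨s, hs⟩ := h.exists_section
  have hLD := H.leadMap_mem_of_mem hω le_rfl hD
  -- The diagonal of digits ending in degree c. It agrees with the reduction of ω in degree c, and
  -- its lower terms are the corrections that make df ∧ β drop by e degrees.
  set β : Form n (MvPolynomial (Fin n) F) := fun S => diagPart ρ π s N e c (ω S) with hβ
  have hβ0 : ∀ S, S.card ≠ m → β S = 0 := by
    intro S hS
    ext u
    rw [hβ, coeff_diagPart, hω.2 S hS, normCoeff_zero, coeff_zero]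
    split_ifs with hu
    · refine h.dig_zero hs (lt_of_le_of_lt (Nat.mul_le_mul_left _ ?_) H.lt_v)
      omega
    · rfl
  have hβc : ∀ S u, coeff u (β S) ≠ 0 → (u.degree : ℤ) ≤ c := by
    intro S u hu
    rw [hβ, coeff_diagPart] at hu
    by_contra hlt
    exact hu (if_neg fun h => hlt h.1)
  rw [pageNum, Submodule.mem_sup]
  refine ⟨β, ⟨?_, ?_⟩, homPart c ψ - β, ?_, by abel⟩
  · change β ∈ polyFil n (d + 1) _ m
    rw [mem_polyFil]
    refine ⟨hβ0, fun S u hu => ?_⟩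
    have := hβc S u hu
    simp only [Nat.add_sub_cancel]
    push_cast at *
    omega
  · change polyWedge g₀ β ∈ polyFil n (d + 1) _ (m + 1)
    rw [mem_polyFil]
    refine ⟨fun T hT => formDiff_eq_zero _ hβ0 hT, fun T u hu => ?_⟩
    have hT : T.card = m + 1 := by
      by_contra hT
      rw [polyWedge, formDiff_eq_zero _ hβ0 hT] at hu
      exact hu (coeff_zero u)
    have hmn : m + 1 ≤ n := by
      rw [← hT]
      simpa using Finset.card_le_univ T
    have hle := degree_le_of_coeff_formDiff_ne_zero H.lift.deg_res hβc hu
    -- A monomial of degree c + d - i with i < e has as coefficient the digit of index Ni ≤ N (e -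
    -- 1) of the leading part of D ω, which vanishes because that form is divisible by π ^ (N (e -
    -- 1) + 1).
    have hlt : (u.degree : ℤ) + e ≤ c + d := by
      by_contra hlt
      push Not at hlt
      obtain ⟨i, hi⟩ : ∃ i : ℕ, (u.degree : ℤ) + i = c + d := ⟨(c + d - u.degree : ℤ).toNat, by omega⟩
      have hie : i < e := by omega
      have h1 := dig_normCoeff_leadMap h hs H.lt_v H.N_pos H.lift hω hie hi T
      rw [h.dig_of_norm_le hs (lt_of_le_of_lt (Nat.mul_le_mul_left _ (by omega)) H.lt_v)] at h1
      · exact hu h1.symm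
      · refine (norm_normCoeff_le h.pi_ne_zero hLD T u).trans ?_
        rw [← zpow_natCast]
        refine zpow_le_zpow_right_of_le_one₀ h.norm_pos h.norm_lt.le ?_
        have : N * i ≤ N * (e - 1) := Nat.mul_le_mul_left _ (by omega)
        push_cast
        push_cast [← @Nat.cast_le ℤ] at this
        linarith
    obtain ⟨k, rfl⟩ := Nat.exists_eq_add_of_le hmn
    have e1 : m + 1 + k - m = k + 1 := by omega
    have e2 : m + 1 + k - (m + 1) = k := by omega
    simp only [Nat.add_sub_cancel, e1, e2, Nat.succ_mul]
    push_cast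
    omega
  · rw [mem_polyFil]
    refine ⟨fun S hS => ?_, fun S u hu => ?_⟩
    · rw [Pi.sub_apply, hβ0 S hS, sub_zero]
      ext u
      rw [coeff_homPart, ← hψ, hω.2 S hS, normCoeff_zero, res_zero, ite_self, coeff_zero]
    · rw [Pi.sub_apply, coeff_sub, coeff_homPart, ← hψ, hβ, coeff_diagPart] at hu
      -- In degree c the diagonal takes the digit of index 0, which is the residue, so the two terms
      -- cancel there.
      have hlt : u.degree < c := by
        by_contra hge
        rcases eq_or_ne u.degree c with he | hne
        · refine hu ?_
          rw [if_pos he, if_pos ⟨by omega, by have := H.e_pos; omega⟩, he, sub_self]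
          simp [dig]
        · rw [if_neg hne, if_neg (by omega), sub_zero] at hu
          exact hu rfl
      simp only [Nat.add_sub_cancel]
      push_cast
      omega

/-- The homogeneous parts of the reductions of boundaries are leading parts of boundaries. -/
theorem homPart_mem_pageDen (H : IsComparison p q v π ρ N d e θ g g₀ D) {j : ℕ} (hj : j + 1 ≤ n)
    {η : Form n (MvPowerSeries (Fin n) L)}
    (hη : η ∈ dworkFormFil n π N (-((N * (e - 1) : ℕ) : ℤ)) j)
    (hD : D η ∈ dworkFormFil n π N 0 (j + 1))
    {ψ : Form n (MvPolynomial (Fin n) F)} (hψ : ResEq ρ π N (D η) ψ) (c : ℕ) :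
    homPart c ψ ∈ pageDen (polyWedge g₀) (fun s k => polyFil n (d + 1) (-s) k) e
      (-((c + (n - (j + 1)) * d : ℕ) : ℤ)) (j + 1) := by
  classical
  have h := H.unif
  obtain ⟨s, hs⟩ := h.exists_section
  set τ := N * (e - 1) with hτ
  have hη' : π ^ τ • η ∈ dworkFormFil n π N 0 j := by
    have := (zpow_smul_mem_dworkFormFil h.pi_ne_zero (s := τ)).2 hη
    rwa [add_neg_cancel, zpow_natCast] at this
  have hD' : D (π ^ τ • η) ∈ dworkFormFil n π N τ (j + 1) := by
    rw [H.smul]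
    have := (zpow_smul_mem_dworkFormFil h.pi_ne_zero (s := τ)).2 hD
    rwa [add_zero, zpow_natCast] at this
  have hLD := H.leadMap_mem_of_mem hη' (by omega) hD'
  -- Chosen so that c' + d - c = e - 1: the digit of index τ = N (e - 1) of the leading part is read
  -- off in degree c. It is also the degree bound for cycles entering E_e from e - 1 steps away; it
  -- may be negative.
  set c' : ℤ := c + e - 1 - d with hc'
  set β : Form n (MvPolynomial (Fin n) F) :=
    fun S => diagPart ρ π s N e c' ((π ^ τ • η) S) with hβ
  have hβ0 : ∀ S, S.card ≠ j → β S = 0 := by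
    intro S hS
    ext u
    rw [hβ, coeff_diagPart, hη'.2 S hS, normCoeff_zero, coeff_zero]
    split_ifs with hu
    · refine h.dig_zero hs (lt_of_le_of_lt (Nat.mul_le_mul_left _ ?_) H.lt_v)
      omega
    · rfl
  have hβc : ∀ S u, coeff u (β S) ≠ 0 → (u.degree : ℤ) ≤ c' := by
    intro S u hu
    rw [hβ, coeff_diagPart] at hu
    by_contra hlt
    exact hu (if_neg fun h => hlt h.1)
  -- Above degree c the coefficients of df ∧ β are digits of index below τ, and the leading part is
  -- divisible by π ^ τ.
  have hβd : ∀ T u, coeff u (polyWedge g₀ β T) ≠ 0 → u.degree ≤ c := by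
    intro T u hu
    have hle := degree_le_of_coeff_formDiff_ne_zero H.lift.deg_res hβc hu
    by_contra hlt
    push Not at hlt
    obtain ⟨i, hi⟩ : ∃ i : ℕ, (u.degree : ℤ) + i = c' + d := ⟨(c' + d - u.degree : ℤ).toNat, by omega⟩
    have hie : i < e - 1 := by omega
    have h1 := dig_normCoeff_leadMap h hs H.lt_v H.N_pos H.lift hη' (by omega) hi T
    have hNi : N * i < τ := Nat.mul_lt_mul_of_pos_left hie H.N_pos
    rw [h.dig_of_norm_le hs (hNi.trans H.lt_v)] at h1
    · exact hu h1.symm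
    · refine (norm_normCoeff_le h.pi_ne_zero hLD T u).trans ?_
      rw [zpow_natCast]
      exact pow_le_pow_of_le_one h.norm_pos.le h.norm_lt.le hNi
  -- In degree c the coefficient is the digit of index τ of the leading part of D (π ^ τ η), which
  -- is θ⁻¹ π ^ τ D η up to a multiple of π ^ (τ + 1). That digit is the residue of θ⁻¹ D η.
  have htop : ∀ T (u : Fin n →₀ ℕ), u.degree = c →
      coeff u (polyWedge g₀ β T) = res ρ θ⁻¹ * coeff u (ψ T) := by
    intro T u hu
    have hτv : 0 + τ < v := by rw [zero_add]; exact H.lt_v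
    have h1 := dig_normCoeff_leadMap h hs H.lt_v H.N_pos H.lift hη' (i := e - 1) (c := c')
      (by have := H.e_pos; omega) (u := u) (by have := H.e_pos; omega) T
    rw [← h1, ← hψ]
    have hA1 : ‖normCoeff π N u (D η T)‖ ≤ 1 := by
      simpa using norm_normCoeff_le h.pi_ne_zero hD T u
    have hθ : ‖θ⁻¹‖ ≤ 1 := by rw [norm_inv, H.norm_unit, inv_one]
    rw [← res_mul ρ hθ hA1]
    have hprod : ‖θ⁻¹ * normCoeff π N u (D η T)‖ ≤ 1 := by
      rw [norm_mul]; exact mul_le_one₀ hθ (norm_nonneg _) hA1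
    have h2 := h.dig_pow_mul hs hτv hprod
    rw [zero_add] at h2
    rw [show res ρ (θ⁻¹ * normCoeff π N u (D η T)) =
      dig ρ π s 0 (θ⁻¹ * normCoeff π N u (D η T)) from rfl, ← h2]
    refine h.dig_congr hs _ ?_ ?_ ?_
    · refine (norm_normCoeff_le h.pi_ne_zero hLD T u).trans ?_
      rw [zpow_natCast]
      exact pow_le_one₀ h.norm_pos.le h.norm_lt.le
    · rw [norm_mul, norm_pow]
      exact mul_le_one₀ (pow_le_one₀ h.norm_pos.le h.norm_lt.le) (norm_nonneg _) hprod
    · have hl := norm_normCoeff_le h.pi_ne_zero (H.lead j _ hη') T u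
      rw [H.smul] at hl
      have e1 : normCoeff π N u (leadMap π N d g (π ^ τ • η) T) -
          π ^ τ * (θ⁻¹ * normCoeff π N u (D η T)) =
          -(θ⁻¹ * normCoeff π N u ((π ^ τ • D η - θ • leadMap π N d g (π ^ τ • η)) T)) := by
        rw [Pi.sub_apply, Pi.smul_apply, Pi.smul_apply, normCoeff_sub, normCoeff_smul,
          normCoeff_smul, mul_sub, inv_mul_cancel_left₀ H.unit_ne_zero]
        ring
      rw [e1, norm_neg, norm_mul, norm_inv, H.norm_unit, inv_one, one_mul]
      refine hl.trans_eq ?_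
      rw [← zpow_natCast]
      push_cast
      rfl
  have hθθ : res ρ θ * res ρ θ⁻¹ = 1 := by
    rw [← res_mul ρ H.norm_unit.le (by rw [norm_inv, H.norm_unit, inv_one]),
      mul_inv_cancel₀ H.unit_ne_zero, res_one]
  obtain ⟨k, rfl⟩ := Nat.exists_eq_add_of_le hj
  have e1 : j + 1 + k - j = k + 1 := by omega
  have e2 : j + 1 + k - (j + 1) = k := by omega
  rw [pageDen, Submodule.mem_sup]
  -- The residue of θ undoes the factor θ⁻¹ found in degree c; what remains has lower degree.
  refine ⟨res ρ θ • polyWedge g₀ β, ?_, homPart c ψ - res ρ θ • polyWedge g₀ β, ?_, by abel⟩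
  · refine Submodule.smul_mem _ _ (mem_iSup_map_cycles.2 (Or.inr ⟨j, rfl, β, ⟨?_, ?_⟩, rfl⟩))
    · change β ∈ polyFil _ (d + 1) _ j
      rw [mem_polyFil]
      refine ⟨hβ0, fun S u hu => ?_⟩
      have := hβc S u hu
      simp only [Nat.add_sub_cancel, e1, e2, Nat.succ_mul]
      push_cast
      omega
    · change polyWedge g₀ β ∈ polyFil _ (d + 1) _ (j + 1)
      rw [mem_polyFil]
      refine ⟨fun T hT => formDiff_eq_zero _ hβ0 hT, fun T u hu => ?_⟩
      have := hβd T u hu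
      simp only [Nat.add_sub_cancel, e2]
      push_cast
      omega
  · rw [mem_polyFil]
    refine ⟨fun S hS => ?_, fun S u hu => ?_⟩
    · rw [Pi.sub_apply, Pi.smul_apply, polyWedge, formDiff_eq_zero _ hβ0 hS, smul_zero, sub_zero]
      ext u
      rw [coeff_homPart, ← hψ, hD.2 S hS, normCoeff_zero, res_zero, ite_self, coeff_zero]
    · rw [Pi.sub_apply, Pi.smul_apply, coeff_sub, coeff_smul, smul_eq_mul, coeff_homPart] at hu
      have hlt : u.degree < c := by
        by_contra hge
        rcases eq_or_ne u.degree c with he | hne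
        · refine hu ?_
          rw [if_pos he, htop S u he, ← mul_assoc, hθθ, one_mul, sub_self]
        · rw [if_neg hne, zero_sub] at hu
          exact hne (le_antisymm (hβd S u (right_ne_zero_of_mul (neg_ne_zero.1 hu))) (by omega))
      simp only [Nat.add_sub_cancel, e2]
      push_cast
      omega

/-- Leading parts of cycles lift to cycles. -/
theorem exists_cycle_of_mem_pageNum (H : IsComparison p q v π ρ N d e θ g g₀ D) {m c : ℕ}
    {ψ : Form n (MvPolynomial (Fin n) F)}
    (hψ : ψ ∈ pageNum (polyWedge g₀) (fun s k => polyFil n (d + 1) (-s) k) e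
      (-((c + (n - m) * d : ℕ) : ℤ)) m) :
    ∃ ω ∈ dworkFormFil n π N 0 m, D ω ∈ dworkFormFil n π N ((N * (e - 1) : ℕ) + 1) (m + 1) ∧
      ResEq ρ π N ω (homPart c ψ) := by
  have h := H.unif
  obtain ⟨s, hs⟩ := h.exists_section
  rw [pageNum, Submodule.mem_sup] at hψ
  obtain ⟨ψ₁, ⟨h1, h2⟩, ψ₂, h3, rfl⟩ := hψ
  replace h1 : ψ₁ ∈ polyFil n (d + 1) _ m := h1
  replace h2 : polyWedge g₀ ψ₁ ∈ polyFil n (d + 1) _ (m + 1) := h2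
  simp only [mem_polyFil, Nat.add_sub_cancel] at h1 h2 h3
  have hc : ∀ S u, coeff u (ψ₁ S) ≠ 0 → (u.degree : ℤ) ≤ c := by
    intro S u hu
    have := h1.2 S u hu
    push_cast at this
    omega
  have hhom : homPart c (ψ₁ + ψ₂) = homPart c ψ₁ := by
    rw [map_add, add_eq_left]
    funext S
    ext u
    rw [coeff_homPart]
    split_ifs with hu
    · by_contra hne
      have := h3.2 S u hne
      push_cast at this
      omega
    · simp
  have hmem := liftForm_mem h hs N h1.1 hc
  refine ⟨liftForm π s N c ψ₁, hmem, H.mem_of_leadMap_mem hmem le_rfl ?_, ?_⟩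
  -- The drop by e degrees gives order N e ≥ N (e - 1) + 1, and the terms divisible by p have order
  -- v ≥ N (e - 1) + 1.
  · have := H.leadMap_liftForm_mem hs h1.1 hc (j := e) (fun T hT u hu => ?_)
      (B := N * (e - 1) + 1) H.lt_v ?_
    · exact_mod_cast this
    · have hmn : m + 1 ≤ n := by
        rw [← hT]
        simpa using Finset.card_le_univ T
      have h4 := h2.2 T u hu
      obtain ⟨k, rfl⟩ := Nat.exists_eq_add_of_le hmn
      have e1 : m + 1 + k - m = k + 1 := by omega
      have e2 : m + 1 + k - (m + 1) = k := by omega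
      simp only [e1, e2, Nat.succ_mul] at h4
      push_cast at h4
      omega
    · have := H.e_pos
      have := H.N_pos
      obtain ⟨i, rfl⟩ : ∃ i, e = i + 1 := ⟨e - 1, by omega⟩
      rw [Nat.add_sub_cancel, Nat.mul_succ]
      omega
  · rw [hhom]
    exact resEq_liftForm h hs H.N_pos hc

/-- Leading parts of boundaries lift to boundaries. -/
theorem exists_boundary_of_mem (H : IsComparison p q v π ρ N d e θ g g₀ D) {j c : ℕ}
    (hj : j + 1 ≤ n) {ψ : Form n (MvPolynomial (Fin n) F)}
    (hψ : ψ ∈ cycles (polyWedge g₀) (fun s k => polyFil n (d + 1) (-s) k) (e - 1)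
      (-((c + (n - (j + 1)) * d : ℕ) : ℤ) - e + 1) j) :
    ∃ η ∈ dworkFormFil n π N (-((N * (e - 1) : ℕ) : ℤ)) j,
      D η ∈ dworkFormFil n π N 0 (j + 1) ∧
      ResEq ρ π N (D η) (homPart c (polyWedge g₀ ψ)) := by
  have h := H.unif
  obtain ⟨s, hs⟩ := h.exists_section
  obtain ⟨h1, h2⟩ := hψ
  replace h1 : ψ ∈ polyFil n (d + 1) _ j := h1
  replace h2 : polyWedge g₀ ψ ∈ polyFil n (d + 1) _ (j + 1) := h2
  obtain ⟨k, rfl⟩ := Nat.exists_eq_add_of_le hj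
  have e1 : j + 1 + k - j = k + 1 := by omega
  have e2 : j + 1 + k - (j + 1) = k := by omega
  simp only [mem_polyFil, Nat.add_sub_cancel, e1, e2, Nat.succ_mul] at h1 h2
  set c' : ℤ := c + e - 1 - d with hc'
  set τ := N * (e - 1) with hτ
  have he := H.e_pos
  have hc : ∀ S u, coeff u (ψ S) ≠ 0 → (u.degree : ℤ) ≤ c' := by
    intro S u hu
    have := h1.2 S u hu
    push_cast at this
    omega
  have hw : ∀ T u, coeff u (polyWedge g₀ ψ T) ≠ 0 → (u.degree : ℤ) ≤ c' + d - (e - 1 : ℕ) := by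
    intro T u hu
    have := h2.2 T u hu
    push_cast at this
    omega
  have hmem := liftForm_mem h hs N h1.1 hc
  have hLD : leadMap π N d g (liftForm π s N c' ψ) ∈ dworkFormFil (j + 1 + k) π N τ (j + 1) :=
    H.leadMap_liftForm_mem hs h1.1 hc (fun T _ => hw T) H.lt_v.le le_rfl
  have hD' := H.mem_of_leadMap_mem hmem (by omega) hLD
  have hDeq : D ((θ⁻¹ * π ^ (-(τ : ℤ))) • liftForm π s N c' ψ) =
      θ⁻¹ • π ^ (-(τ : ℤ)) • D (liftForm π s N c' ψ) := by rw [H.smul, smul_smul]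
  have hθ : ‖θ⁻¹‖ = 1 := by rw [norm_inv, H.norm_unit, inv_one]
  -- The scaled lift has leading image divisible by π ^ τ. Dividing by π ^ τ brings its differential
  -- to filtration 0, and θ⁻¹ normalizes the reduction to that of df ∧ ψ itself.
  refine ⟨(θ⁻¹ * π ^ (-(τ : ℤ))) • liftForm π s N c' ψ, ?_, ?_, ?_⟩
  · rw [← smul_smul]
    refine smul_mem_dworkFormFil h.pi_ne_zero ?_ hθ.le
    have := (zpow_smul_mem_dworkFormFil h.pi_ne_zero (s := -(τ : ℤ))).2 hmem
    rwa [add_zero] at this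
  · rw [hDeq]
    refine smul_mem_dworkFormFil h.pi_ne_zero ?_ hθ.le
    have := (zpow_smul_mem_dworkFormFil h.pi_ne_zero (s := -(τ : ℤ))).2 hD'
    rwa [neg_add_cancel] at this
  · intro T u
    rw [hDeq]
    have hl := norm_normCoeff_le h.pi_ne_zero (H.lead j _ hmem) T u
    rw [Pi.sub_apply, Pi.smul_apply, normCoeff_sub, normCoeff_smul] at hl
    rw [Pi.smul_apply, Pi.smul_apply, normCoeff_smul, normCoeff_smul]
    have hLn := H.norm_normCoeff_leadMap_liftForm_le hs hc (hw T) H.lt_v.le le_rfl u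
    set A := normCoeff π N u (leadMap π N d g (liftForm π s N c' ψ) T) with hA
    set A' := normCoeff π N u (D (liftForm π s N c' ψ) T) with hA'
    have hπτ : ‖π ^ (-(τ : ℤ))‖ = (‖π‖ ^ τ)⁻¹ := by rw [norm_zpow, zpow_neg, zpow_natCast]
    have hA1 : ‖π ^ (-(τ : ℤ)) * A‖ ≤ 1 := by
      rw [norm_mul, hπτ, inv_mul_le_one₀ (pow_pos h.norm_pos _)]
      exact hLn
    have hdiff : ‖θ⁻¹ * (π ^ (-(τ : ℤ)) * (A' - θ * A))‖ < 1 := by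
      rw [norm_mul, hθ, one_mul, norm_mul, hπτ]
      calc _ ≤ (‖π‖ ^ τ)⁻¹ * ‖π‖ ^ ((τ : ℤ) + 1) := by gcongr
        _ = ‖π‖ := by
          rw [zpow_add₀ h.norm_pos.ne', zpow_natCast, zpow_one,
            inv_mul_cancel_left₀ (pow_pos h.norm_pos _).ne']
        _ < 1 := h.norm_lt
    have e3 : θ⁻¹ * (π ^ (-(τ : ℤ)) * A') =
        θ⁻¹ * (π ^ (-(τ : ℤ)) * (A' - θ * A)) + π ^ (-(τ : ℤ)) * A := by
      have := H.unit_ne_zero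
      field_simp
      ring
    rw [e3, res_add ρ hdiff.le hA1, (h.res_eq_zero_iff hdiff.le).2 hdiff, zero_add, coeff_homPart]
    have hf := fixed_coeff_polyWedge h hs H.lift ψ T u
    have hAe : π ^ (-(τ : ℤ)) * A = π ^ ((N : ℤ) * (c - u.degree)) *
        coeff u (polyWedge g (fun S => liftPoly s (ψ S)) T) := by
      rw [hA, leadMap_liftForm h.pi_ne_zero, normCoeff_zpow_smul_coe h.pi_ne_zero, ← mul_assoc,
        ← zpow_add₀ h.pi_ne_zero]
      congr 2
      rw [hτ, hc']
      push_cast [Nat.cast_sub he]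
      ring
    split_ifs with hu
    · rw [hAe, hu, sub_self, mul_zero, zpow_zero, one_mul, res_coeff_polyWedge h hs H.lift]
    · rw [h.res_eq_zero_iff hA1]
      -- Below degree c a positive power of π ^ N remains. Above degree c the polynomial df ∧ ψ has
      -- no term, so the coefficient of the wedge of lifts is divisible by p; its order v exceeds
      -- the loss, which is at most τ.
      rcases Nat.lt_or_gt_of_ne hu with hlt | hgt
      · rw [hAe, norm_mul, norm_zpow]
        refine mul_lt_one_of_nonneg_of_lt_one_left (by positivity)
          (zpow_lt_one₀ h.norm_pos h.norm_lt ?_) hf.1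
        exact mul_pos (by exact_mod_cast H.N_pos) (by omega)
      · by_cases h0 : coeff u (polyWedge g (fun S => liftPoly s (ψ S)) T) = 0
        · rw [hAe, h0, mul_zero, norm_zero]
          exact one_pos
        have hz : coeff u (polyWedge g₀ ψ T) = 0 := by
          by_contra hne
          have := hw T u hne
          omega
        have hud : (u.degree : ℤ) ≤ c' + d := by
          refine degree_le_of_coeff_formDiff_ne_zero H.lift.deg (fun S w hw => hc S w ?_) h0
          classical
          rw [coeff_liftPoly] at hw
          exact fun h => hw (if_pos h)
        have hp := h.norm_le_norm_p hf (by rw [res_coeff_polyWedge h hs H.lift, hz])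
        rw [hAe, norm_mul, norm_zpow]
        calc _ ≤ ‖π‖ ^ (-(τ : ℤ)) * ‖π‖ ^ v := by
              refine mul_le_mul (zpow_le_zpow_right_of_le_one₀ h.norm_pos h.norm_lt.le ?_)
                (hp.trans_eq h.norm_p) (norm_nonneg _) (by positivity)
              have h5 : (N : ℤ) * (u.degree - c) ≤ N * (e - 1 : ℕ) := by
                gcongr
                omega
              rw [hτ]
              push_cast at h5 ⊢
              linarith
          _ = ‖π‖ ^ ((v : ℤ) - τ) := by
              rw [← zpow_natCast, ← zpow_add₀ h.norm_pos.ne', neg_add_eq_sub]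
          _ < 1 := zpow_lt_one₀ h.norm_pos h.norm_lt (by have := H.lt_v; omega)

end IsComparison

end Comparison

/-! ### Bases of classes -/

section Basis

theorem mk_submoduleOf_eq_zero_iff {R X : Type*} [CommRing R] [AddCommGroup X] [Module R X]
    {P Q : Submodule R X} (x : P) :
    (Submodule.Quotient.mk x : SubQuot P Q) = 0 ↔ (x : X) ∈ Q := by
  rw [Submodule.Quotient.mk_eq_zero]
  rfl

theorem ClassesFormBasis.mem {R X ι : Type*} [CommRing R] [AddCommGroup X] [Module R X]
    {d : X →ₗ[R] X} {Fil : ℤ → ℕ → Submodule R X} {t r : ℤ} {k : ℕ} {v : ι → X}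
    (h : ClassesFormBasis d Fil t r k v) (i : ι) : v i ∈ pageNum d Fil t r k :=
  (h.choose_spec i).choose

theorem ClassesFormBasis.eq_zero {R X ι : Type*} [CommRing R] [AddCommGroup X] [Module R X]
    {d : X →ₗ[R] X} {Fil : ℤ → ℕ → Submodule R X} {t r : ℤ} {k : ℕ} {v : ι → X}
    (h : ClassesFormBasis d Fil t r k v) {g : ι →₀ R}
    (hg : Finsupp.linearCombination R v g ∈ pageDen d Fil t r k) : g = 0 := by
  obtain ⟨B, hB⟩ := h
  choose hv hB using hB
  have h1 : (Submodule.mkQ _) (Finsupp.linearCombination R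
      (fun i => (⟨v i, hv i⟩ : pageNum d Fil t r k)) g) = Finsupp.linearCombination R B g := by
    rw [Finsupp.apply_linearCombination]
    congr 2
    funext i
    exact (hB i).symm
  have h2 : ((Finsupp.linearCombination R
      (fun i => (⟨v i, hv i⟩ : pageNum d Fil t r k)) g : pageNum d Fil t r k) : X) =
      Finsupp.linearCombination R v g :=
    Finsupp.apply_linearCombination R (pageNum d Fil t r k).subtype _ g
  rw [← h2] at hg
  rw [← B.repr_linearCombination g, ← h1, Submodule.mkQ_apply,
    (mk_submoduleOf_eq_zero_iff _).2 hg, map_zero]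

theorem ClassesFormBasis.exists_sub_mem {R X ι : Type*} [CommRing R] [AddCommGroup X] [Module R X]
    {d : X →ₗ[R] X} {Fil : ℤ → ℕ → Submodule R X} {t r : ℤ} {k : ℕ} {v : ι → X}
    (h : ClassesFormBasis d Fil t r k v) {x : X} (hx : x ∈ pageNum d Fil t r k) :
    ∃ g : ι →₀ R, x - Finsupp.linearCombination R v g ∈ pageDen d Fil t r k := by
  obtain ⟨B, hB⟩ := h
  choose hv hB using hB
  set g := B.repr (Submodule.Quotient.mk ⟨x, hx⟩) with hg
  refine ⟨g, ?_⟩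
  have h1 : (Submodule.mkQ _) (Finsupp.linearCombination R
      (fun i => (⟨v i, hv i⟩ : pageNum d Fil t r k)) g) = Finsupp.linearCombination R B g := by
    rw [Finsupp.apply_linearCombination]
    congr 2
    funext i
    exact (hB i).symm
  have h2 : ((Finsupp.linearCombination R
      (fun i => (⟨v i, hv i⟩ : pageNum d Fil t r k)) g : pageNum d Fil t r k) : X) =
      Finsupp.linearCombination R v g :=
    Finsupp.apply_linearCombination R (pageNum d Fil t r k).subtype _ g
  rw [hg, B.linearCombination_repr, ← hg, Submodule.mkQ_apply, eq_comm, ← sub_eq_zero,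
    ← Submodule.Quotient.mk_sub, mk_submoduleOf_eq_zero_iff] at h1
  rw [← h2]
  exact h1

/-- A criterion for the classes of a family to be a basis over the residue field. -/
theorem classesFormBasisOver_of {R k₀ X ι : Type*} [CommRing R] [Field k₀] (ρ : R →+* k₀)
    [AddCommGroup X] [Module R X] {d : X →ₗ[R] X} {Fil : ℤ → ℕ → Submodule R X} {t r : ℤ} {k : ℕ}
    {v : ι → X} (C : k₀ → R) (hC : ∀ y, ρ (C y) = y) (hv : ∀ i, v i ∈ pageNum d Fil t r k)
    (hker : ∀ c, ρ c = 0 → ∀ x ∈ pageNum d Fil t r k, c • x ∈ pageDen d Fil t r k)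
    (hli : ∀ g : ι →₀ k₀, (∑ i ∈ g.support, C (g i) • v i) ∈ pageDen d Fil t r k → g = 0)
    (hspan : ∀ x ∈ pageNum d Fil t r k, ∃ g : ι →₀ k₀,
      x - ∑ i ∈ g.support, C (g i) • v i ∈ pageDen d Fil t r k) :
    ClassesFormBasisOver ρ d Fil t r k v := by
  have hker' : ∀ c, ρ c = 0 → ∀ x : Page d Fil t r k, c • x = 0 := by
    intro c hc x
    induction x using Submodule.Quotient.induction_on with
    | H x =>
      rw [← Submodule.Quotient.mk_smul, mk_submoduleOf_eq_zero_iff]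
      exact hker c hc x x.2
  -- The lift C is not a ring homomorphism. The scalar action is nevertheless a module structure
  -- because the kernel of ρ acts by zero on the page.
  let : SMul k₀ (Page d Fil t r k) := ⟨fun y x => C y • x⟩
  have hsmul : ∀ (c : R) (x : Page d Fil t r k), ρ c • x = c • x := by
    intro c x
    change C (ρ c) • x = c • x
    rw [← sub_eq_zero, ← sub_smul]
    exact hker' _ (by rw [map_sub, hC, sub_self]) x
  let hmod : Module k₀ (Page d Fil t r k) :=
    Function.Surjective.moduleLeft ρ (fun y => ⟨C y, hC y⟩) hsmul
  have hcomb : ∀ g : ι →₀ k₀, ∃ h : ∑ i ∈ g.support, C (g i) • v i ∈ pageNum d Fil t r k,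
      Finsupp.linearCombination k₀ (fun i => (Submodule.Quotient.mk ⟨v i, hv i⟩ :
        Page d Fil t r k)) g = Submodule.Quotient.mk ⟨_, h⟩ := by
    intro g
    have hmem : ∑ i ∈ g.support, C (g i) • v i ∈ pageNum d Fil t r k :=
      Submodule.sum_mem _ fun i _ => Submodule.smul_mem _ _ (hv i)
    refine ⟨hmem, ?_⟩
    have e : (⟨_, hmem⟩ : pageNum d Fil t r k) = ∑ i ∈ g.support, C (g i) • ⟨v i, hv i⟩ := by
      apply Subtype.ext
      simp
    rw [Finsupp.linearCombination_apply, Finsupp.sum, e, ← Submodule.mkQ_apply, map_sum]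
    refine Finset.sum_congr rfl fun i _ => ?_
    rw [map_smul, ← hsmul, hC]
    rfl
  refine ⟨hmod, hsmul, Module.Basis.mk
    (v := fun i => (Submodule.Quotient.mk ⟨v i, hv i⟩ : Page d Fil t r k)) ?_ ?_, fun i =>
      ⟨hv i, Module.Basis.mk_apply _ _ i⟩⟩
  · rw [linearIndependent_iff]
    intro g hg
    obtain ⟨h, hg'⟩ := hcomb g
    rw [hg', mk_submoduleOf_eq_zero_iff] at hg
    exact hli g hg
  · rintro x -
    induction x using Submodule.Quotient.induction_on with
    | H x =>
      obtain ⟨g, hg⟩ := hspan x x.2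
      obtain ⟨h, hg'⟩ := hcomb g
      have : (Submodule.Quotient.mk x : Page d Fil t r k) = Finsupp.linearCombination k₀
          (fun i => (Submodule.Quotient.mk ⟨v i, hv i⟩ : Page d Fil t r k)) g := by
        rw [hg', ← sub_eq_zero, ← Submodule.Quotient.mk_sub, mk_submoduleOf_eq_zero_iff]
        exact hg
      rw [this, Finsupp.mem_span_range_iff_exists_finsupp]
      exact ⟨g, rfl⟩

end Basis

/-! ### Homogeneous parts of polynomial forms -/

section HomPart

variable {F : Type*} [Field F] {n : ℕ}

theorem homPart_homPart (c : ℕ) (ψ : Form n (MvPolynomial (Fin n) F)) :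
    homPart c (homPart c ψ) = homPart c ψ := by
  funext S
  ext u
  rw [coeff_homPart]
  split_ifs with h
  · rfl
  · rw [coeff_homPart, if_neg h]

theorem homPart_of_isHomogeneousForm {k l : ℕ} {φ : Form n (MvPolynomial (Fin n) F)}
    (hφ : IsHomogeneousForm k l φ) (c : ℕ) : homPart c φ = if l = c then φ else 0 := by
  funext S
  ext u
  rw [coeff_homPart]
  by_cases h0 : coeff u (φ S) = 0
  · split_ifs <;> simp [h0]
  have hu : u.degree = l := by
    by_contra h
    exact h0 ((hφ.2 S).coeff_eq_zero h)
  rw [hu]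
  split_ifs <;> simp

/-- The homogeneous parts of a combination of homogeneous forms. -/
theorem homPart_linearCombination {I : Type*} {m : ℕ} {l : I → ℕ}
    {φ : I → Form n (MvPolynomial (Fin n) F)} (hφ : ∀ i, IsHomogeneousForm m (l i) (φ i))
    (c w : ℕ) (g : I →₀ F) :
    homPart c (Finsupp.linearCombination F φ g) =
      Finsupp.linearCombination F (fun i : {i // l i + w = c + w} => φ i)
        (g.subtypeDomain fun i => l i + w = c + w) := by
  -- The common summand w is kept in the index condition so that the subtype is literally the one
  -- indexing the basis in degree c + w, the degree shifted by (n - m)(δ - 1).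
  have : (homPart c).comp (Finsupp.linearCombination F φ) =
      (Finsupp.linearCombination F (fun i : {i // l i + w = c + w} => φ i)).comp
        (Finsupp.lsubtypeDomain {i | l i + w = c + w}) := by
    refine Finsupp.lhom_ext fun i a => ?_
    rw [LinearMap.comp_apply, LinearMap.comp_apply, Finsupp.linearCombination_single, map_smul,
      homPart_of_isHomogeneousForm (hφ i)]
    change _ = Finsupp.linearCombination F _ ((Finsupp.single i a).subtypeDomain
      fun i => l i + w = c + w)
    by_cases h : l i = c
    · have e : (Finsupp.single i a).subtypeDomain (fun i => l i + w = c + w) =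
          Finsupp.single ⟨i, by rw [h]⟩ a := by
        classical
        ext j
        rw [Finsupp.subtypeDomain_apply, Finsupp.single_apply, Finsupp.single_apply]
        simp only [Subtype.ext_iff]
      rw [if_pos h, e, Finsupp.linearCombination_single]
    · have e : (Finsupp.single i a).subtypeDomain (fun i => l i + w = c + w) = 0 := by
        classical
        ext j
        rw [Finsupp.subtypeDomain_apply, Finsupp.single_apply, if_neg]
        · rfl
        · rintro rfl
          exact h (by have := j.2; omega)
      rw [if_neg h, e, map_zero, smul_zero]
  exact LinearMap.congr_fun this g

theorem sum_homPart (ψ : Form n (MvPolynomial (Fin n) F)) :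
    ∃ B, ψ = ∑ c ∈ Finset.range B, homPart c ψ := by
  refine ⟨(Finset.univ.sup fun S => (ψ S).totalDegree) + 1, ?_⟩
  funext S
  ext u
  rw [Finset.sum_apply, coeff_sum]
  simp only [coeff_homPart, Finset.sum_ite_eq, Finset.mem_range]
  split_ifs with hu
  · rfl
  · refine coeff_eq_zero_of_totalDegree_lt (lt_of_le_of_lt
      (Finset.le_sup (f := fun S => (ψ S).totalDegree) (Finset.mem_univ S)) ?_)
    change (Finset.univ.sup fun S => (ψ S).totalDegree) < u.degree
    omega

end HomPart

/-! ### Reduction of forms and the transfer of bases -/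

section Comparison

variable {L : Type*} [NormedField L] [IsUltrametricDist L] {F : Type*} [Field F] {n : ℕ}
  {p q v : ℕ} {π : L} {ρ : integerRing L →+* F} {N d e : ℕ} {θ : L}
  {g : Fin n → MvPolynomial (Fin n) L} {g₀ : Fin n → MvPolynomial (Fin n) F}
  {D : Form n (MvPowerSeries (Fin n) L) →ₗ[integerRing L] Form n (MvPowerSeries (Fin n) L)}

theorem norm_normCoeff_le_one (hπ : π ≠ 0) {k : ℕ}
    {ω : Form n (MvPowerSeries (Fin n) L)} (hω : ω ∈ dworkFormFil n π N 0 k)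
    (S : Finset (Fin n)) (u : Fin n →₀ ℕ) : ‖normCoeff π N u (ω S)‖ ≤ 1 := by
  simpa using norm_normCoeff_le hπ hω S u

theorem ResEq.add (hπ : π ≠ 0) {k : ℕ} {ω η : Form n (MvPowerSeries (Fin n) L)}
    {ψ χ : Form n (MvPolynomial (Fin n) F)} (hω : ω ∈ dworkFormFil n π N 0 k)
    (hη : η ∈ dworkFormFil n π N 0 k) (h1 : ResEq ρ π N ω ψ) (h2 : ResEq ρ π N η χ) :
    ResEq ρ π N (ω + η) (ψ + χ) := by
  intro S u
  rw [Pi.add_apply, Pi.add_apply, normCoeff_add, res_add ρ (norm_normCoeff_le_one hπ hω S u)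
    (norm_normCoeff_le_one hπ hη S u), h1, h2, coeff_add]

theorem ResEq.sub (hπ : π ≠ 0) {k : ℕ} {ω η : Form n (MvPowerSeries (Fin n) L)}
    {ψ χ : Form n (MvPolynomial (Fin n) F)} (hω : ω ∈ dworkFormFil n π N 0 k)
    (hη : η ∈ dworkFormFil n π N 0 k) (h1 : ResEq ρ π N ω ψ) (h2 : ResEq ρ π N η χ) :
    ResEq ρ π N (ω - η) (ψ - χ) := by
  intro S u
  rw [Pi.sub_apply, Pi.sub_apply, normCoeff_sub, res_sub ρ (norm_normCoeff_le_one hπ hω S u)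
    (norm_normCoeff_le_one hπ hη S u), h1, h2, coeff_sub]

theorem ResEq.smul (hπ : π ≠ 0) {k : ℕ} {ω : Form n (MvPowerSeries (Fin n) L)}
    {ψ : Form n (MvPolynomial (Fin n) F)} (hω : ω ∈ dworkFormFil n π N 0 k)
    (h1 : ResEq ρ π N ω ψ) (c : integerRing L) : ResEq ρ π N (c • ω) (ρ c • ψ) := by
  intro S u
  change res ρ (normCoeff π N u ((c : L) • ω S)) = _
  rw [normCoeff_smul, res_mul ρ (mem_integerRing.1 c.2) (norm_normCoeff_le_one hπ hω S u),
    res_coe, h1, Pi.smul_apply, coeff_smul, smul_eq_mul]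

theorem resEq_zero : ResEq ρ π N (0 : Form n (MvPowerSeries (Fin n) L)) 0 := by
  intro S u
  rw [Pi.zero_apply, normCoeff_zero, res_zero, Pi.zero_apply, coeff_zero]

theorem ResEq.sum (hπ : π ≠ 0) {k : ℕ} {ι : Type*} (t : Finset ι)
    {ω : ι → Form n (MvPowerSeries (Fin n) L)} {ψ : ι → Form n (MvPolynomial (Fin n) F)}
    (hω : ∀ i ∈ t, ω i ∈ dworkFormFil n π N 0 k) (h1 : ∀ i ∈ t, ResEq ρ π N (ω i) (ψ i)) :
    ResEq ρ π N (∑ i ∈ t, ω i) (∑ i ∈ t, ψ i) := by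
  classical
  induction t using Finset.induction_on with
  | empty => exact resEq_zero
  | insert i t hi ih =>
    have ht : ∀ j ∈ t, ω j ∈ dworkFormFil n π N 0 k := fun j hj => hω j (by simp [hj])
    rw [Finset.sum_insert hi, Finset.sum_insert hi]
    exact ResEq.add hπ (hω i (by simp)) (Submodule.sum_mem _ ht) (h1 i (by simp))
      (ih ht fun j hj => h1 j (by simp [hj]))

theorem ResEq.mem_one (h : IsUnif p q v π ρ) {k : ℕ} {ω : Form n (MvPowerSeries (Fin n) L)}
    (hω : ω ∈ dworkFormFil n π N 0 k) (h1 : ResEq ρ π N ω 0) : ω ∈ dworkFormFil n π N 1 k := by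
  refine ⟨fun S => (mem_dworkFil h.pi_ne_zero).2
    ⟨((mem_dworkFil h.pi_ne_zero).1 (hω.1 S)).1, fun u => ?_⟩, hω.2⟩
  rw [zpow_one]
  refine h.gap _ ((h.res_eq_zero_iff (norm_normCoeff_le_one h.pi_ne_zero hω S u)).1 ?_)
  rw [h1]
  exact coeff_zero u

theorem resEq_zero_of_mem_one (h : IsUnif p q v π ρ) {k : ℕ}
    {ω : Form n (MvPowerSeries (Fin n) L)} (hω : ω ∈ dworkFormFil n π N 1 k) :
    ResEq ρ π N ω 0 := by
  intro S u
  have h1 : ‖normCoeff π N u (ω S)‖ < 1 :=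
    (norm_normCoeff_le h.pi_ne_zero hω S u).trans_lt (by rw [zpow_one]; exact h.norm_lt)
  rw [(h.res_eq_zero_iff h1.le).2 h1]
  exact (coeff_zero u).symm

theorem ResEq.unique {ω : Form n (MvPowerSeries (Fin n) L)}
    {ψ χ : Form n (MvPolynomial (Fin n) F)} (h1 : ResEq ρ π N ω ψ) (h2 : ResEq ρ π N ω χ) :
    ψ = χ := by
  funext S
  ext u
  rw [← h1, ← h2]

/-- Because A_u tends to 0, only finitely many A_u have nonzero residue, so the reduction is a
polynomial form. -/
theorem exists_resEq (h : IsUnif p q v π ρ) {k : ℕ} {ω : Form n (MvPowerSeries (Fin n) L)}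
    (hω : ω ∈ dworkFormFil n π N 0 k) : ∃ ψ, ResEq ρ π N ω ψ := by
  classical
  have hfin : ∀ S, {u | res ρ (normCoeff π N u (ω S)) ≠ 0}.Finite := by
    intro S
    have h1 := ((mem_dworkFil h.pi_ne_zero).1 (hω.1 S)).1
    rw [NormedAddGroup.tendsto_nhds_zero] at h1
    have h2 := h1 1 one_pos
    rw [Filter.eventually_cofinite] at h2
    exact h2.subset fun u hu hlt => hu ((h.res_eq_zero_iff hlt.le).2 hlt)
  refine ⟨fun S => ∑ u ∈ (hfin S).toFinset, monomial u (res ρ (normCoeff π N u (ω S))),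
    fun S u => ?_⟩
  simp only [coeff_sum, coeff_monomial, Finset.sum_ite_eq', Set.Finite.mem_toFinset,
    Set.mem_ofPred_eq]
  split_ifs with hu
  · rfl
  · exact not_not.1 hu

namespace IsComparison

/-- D commutes with scalars of L, so multiplication by π ^ s translates the whole spectral sequence.
This reduces every r to r = 0. -/
theorem zpow_smul_mem_cycles (H : IsComparison p q v π ρ N d e θ g g₀ D) {t r s : ℤ} {k : ℕ}
    {ω : Form n (MvPowerSeries (Fin n) L)} :
    π ^ s • ω ∈ cycles D (dworkFormFil n π N) t (s + r) k ↔
      ω ∈ cycles D (dworkFormFil n π N) t r k := by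
  refine and_congr (zpow_smul_mem_dworkFormFil H.unif.pi_ne_zero) ?_
  change D (π ^ s • ω) ∈ dworkFormFil n π N (s + r + t) (k + 1) ↔
    D ω ∈ dworkFormFil n π N (r + t) (k + 1)
  rw [H.smul, add_assoc]
  exact zpow_smul_mem_dworkFormFil H.unif.pi_ne_zero

theorem zpow_smul_mem_boundaries (H : IsComparison p q v π ρ N d e θ g g₀ D) {t r : ℤ} (s : ℤ)
    {k : ℕ} {y : Form n (MvPowerSeries (Fin n) L)}
    (hy : y ∈ ⨆ (j : ℕ) (_ : j + 1 = k), (cycles D (dworkFormFil n π N) t r j).map D) :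
    π ^ s • y ∈ ⨆ (j : ℕ) (_ : j + 1 = k), (cycles D (dworkFormFil n π N) t (s + r) j).map D := by
  rw [mem_iSup_map_cycles] at *
  rcases hy with rfl | ⟨j, hj, η, hη, rfl⟩
  · exact Or.inl (smul_zero _)
  · exact Or.inr ⟨j, hj, π ^ s • η, H.zpow_smul_mem_cycles.2 hη, H.smul _ _⟩

theorem boundary_mem (_ : IsComparison p q v π ρ N d e θ g g₀ D) {t : ℤ} {k : ℕ}
    {y : Form n (MvPowerSeries (Fin n) L)}
    (hy : y ∈ ⨆ (j : ℕ) (_ : j + 1 = k), (cycles D (dworkFormFil n π N) (t - 1) (0 - t + 1) j).map D) :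
    y ∈ dworkFormFil n π N 0 k := by
  rw [mem_iSup_map_cycles] at hy
  rcases hy with rfl | ⟨j, rfl, η, hη, rfl⟩
  · exact Submodule.zero_mem _
  · have h1 : D η ∈ dworkFormFil n π N (0 - t + 1 + (t - 1)) (j + 1) := hη.2
    rwa [show 0 - t + 1 + (t - 1) = 0 by ring] at h1

/-- Reductions of boundaries. -/
theorem homPart_mem_pageDen' (H : IsComparison p q v π ρ N d e θ g g₀ D) {m : ℕ} (hm : m ≤ n)
    {t : ℤ} (ht : t = (N * (e - 1) : ℕ) + 1) {y : Form n (MvPowerSeries (Fin n) L)}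
    (hy : y ∈ ⨆ (j : ℕ) (_ : j + 1 = m),
      (cycles D (dworkFormFil n π N) (t - 1) (0 - t + 1) j).map D)
    {ψ : Form n (MvPolynomial (Fin n) F)} (hψ : ResEq ρ π N y ψ) (c : ℕ) :
    homPart c ψ ∈ pageDen (polyWedge g₀) (fun s k => polyFil n (d + 1) (-s) k) e
      (-((c + (n - m) * d : ℕ) : ℤ)) m := by
  rw [mem_iSup_map_cycles] at hy
  rcases hy with rfl | ⟨j, rfl, η, ⟨h1, h2⟩, rfl⟩
  · rw [ResEq.unique hψ resEq_zero, map_zero]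
    exact Submodule.zero_mem _
  · replace h1 : η ∈ dworkFormFil n π N (0 - t + 1) j := h1
    replace h2 : D η ∈ dworkFormFil n π N (0 - t + 1 + (t - 1)) (j + 1) := h2
    rw [show 0 - t + 1 + (t - 1) = 0 by ring] at h2
    rw [show 0 - t + 1 = -((N * (e - 1) : ℕ) : ℤ) by rw [ht]; ring] at h1
    exact H.homPart_mem_pageDen hm h1 h2 hψ c

/-- Lifts of boundaries. -/
theorem exists_boundary_of_mem_pageDen (H : IsComparison p q v π ρ N d e θ g g₀ D) {m c : ℕ}
    (hm : m ≤ n) {t : ℤ} (ht : t = (N * (e - 1) : ℕ) + 1)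
    {ψ : Form n (MvPolynomial (Fin n) F)}
    (hψ : ψ ∈ pageDen (polyWedge g₀) (fun s k => polyFil n (d + 1) (-s) k) e
      (-((c + (n - m) * d : ℕ) : ℤ)) m) :
    ∃ y ∈ ⨆ (j : ℕ) (_ : j + 1 = m),
      (cycles D (dworkFormFil n π N) (t - 1) (0 - t + 1) j).map D,
      ResEq ρ π N y (homPart c ψ) := by
  rw [pageDen, Submodule.mem_sup] at hψ
  obtain ⟨χ, hχ, ψ₂, h3, rfl⟩ := hψ
  have hhom : homPart c (χ + ψ₂) = homPart c χ := by
    rw [map_add, add_eq_left]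
    funext S
    ext u
    rw [coeff_homPart]
    simp only [mem_polyFil, Nat.add_sub_cancel] at h3
    split_ifs with hu
    · by_contra hne
      have := h3.2 S u hne
      push_cast at this
      omega
    · simp
  rw [hhom]
  rw [mem_iSup_map_cycles] at hχ
  rcases hχ with rfl | ⟨j, rfl, η, hη, rfl⟩
  · refine ⟨0, Submodule.zero_mem _, ?_⟩
    rw [map_zero]
    exact resEq_zero
  · obtain ⟨η', h1, h2, h3⟩ := H.exists_boundary_of_mem hm hη
    refine ⟨D η', mem_iSup_map_cycles.2 (Or.inr ⟨j, rfl, η', ⟨?_, ?_⟩, rfl⟩), h3⟩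
    · rw [show 0 - t + 1 = -((N * (e - 1) : ℕ) : ℤ) by rw [ht]; ring]
      exact h1
    · change D η' ∈ dworkFormFil n π N (0 - t + 1 + (t - 1)) (j + 1)
      rw [show 0 - t + 1 + (t - 1) = 0 by ring]
      exact h2

/-- The basis theorem for any differential satisfying the comparison hypotheses. -/
theorem classesFormBasisOver (H : IsComparison p q v π ρ N d e θ g g₀ D) {m : ℕ} (hm : m ≤ n)
    {t : ℤ} (ht : t = (N * (e - 1) : ℕ) + 1) {I : Type*} {l : I → ℕ}
    {φ : I → Form n (MvPolynomial (Fin n) F)} (hφ : ∀ i, IsHomogeneousForm m (l i) (φ i))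
    (hbasis : ∀ r : ℕ, ClassesFormBasis (polyWedge g₀) (fun s k => polyFil n (d + 1) (-s) k) e
      (-r) m (fun i : {i : I // l i + (n - m) * d = r} => φ i))
    {φt : I → Form n (MvPowerSeries (Fin n) L)} (hφt : ∀ i, φt i ∈ dworkFormFil n π N 0 m)
    (hres : ∀ i, ResEq ρ π N (φt i) (φ i)) (r : ℤ) :
    ClassesFormBasisOver ρ D (dworkFormFil n π N) t r m (fun i => π ^ r • φt i) := by
  have h := H.unif
  have hπ := h.pi_ne_zero
  choose C hC using h.lift
  have hscale : ∀ {k : ℕ} {s : ℤ} {ω : Form n (MvPowerSeries (Fin n) L)},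
      ω ∈ dworkFormFil n π N s k → ∀ a : ℤ, π ^ a • ω ∈ dworkFormFil n π N (a + s) k :=
    fun hω a => (zpow_smul_mem_dworkFormFil hπ).2 hω
  have hinv : ∀ (a : ℤ) (ω : Form n (MvPowerSeries (Fin n) L)), π ^ a • π ^ (-a) • ω = ω := by
    intro a ω
    rw [smul_smul, ← zpow_add₀ hπ, add_neg_cancel, zpow_zero, one_smul]
  have hcomb : ∀ γ : I →₀ F, ∑ i ∈ γ.support, C (γ i) • φt i ∈ dworkFormFil n π N 0 m ∧
      ResEq ρ π N (∑ i ∈ γ.support, C (γ i) • φt i) (Finsupp.linearCombination F φ γ) := by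
    intro γ
    refine ⟨Submodule.sum_mem _ fun i _ => Submodule.smul_mem _ _ (hφt i), ?_⟩
    rw [Finsupp.linearCombination_apply, Finsupp.sum]
    refine ResEq.sum (k := m) hπ _ (fun i _ => Submodule.smul_mem _ _ (hφt i)) fun i _ => ?_
    have := ResEq.smul hπ (hφt i) (hres i) (C (γ i))
    rwa [(hC (γ i)).1] at this
  have hcombr : ∀ γ : I →₀ F, ∑ i ∈ γ.support, C (γ i) • π ^ r • φt i =
      π ^ r • ∑ i ∈ γ.support, C (γ i) • φt i := by
    intro γ
    rw [Finset.smul_sum]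
    refine Finset.sum_congr rfl fun i _ => ?_
    exact smul_comm ((C (γ i) : L)) (π ^ r) (φt i)
  refine classesFormBasisOver_of ρ C (fun y => (hC y).1) ?_ ?_ ?_ ?_
  -- The given lift need not be a cycle. Some cycle has the same reduction, and the two differ by an
  -- element of filtration one higher.
  · intro i
    have h1 := (hbasis (l i + (n - m) * d)).mem ⟨i, rfl⟩
    obtain ⟨ω, hω, hDω, hωr⟩ := H.exists_cycle_of_mem_pageNum h1
    rw [homPart_of_isHomogeneousForm (hφ i), if_pos rfl] at hωr
    have h2 := ResEq.sub hπ (hφt i) hω (hres i) hωr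
    rw [sub_self] at h2
    have h3 := hscale (ResEq.mem_one h (Submodule.sub_mem _ (hφt i) hω) h2) r
    rw [smul_sub] at h3
    rw [pageNum, Submodule.mem_sup]
    refine ⟨π ^ r • ω, ?_, _, h3, by abel⟩
    have h4 := H.zpow_smul_mem_cycles (t := t) (r := 0) (s := r) (k := m) (ω := ω)
    rw [add_zero] at h4
    refine h4.2 ⟨hω, ?_⟩
    change D ω ∈ dworkFormFil n π N (0 + t) (m + 1)
    rw [zero_add, ht]
    exact hDω
  -- An element of the kernel of ρ is divisible by π, hence moves filtration r into filtration r +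
  -- 1.
  · intro c hc x hx
    rw [pageDen, Submodule.mem_sup]
    refine ⟨0, Submodule.zero_mem _, c • x, ?_, zero_add _⟩
    have hxr : x ∈ dworkFormFil n π N r m := by
      refine (sup_le inf_le_left ?_ : pageNum D (dworkFormFil n π N) t r m ≤ _) hx
      exact dworkFormFil_anti hπ h.norm_lt.le (by omega)
    have hcn : ‖(c : L) / π‖ ≤ 1 := by
      rw [norm_div]
      exact (div_le_one h.norm_pos).2 (h.gap _ ((h.ker c).1 hc))
    have h1 := hscale (smul_mem_dworkFormFil hπ hxr hcn) 1
    rw [zpow_one, smul_smul, mul_div_cancel₀ _ hπ, add_comm 1 r] at h1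
    exact h1
  -- Linear independence: after division by π ^ r the boundary y has reduction ∑ γ i φ i, whose
  -- homogeneous parts are boundaries on E_e. Each part involves only the basis elements of one
  -- degree, so its coefficients vanish.
  · intro γ hγ
    rw [hcombr, pageDen, Submodule.mem_sup] at hγ
    obtain ⟨y, hy, z, hz, hyz⟩ := hγ
    obtain ⟨hω, hωr⟩ := hcomb γ
    set ω := ∑ i ∈ γ.support, C (γ i) • φt i with hωdef
    have hy' := H.zpow_smul_mem_boundaries (-r) hy
    rw [show -r + (r - t + 1) = 0 - t + 1 by ring] at hy'
    have hz' := hscale hz (-r)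
    rw [neg_add_cancel_left] at hz'
    have hyω : π ^ (-r) • y = ω - π ^ (-r) • z := by
      have : π ^ (-r) • (y + z) = ω := by
        rw [hyz]
        simpa using hinv (-r) ω
      rw [← this, smul_add, add_sub_cancel_right]
    have hyr : ResEq ρ π N (π ^ (-r) • y) (Finsupp.linearCombination F φ γ) := by
      rw [hyω]
      have := ResEq.sub hπ hω (dworkFormFil_anti hπ h.norm_lt.le zero_le_one hz') hωr
        (resEq_zero_of_mem_one h hz')
      rwa [sub_zero] at this
    ext i
    have h1 := H.homPart_mem_pageDen' hm ht hy' hyr (l i)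
    rw [homPart_linearCombination hφ (l i) ((n - m) * d)] at h1
    have h2 := (hbasis (l i + (n - m) * d)).eq_zero h1
    exact DFunLike.congr_fun h2 ⟨i, rfl⟩
  -- Spanning: each homogeneous part of the reduction of a cycle is a combination of the φ i of that
  -- degree plus a boundary. The finitely many boundaries lift, and the remainder has zero
  -- reduction.
  · intro x hx
    rw [pageNum, Submodule.mem_sup] at hx
    obtain ⟨y, hy, z, hz, rfl⟩ := hx
    have hcyc : π ^ (-r) • y ∈ cycles D (dworkFormFil n π N) t 0 m := by
      rw [← H.zpow_smul_mem_cycles (s := r), hinv, add_zero]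
      exact hy
    set ω := π ^ (-r) • y with hωdef
    have hω : ω ∈ dworkFormFil n π N 0 m := hcyc.1
    have hDω : D ω ∈ dworkFormFil n π N (0 + t) (m + 1) := hcyc.2
    rw [zero_add, ht] at hDω
    obtain ⟨ψ, hψ⟩ := exists_resEq h hω
    -- Taking the part of degree c once more discards the lower terms left over in E_e, so distinct
    -- degrees do not interfere when the results are summed.
    have hc : ∀ c : ℕ, ∃ γ : {i : I // l i + (n - m) * d = c + (n - m) * d} →₀ F,
        ∃ b ∈ ⨆ (j : ℕ) (_ : j + 1 = m),
          (cycles D (dworkFormFil n π N) (t - 1) (0 - t + 1) j).map D,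
        ResEq ρ π N b (homPart c ψ - Finsupp.linearCombination F φ
          (γ.mapDomain Subtype.val)) := by
      intro c
      obtain ⟨γ, hγ⟩ := (hbasis (c + (n - m) * d)).exists_sub_mem
        (H.homPart_mem_pageNum hω hDω hψ c)
      obtain ⟨b, hb, hbr⟩ := H.exists_boundary_of_mem_pageDen hm ht hγ
      refine ⟨γ, b, hb, ?_⟩
      rw [Finsupp.linearCombination_mapDomain]
      rw [map_sub, homPart_homPart] at hbr
      convert hbr using 2
      have h1 := homPart_linearCombination hφ c ((n - m) * d) (γ.mapDomain Subtype.val)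
      rw [Finsupp.linearCombination_mapDomain] at h1
      refine Eq.trans ?_ h1.symm
      change Finsupp.linearCombination F _ γ = _
      congr 1
      ext i
      rw [Finsupp.subtypeDomain_apply, Finsupp.mapDomain_apply Subtype.val_injective]
    choose γ b hb hbr using hc
    obtain ⟨B, hB⟩ := sum_homPart ψ
    set Γ : I →₀ F := ∑ c ∈ Finset.range B, (γ c).mapDomain Subtype.val with hΓ
    refine ⟨Γ, ?_⟩
    obtain ⟨hωΓ, hωΓr⟩ := hcomb Γ
    have hbsum := ResEq.sum hπ (Finset.range B) (fun c _ => H.boundary_mem (hb c))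
      (fun c _ => hbr c)
    have hbmem : ∑ c ∈ Finset.range B, b c ∈ ⨆ (j : ℕ) (_ : j + 1 = m),
        (cycles D (dworkFormFil n π N) (t - 1) (0 - t + 1) j).map D :=
      Submodule.sum_mem _ fun c _ => hb c
    rw [Finset.sum_sub_distrib, ← hB, ← map_sum, ← hΓ] at hbsum
    have h1 := ResEq.sub hπ (Submodule.sub_mem _ hω hωΓ) (H.boundary_mem hbmem)
      (ResEq.sub hπ hω hωΓ hψ hωΓr) hbsum
    rw [sub_self] at h1
    have h2 := hscale (ResEq.mem_one h (Submodule.sub_mem _ (Submodule.sub_mem _ hω hωΓ)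
      (H.boundary_mem hbmem)) h1) r
    have h3 := H.zpow_smul_mem_boundaries r hbmem
    rw [show r + (0 - t + 1) = r - t + 1 by ring] at h3
    rw [smul_sub, smul_sub, hωdef, hinv] at h2
    rw [hcombr, pageDen, Submodule.mem_sup]
    exact ⟨_, h3, _, Submodule.add_mem _ h2 hz, by abel⟩

end IsComparison

end Comparison

/-! ### The orders of γ_l, the inequalities on b, and the conclusion -/

section Final

/-- The total sum is zero, so a partial sum is minus the tail and obeys the ultrametric bound of the
tail. -/
theorem norm_partial_sum_le {K : Type*} [NormedField K] [IsUltrametricDist K] {f : ℕ → K}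
    (hf : HasSum f 0) {B : ℝ} (hB : 0 ≤ B) {l : ℕ} (hl : ∀ i, l ≤ i → ‖f i‖ ≤ B) :
    ‖∑ i ∈ Finset.range l, f i‖ ≤ B := by
  have h1 := (hf.tendsto_sum_nat.sub_const (∑ i ∈ Finset.range l, f i)).norm
  rw [zero_sub, norm_neg] at h1
  refine le_of_tendsto h1 ?_
  filter_upwards [Filter.eventually_ge_atTop l] with k hk
  rw [← Finset.sum_range_add_sum_Ico f hk, add_sub_cancel_left]
  exact IsUltrametricDist.norm_sum_le_of_forall_le_of_nonneg hB fun i hi =>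
    hl i (Finset.mem_Ico.1 hi).1

/-- The i-th term of the series has π-order G (p^i - (p-1) i), nondecreasing in i. As γ_l is minus
the tail from i = l + 1, its order is at least that of the first tail term; multiplication by p^l
adds G (p-1) l. -/
theorem norm_gamma_sum_mul_le {K : Type*} [NormedField K] [IsUltrametricDist K] {p G : ℕ}
    (hp : 1 < p) {π γ : K} (hπ : 0 < ‖π‖) (hπ1 : ‖π‖ ≤ 1)
    (hpn : ‖(p : K)‖ = ‖π‖ ^ (G * (p - 1))) (hγ : ‖γ‖ = ‖π‖ ^ G)
    (hsum : HasSum (fun i : ℕ => γ ^ p ^ i / (p : K) ^ i) 0) (l : ℕ) :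
    ‖(∑ i ∈ Finset.range (l + 1), γ ^ p ^ i / (p : K) ^ i) * (p : K) ^ l‖ ≤
      ‖π‖ ^ ((G : ℤ) * (p ^ (l + 1) - (p - 1))) := by
  have hterm : ∀ i : ℕ, ‖γ ^ p ^ i / (p : K) ^ i‖ =
      ‖π‖ ^ ((G : ℤ) * (p ^ i - (p - 1) * i)) := by
    intro i
    rw [norm_div, norm_pow, norm_pow, hpn, hγ, ← pow_mul, ← pow_mul, mul_sub, zpow_sub₀ hπ.ne',
      ← zpow_natCast, ← zpow_natCast]
    push_cast [Nat.cast_sub hp.le]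
    rw [mul_assoc]
  have hmono : ∀ i : ℕ, l + 1 ≤ i →
      (p : ℤ) ^ (l + 1) - (p - 1) * (l + 1 : ℕ) ≤ p ^ i - (p - 1) * i := by
    intro i hi
    induction i, hi using Nat.le_induction with
    | base => exact le_rfl
    | succ i hi ih =>
      refine ih.trans ?_
      have h1 : (1 : ℤ) ≤ (p : ℤ) ^ i := one_le_pow₀ (by exact_mod_cast hp.le)
      have h2 : (0 : ℤ) ≤ (p : ℤ) - 1 := by
        have : (1 : ℤ) ≤ p := by exact_mod_cast hp.le
        linarith
      rw [pow_succ]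
      push_cast
      nlinarith
  have hle := norm_partial_sum_le hsum (B := ‖π‖ ^ ((G : ℤ) * (p ^ (l + 1) -
    (p - 1) * (l + 1 : ℕ)))) (by positivity) (l := l + 1) fun i hi => by
      rw [hterm]
      exact zpow_le_zpow_right_of_le_one₀ hπ hπ1
        (mul_le_mul_of_nonneg_left (hmono i hi) (by positivity))
  rw [norm_mul, norm_pow, hpn, ← pow_mul]
  calc _ ≤ ‖π‖ ^ ((G : ℤ) * (p ^ (l + 1) - (p - 1) * (l + 1 : ℕ))) *
        ‖π‖ ^ (G * (p - 1) * l) := by gcongr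
    _ = _ := by
      rw [← zpow_natCast, ← zpow_add₀ hπ.ne']
      congr 1
      push_cast [Nat.cast_sub hp.le]
      ring

variable {L : Type*} [NormedField L] [IsUltrametricDist L] {F : Type*} [Field F] {n : ℕ}
  {p q v : ℕ} {π : L} {ρ : integerRing L →+* F}

theorem dworkD_smul (γ : L) (ε : ℤ) (fhat : MvPolynomial (Fin n) L) (c : L)
    (ω : Form n (MvPowerSeries (Fin n) L)) :
    dworkD p π γ ε fhat (c • ω) = c • dworkD p π γ ε fhat ω := by
  funext T
  rw [dworkD, Pi.smul_apply, formDiff_apply, formDiff_apply, Finset.smul_sum]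
  refine Finset.sum_congr rfl fun i _ => ?_
  rw [Pi.smul_apply, dworkDi, LinearMap.restrictScalars_apply, LinearMap.restrictScalars_apply,
    map_smul, smul_comm]

/-- The partial derivatives of a Teichmüller lift are lifts of the partial derivatives. -/
theorem isLift_pderiv (h : IsUnif p q v π ρ) {f : MvPolynomial (Fin n) F} {d : ℕ}
    (hd : f.totalDegree = d + 1) {fhat : MvPolynomial (Fin n) (integerRing L)}
    (hf : IsTeichmuellerLift ρ q fhat f) :
    (∀ u, ‖coeff u (map (integerRing L).subtype fhat)‖ ≤ 1) ∧
    (∀ u, coeff u (map (integerRing L).subtype fhat) ≠ 0 → u.degree ≤ d + 1) ∧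
    IsLift p q ρ d (fun i => pderiv i (map (integerRing L).subtype fhat))
      (fun i => pderiv i f) := by
  have hcoe : ∀ u, coeff u (map (integerRing L).subtype fhat) = ((coeff u fhat : integerRing L) : L) := fun u =>
    coeff_map _ _ _
  have hn : ∀ u, ‖coeff u (map (integerRing L).subtype fhat)‖ ≤ 1 := fun u => by
    rw [hcoe]; exact mem_integerRing.1 (coeff u fhat).2
  have hres : ∀ u, res ρ (coeff u (map (integerRing L).subtype fhat)) = coeff u f := fun u => by
    rw [hcoe, res_coe, ← hf.2, coeff_map]
  have hfix : ∀ u, coeff u (map (integerRing L).subtype fhat) ^ q =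
      coeff u (map (integerRing L).subtype fhat) := fun u => by
    rw [hcoe]; exact congrArg Subtype.val (hf.1 u)
  -- The lift has no extra monomials: a nonzero coefficient with zero residue would have norm below
  -- 1, contradicting invariance under the q-th power.
  have hdeg : ∀ u, coeff u (map (integerRing L).subtype fhat) ≠ 0 → u.degree ≤ d + 1 := by
    intro u hu
    have hfu : coeff u f ≠ 0 := by
      rw [← hres]
      intro h0
      have hlt := (h.res_eq_zero_iff (hn u)).1 h0
      have h1 := pow_lt_self_of_lt_one₀ (norm_pos_iff.2 hu) hlt h.one_lt_q
      rw [← norm_pow, hfix] at h1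
      exact lt_irrefl _ h1
    by_contra hlt
    refine hfu (coeff_eq_zero_of_totalDegree_lt ?_)
    rw [hd]
    exact not_le.1 hlt
  refine ⟨hn, hdeg, fun i u => ?_, fun i u => ?_, fun i u hu => ?_⟩
  · rw [coeff_pderiv]
    refine h.fixed_mul ⟨hn _, ?_⟩ (by exact_mod_cast h.fixed_natCast (u i + 1))
    rw [hfix, sub_self, norm_zero]
    exact norm_nonneg _
  · rw [coeff_pderiv, coeff_pderiv, ← Nat.cast_add_one, res_mul ρ (hn _)
      (IsUltrametricDist.norm_natCast_le_one _ _), hres, res_natCast, Nat.cast_add_one]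
  · rw [coeff_pderiv] at hu
    have h1 := hdeg _ (left_ne_zero_of_mul hu)
    simpa using h1

/-- Dwork's differential satisfies the comparison hypotheses. -/
theorem isComparison_dworkD (h : IsUnif p q v π ρ) {f : MvPolynomial (Fin n) F} {d : ℕ}
    (hd : f.totalDegree = d + 1) {fhat : MvPolynomial (Fin n) (integerRing L)}
    (hf : IsTeichmuellerLift ρ q fhat f) {G N E e : ℕ} {γ : L} (hγn : ‖γ‖ = ‖π‖ ^ G)
    (hE : E + N * (d + 1) = G * p) (hE0 : 1 ≤ E) (hN : 0 < N) (he : 0 < e)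
    (hγ : ∀ l, ‖gammaPartial p γ l * (p : L) ^ l‖ ≤ ‖π‖ ^ ((G : ℤ) * (p ^ (l + 1) - (p - 1))))
    (ht : N * (e - 1) + 1 ≤ (p - 1) * E) (ht' : N * (e - 1) + 1 + G ≤ N * (d + 1))
    (hv : N * (e - 1) < v) :
    IsComparison p q v π ρ N d e (γ / π ^ G)
      (fun i => pderiv i (map (integerRing L).subtype fhat)) (fun i => pderiv i f)
      (dworkD p π γ (((N * d : ℕ) : ℤ) - G) (map (integerRing L).subtype fhat)) := by
  obtain ⟨hn, hdeg, hlift⟩ := isLift_pderiv h hd hf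
  refine ⟨h, hlift, hN, he, hv, ?_, dworkD_smul γ _ _, fun k ω hω => ⟨fun T => ?_, fun T hT => ?_⟩⟩
  · rw [norm_div, norm_pow, hγn, div_self (pow_pos h.norm_pos _).ne']
  · rw [Pi.sub_apply, Pi.smul_apply, dworkD, leadMap, formDiff_apply, formDiff_apply,
      Finset.smul_sum, ← Finset.sum_sub_distrib]
    refine Submodule.sum_mem _ fun i _ => ?_
    rw [smul_comm, ← smul_sub]
    refine zsmul_mem ?_ _
    have := dworkDi_sub_mem h (by omega) hE hE0 hγ hn hdeg i ht ht' (hω.1 (T.erase i))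
    rw [LinearMap.mulLeft_apply, smul_mul_assoc]
    exact_mod_cast this
  · rw [Pi.sub_apply, Pi.smul_apply, dworkD, leadMap, formDiff_eq_zero _ hω.2 hT,
      formDiff_eq_zero _ hω.2 hT, smul_zero, sub_zero]

/-- The inequalities on the parameters in terms of natural numbers. -/
theorem exponent_bounds {p δ e M N G : ℕ} {b : ℚ} (hp : 1 < p) (he : 1 ≤ e) (heδ : e ≤ δ)
    (hM : 0 < M) (hN : (N : ℚ) = M * b) (hG : G * (p - 1) = M * δ)
    (hb : (δ : ℚ) / (((p : ℚ) - 1) * ((δ : ℚ) - e + 1)) < b)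
    (hb' : b < (p : ℚ) * δ / (((p : ℚ) - 1) * δ + e - 1)) :
    0 < N ∧ N * (e - 1) < M * δ ∧ N * (e - 1) + 1 + G ≤ N * δ ∧
      ∃ E, E + N * δ = G * p ∧ 1 ≤ E ∧ N * (e - 1) + 1 ≤ (p - 1) * E := by
  obtain ⟨r, rfl⟩ : ∃ r, p = r + 1 + 1 := ⟨p - 2, by omega⟩
  obtain ⟨i, rfl⟩ : ∃ i, e = i + 1 := ⟨e - 1, by omega⟩
  obtain ⟨k, rfl⟩ : ∃ k, δ = i + 1 + k := ⟨δ - (i + 1), by omega⟩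
  simp only [Nat.add_sub_cancel] at *
  have hM' : (0 : ℚ) < M := by exact_mod_cast hM
  -- The lower bound on b without denominators. With G (p - 1) = M δ it says G < N (δ - e + 1), so
  -- the derivative term has order Nδ - G above N (e - 1).
  have h1 : M * (i + 1 + k) < N * ((r + 1) * (k + 1)) := by
    rw [div_lt_iff₀ (by push_cast; ring_nf; positivity)] at hb
    have := mul_lt_mul_of_pos_left hb hM'
    rw [← mul_assoc, ← hN] at this
    push_cast at this
    have h' : ((M * (i + 1 + k) : ℕ) : ℚ) < ((N * ((r + 1) * (k + 1)) : ℕ) : ℚ) := by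
      push_cast
      linarith
    exact_mod_cast h'
  -- The upper bound on b without denominators. It is equivalent to N (e - 1) < (p - 1)(Gp - Nδ),
  -- the bound needed for the terms l ≥ 1 of Hᵢ, and it contains Nδ < Gp.
  have h2 : N * ((r + 1) * (i + 1 + k) + i) < (r + 1 + 1) * (M * (i + 1 + k)) := by
    rw [lt_div_iff₀ (by push_cast; ring_nf; positivity)] at hb'
    have := mul_lt_mul_of_pos_left hb' hM'
    rw [← mul_assoc, ← hN] at this
    push_cast at this
    have h' : ((N * ((r + 1) * (i + 1 + k) + i) : ℕ) : ℚ) <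
        (((r + 1 + 1) * (M * (i + 1 + k)) : ℕ) : ℚ) := by
      push_cast
      linarith
    exact_mod_cast h'
  have h3 : G < N * (k + 1) := by
    rw [← hG] at h1
    refine Nat.lt_of_mul_lt_mul_right (a := r + 1) ?_
    calc _ < _ := h1
      _ = _ := by ring
  have hlt : N * (i + 1 + k) < G * (r + 1 + 1) := by
    refine Nat.lt_of_mul_lt_mul_left (a := r + 1) ?_
    rw [← hG] at h2
    calc (r + 1) * (N * (i + 1 + k)) ≤ N * ((r + 1) * (i + 1 + k) + i) := by
          rw [mul_left_comm]; exact Nat.mul_le_mul_left _ (Nat.le_add_right _ _)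
      _ < _ := h2
      _ = _ := by ring
  refine ⟨Nat.pos_of_ne_zero ?_, ?_, ?_, G * (r + 1 + 1) - N * (i + 1 + k), ?_, ?_, ?_⟩
  · rintro rfl
    simp at h1
  -- For b ≥ 1, replacing N by M in the summand N (p - 1) δ of the upper bound leaves N (e - 1) < M
  -- δ. For b < 1 it suffices that e - 1 < δ.
  · rcases le_or_gt M N with hMN | hMN
    · have h4 : M * ((r + 1) * (i + 1 + k)) ≤ N * ((r + 1) * (i + 1 + k)) :=
        Nat.mul_le_mul_right _ hMN
      have h5 : (r + 1 + 1) * (M * (i + 1 + k)) =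
        M * ((r + 1) * (i + 1 + k)) + M * (i + 1 + k) := by ring
      rw [Nat.mul_add] at h2
      omega
    · calc N * i ≤ M * i := Nat.mul_le_mul_right _ hMN.le
        _ < M * (i + 1 + k) := Nat.mul_lt_mul_of_pos_left (by omega) hM
  · have : N * (i + 1 + k) = N * i + N * (k + 1) := by ring
    omega
  · omega
  · omega
  · obtain ⟨E, hE⟩ := Nat.exists_eq_add_of_lt hlt
    rw [hE]
    have h5 : N * (i + 1 + k) + E + 1 - N * (i + 1 + k) = E + 1 := by omega
    rw [h5]
    rw [← hG] at h2
    have h6 : (r + 1 + 1) * (G * (r + 1)) = (r + 1) * (N * (i + 1 + k) + E + 1) := by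
      rw [← hE]; ring
    have h7 : (r + 1) * (N * (i + 1 + k) + E + 1) =
        N * ((r + 1) * (i + 1 + k)) + (r + 1) * (E + 1) := by ring
    rw [h6, h7, Nat.mul_add] at h2
    omega

end Final

end DworkSS

end

theorem theorem3p1 (p : ℕ) [Fact p.Prime] (a n : ℕ)
    (F : Type*) [Field F] [Finite F] (hF : Nat.card F = p ^ a)
    (f : MvPolynomial (Fin n) F) (δ : ℕ) (hδ : f.totalDegree = δ)
    (e m : ℕ) (he : 1 ≤ e) (heδ : e ≤ δ) (hm : m ≤ n)
    (b : ℚ) (hb : (δ : ℚ) / (((p : ℚ) - 1) * ((δ : ℚ) - e + 1)) < b)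
    (hb' : b < (p : ℚ) * δ / (((p : ℚ) - 1) * δ + e - 1))
    (M N : ℕ) (hM : 0 < M) (hN : (N : ℚ) = M * b) (hpN : p ∣ N) (hMδ : p * (p - 1) ∣ M * δ)
    (ζ π : ℂ_[p]) (hζ : IsPrimitiveRoot ζ p)
    (hπ : π ^ (M * δ) = -(p : ℂ_[p]) ∨ (π ^ (M * δ) = (p : ℂ_[p]) ∧ (p = 2 ∨ Even a)))
    (ρ : DworkSS.integerRing (DworkSS.omegaTilde p a ζ π) →+* F)
    (γ : DworkSS.omegaTilde p a ζ π) (hγ : (γ : ℂ_[p]) ∈ DworkSS.omegaOne p ζ)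
    (hγsum : HasSum (fun i : ℕ => (γ : ℂ_[p]) ^ p ^ i / (p : ℂ_[p]) ^ i) 0)
    (hγord : ‖(γ : ℂ_[p])‖ ^ (p - 1) = ‖(p : ℂ_[p])‖)
    (fhat : MvPolynomial (Fin n) (DworkSS.integerRing (DworkSS.omegaTilde p a ζ π)))
    (hfhat : DworkSS.IsTeichmuellerLift ρ (p ^ a) fhat f)
    (I : Type*) (l : I → ℕ)
    (φ : I → DworkSS.Form n (MvPolynomial (Fin n) F))
    (hφ : ∀ i, DworkSS.IsHomogeneousForm m (l i) (φ i))
    (hbasis : ∀ r : ℕ, DworkSS.PolyBasis f e r m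
      (fun i : {i : I // l i + (n - m) * (δ - 1) = r} => φ i))
    (φt : I → DworkSS.Form n (MvPowerSeries (Fin n) (DworkSS.omegaTilde p a ζ π)))
    (hφt : ∀ i, DworkSS.Reduces ρ (DworkSS.piElt p a ζ π) N m (φt i) (φ i)) :
    ∀ r : ℤ, DworkSS.ClassesFormBasisOver ρ
      (DworkSS.dworkD p (DworkSS.piElt p a ζ π) γ
        (((N * (δ - 1) : ℕ) : ℤ) - ((M * δ / (p - 1) : ℕ) : ℤ))
        (MvPolynomial.map (DworkSS.integerRing (DworkSS.omegaTilde p a ζ π)).subtype fhat))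
      (DworkSS.dworkFormFil n (DworkSS.piElt p a ζ π) N)
      ((N : ℤ) * ((e : ℤ) - 1) + 1) r m
      (fun i => (DworkSS.piElt p a ζ π) ^ r • φt i) := by
  have hp : p.Prime := Fact.out
  obtain ⟨d, rfl⟩ : ∃ d, δ = d + 1 := ⟨δ - 1, by omega⟩
  have hpv : p - 1 ∣ M * (d + 1) := (dvd_mul_left _ _).trans hMδ
  set G := M * (d + 1) / (p - 1) with hGdef
  have hG : G * (p - 1) = M * (d + 1) := Nat.div_mul_cancel hpv
  obtain ⟨hN0, hlt, ht', E, hE, hE0, ht⟩ :=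
    DworkSS.exponent_bounds hp.one_lt he heδ hM hN hG hb hb'
  have h := DworkSS.isUnif_omegaTilde hF (Nat.mul_pos hM d.succ_pos) hpv hζ hπ ρ
  have hpn : ‖(p : ℂ_[p])‖ = ‖π‖ ^ (G * (p - 1)) := by
    rw [hG]
    exact h.norm_p
  have hγn : ‖γ‖ = ‖DworkSS.piElt p a ζ π‖ ^ G := by
    change ‖(γ : ℂ_[p])‖ = ‖π‖ ^ G
    have hp1 : p - 1 ≠ 0 := Nat.sub_ne_zero_of_lt hp.one_lt
    refine (pow_left_inj₀ (norm_nonneg _) (by positivity) hp1).1 ?_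
    rw [hγord, hpn, pow_mul]
  have hγl : ∀ l, ‖DworkSS.gammaPartial p γ l * (p : DworkSS.omegaTilde p a ζ π) ^ l‖ ≤
      ‖DworkSS.piElt p a ζ π‖ ^ ((G : ℤ) * (p ^ (l + 1) - (p - 1))) := by
    intro l
    have h1 := DworkSS.norm_gamma_sum_mul_le (γ := (γ : ℂ_[p])) (π := π) hp.one_lt h.norm_pos
      h.norm_lt.le hpn hγn hγsum l
    have h2 : ((DworkSS.gammaPartial p γ l * (p : DworkSS.omegaTilde p a ζ π) ^ l :
        DworkSS.omegaTilde p a ζ π) : ℂ_[p]) =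
        (∑ i ∈ Finset.range (l + 1), (γ : ℂ_[p]) ^ p ^ i / (p : ℂ_[p]) ^ i) *
          (p : ℂ_[p]) ^ l := by
      simp [DworkSS.gammaPartial]
    change ‖((DworkSS.gammaPartial p γ l * (p : DworkSS.omegaTilde p a ζ π) ^ l :
        DworkSS.omegaTilde p a ζ π) : ℂ_[p])‖ ≤ _
    rw [h2]
    exact h1
  have H := DworkSS.isComparison_dworkD h hδ hfhat hγn hE hE0 hN0 he hγl ht ht' hlt
  intro r
  simp only [DworkSS.PolyBasis, hδ] at hbasis
  refine H.classesFormBasisOver hm ?_ hφ hbasis (fun i => (hφt i).1) (fun i S u => ?_) r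
  · push_cast [Nat.cast_sub he]
    ring
  · obtain ⟨c, hc, hcρ⟩ := (hφt i).2 S u
    rw [hc, DworkSS.res_coe, hcρ]
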